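/- **Conventions.** Graphs are simple. Let $K$ be a graph, $|a-b|$ its distance; paths are simplicial, parametrized by arc length. $K$ is *$\delta$-hyperbolic* if it is connected and each side of a geodesic triangle is in the $\delta$-neighbourhood of the union of the other two; *fine* if for all $L$ and each edge $e$ only finitely many circuits of length $<L$ contain $e$. For edges $(v,a),(v,b)$, $\mathrm{Ang}_v((v,a),(v,b))\in\mathbb N\cup\{\infty\}$ is the least length of a path from $a$ to $b$ avoiding $v$. The cone $\mathrm{Cone}_{d,\theta}((v,v'),v)$ is the set of vertices $w$ with $|v-w|\le d$ that are joined to $v$ by a geodesic all of whose angles between consecutive edges are $\le\theta$ and whose first edge (if any) makes an angle $\le\theta$ with $(v,v')$. The conical $N$-neighbourhood of a geodesic is the union of the cones $\mathrm{Cone}_{N,N}(e,v)$, $e$ an edge of the geodesic and $v$ an end of $e$. A *channel* of a geodesic $g$ is a geodesic not shorter than $g$ in the conical $\epsilon$-neighbourhood of $g$. A path $q$ is a *$\Lambda$-quasi-geodesic* if $|s-t|/\Lambda\le|q(s)-q(t)|\le\Lambda|s-t|$ for all $s,t$; it is *$L$-locally* so if its subpaths of length $\le L$ are. It is a *$\mu$-local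 geodesic* if its subpaths of length $\le\mu$ are geodesic. Let $\Gamma$ be a group hyperbolic relative to a family $\mathcal G$ of subgroups, with associated $\delta$-hyperbolic graph $K$, $\delta\ge2$ an integer: $K$ is fine and $\Gamma$ acts on it with finite quotient and finite edge stabilizers, the elements of $\mathcal G$ are exactly the stabilizers of the vertices of infinite valence, and they are finitely generated. **Constants.** Put $\lambda=1000\delta$. Let $\epsilon$ and $D$ be integers that are large enough in terms of $\delta$ only; in particular every $\lambda$-quasi-geodesic lies in the $D$-neighbourhood, and (if its ends are distinct) in the conical $\epsilon$-neighbourhood, of every geodesic with the same ends. Put $\mu=(100\epsilon+\lambda^2)\cdot40\lambda$. Let $\mathrm{Capa}$ be a large enough integer, depending on $K,\delta,\epsilon$ only; in particular every geodesic of length $\mu$ has at most $\mathrm{Capa}$ channels. Put $\varphi(n)=24(n+1)\,\mathrm{Capa}\,(2\epsilon+1)\epsilon$ and $\Theta=\max\{10000(D+\epsilon+\delta),\rho\}$, where $\rho$ is any natural number (for instance a bound for the angles at vertices of finite valence, if there is one). **Cylinders.** An *$l$-coarse-piecewise-geodesic* is a $40\lambda(\epsilon+100\lambda\delta)$-local $\frac\lambda2$-quasi-geodesic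 $f$ from $x$ to $y$, contained in the $2\epsilon$-neighbourhood of a geodesic from $x$ to $y$, with a subdivision $0=c_1\le d_1\le c_2\le\dots\le d_N=\mathrm{length}(f)$ by integers such that each $f|_{[c_i,d_i]}$ is a $\mu$-local geodesic, $d_i-c_i\ge l$ for $1<i<N$, and $c_{i+1}-d_i\le\epsilon$. The cylinder $Cyl_l(x,y)$ is the set of the vertices $v$ lying on a piece $f|_{[c_i,d_i]}$ of such a path, with $|f(c_i)-v|\ge l$ if $f(c_i)\ne x$ and $|f(d_i)-v|\ge l$ if $f(d_i)\neq y$. **Slices.** A *parabolic slice* of $Cyl(a,b)$ is a singleton $\{v\}\subset Cyl(a,b)$ such that $v$ has neighbours $w,w'\in Cyl(a,b)$ with $\mathrm{Ang}_v((v,w),(v,w'))\ge\Theta$; its *angle* is the supremum of these angles over all such $w,w'$. In a cylinder $C=Cyl(a,b)$ without parabolic slice, let $N_R(x)$ (resp. $N_L(x)$) be the set of $v\in C$ with $|x-v|>100\delta$ and $|a-v|>|a-x|$ (resp. $|a-v|<|a-x|$), and let $\mathrm{Diff}(x,y)=|N_L(x)\setminus N_L(y)|-|N_L(y)\setminus N_L(x)|+|N_R(y)\setminus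 N_R(x)|-|N_R(x)\setminus N_R(y)|$. The *regular slices* are the classes of $C\setminus\{a,b\}$ under $\mathrm{Diff}=0$; $S$ comes before $S'$ if $\mathrm{Diff}(s,s')<0$ for $s\in S$, $s'\in S'$. The *ordered slice decomposition* of a cylinder $Cyl(a,b)$, $a\ne b$, with parabolic slices $\{v_1\},\dots,\{v_k\}$ (in their order along every geodesic from $a$ to $b$) is: $\{a\}$, the regular slices of $Cyl(a,v_1)$ in order, $\{v_1\}$, the regular slices of $Cyl(v_1,v_2)$ in order, $\{v_2\}$, …, the regular slices of $Cyl(v_k,b)$ in order, $\{b\}$. That of $Cyl(a,a)$ is $(\{a\})$. Its existence means that all these consecutive cylinders are finite without parabolic slice and that the list is a partition of $Cyl(a,b)$. **Theorem.** Let $p$ be a vertex of $K$, $F$ a finite subset of $\Gamma$, $n=(2\,\mathrm{Card}\,F)^3$. There is $l=10\mu+2i\epsilon$ with $1\le i\le\varphi(n)/(2\epsilon)$, depending neither on $D$ nor on $\rho$, such that for all $\alpha,\beta,\gamma\in F\cup F^{-1}$ with $\alpha\beta\gamma=1$ and $(x,y,z)=(p,\alpha p,\gamma^{-1}p)$ the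 following hold for the $l$-cylinders. 1. $Cyl(x,y)\cap B_R(x)=Cyl(x,z)\cap B_R(x)$, where $B_R(x)$ is the closed ball of radius $R=(y\cdot z)_x-4(11\mu+\varphi(n))$ and $(y\cdot z)_x$ is the Gromov product; and the analogues at $y$ and $z$ hold. 2. The three cylinders have ordered slice decompositions, of the form $$\begin{array}{lll}Cyl(x,y)&=&(S_1,\dots,S_k,\ \mathcal H_z,\ T_m,\dots,T_1)\\ Cyl(x,z)&=&(S_1,\dots,S_k,\ \mathcal H_y,\ V_q,\dots,V_1)\\ Cyl(y,z)&=&(T_1,\dots,T_m,\ \mathcal H_x,\ V_q,\dots,V_1)\end{array}$$ with $k,m,q\ge0$, where *either* each hole $\mathcal H_x,\mathcal H_y,\mathcal H_z$ consists of at most $10\varphi(n)$ consecutive slices, none of which is a parabolic slice (of the cylinder concerned) of angle more than $3\Theta+100\delta$, *or* there are no holes but a common central slice: $\mathcal H_x=\mathcal H_y=\mathcal H_z=(\{v\})$ with $\{v\}$ a parabolic slice of all three cylinders. -/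

import Mathlib

namespace CanonicalSlices

universe u v

variable {V : Type u}

/-! ### Geodesics, hyperbolicity, fineness -/

/-- A simplicial path is geodesic if its length is the distance between its ends. -/
def IsGeodesic (K : SimpleGraph V) {a b : V} (g : K.Walk a b) : Prop :=
  g.length = K.dist a b

/-- `δ`-hyperbolicity: in every geodesic triangle each side lies in the
`δ`-neighbourhood of the union of the other two. -/
def IsHyperbolic (K : SimpleGraph V) (δ : ℕ) : Prop :=
  ∀ (a b c : V) (f : K.Walk a b) (g : K.Walk b c) (h : K.Walk a c),
    IsGeodesic K f → IsGeodesic K g → IsGeodesic K h →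
      ∀ v ∈ f.support, ∃ w, (w ∈ g.support ∨ w ∈ h.support) ∧ K.dist v w ≤ δ

/-- Fineness: only finitely many circuits (simple simplicial loops, regarded as sets of edges) of
length less than `L` contain a given edge. -/
def IsFine (K : SimpleGraph V) : Prop :=
  ∀ (L : ℕ), ∀ e ∈ K.edgeSet,
    {s : Set (Sym2 V) | ∃ (x : V) (c : K.Walk x x),
      c.IsCycle ∧ c.length < L ∧ e ∈ c.edges ∧ s = {f | f ∈ c.edges}}.Finite

/-- `K` is a `δ`-hyperbolic graph associated to the group `Γ`, hyperbolic relative to the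
family `𝒢` of subgroups. -/
structure IsAssociatedGraph (Γ : Type v) [Group Γ] [MulAction Γ V] (𝒢 : Set (Subgroup Γ))
    (K : SimpleGraph V) (δ : ℕ) : Prop where
  adj_smul : ∀ (γ : Γ) (a b : V), K.Adj (γ • a) (γ • b) ↔ K.Adj a b
  connected : K.Connected
  hyperbolic : IsHyperbolic K δ
  fine : IsFine K
  finite_edge_stabilizers : ∀ a b : V, K.Adj a b →
    {γ : Γ | s(γ • a, γ • b) = s(a, b)}.Finite
  finite_vertex_orbits : ∃ T : Set V, T.Finite ∧ ∀ a : V, ∃ γ : Γ, γ • a ∈ T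
  finite_edge_orbits : ∃ T : Set (Sym2 V), T.Finite ∧
    ∀ a b : V, K.Adj a b → ∃ γ : Γ, s(γ • a, γ • b) ∈ T
  parabolics : ∀ H : Subgroup Γ,
    H ∈ 𝒢 ↔ ∃ a : V, (K.neighborSet a).Infinite ∧ MulAction.stabilizer Γ a = H
  fg_parabolics : ∀ H ∈ 𝒢, H.FG

/-! ### Angles and cones -/

/-- `Ang_v((v,a),(v,b))`: the least length of a path from `a` to `b` avoiding `v`
(`⊤` if there is none). -/
noncomputable def angle (K : SimpleGraph V) (v a b : V) : ℕ∞ :=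
  ⨅ (w : K.Walk a b) (_ : v ∉ w.support), (w.length : ℕ∞)

/-- The largest angle between consecutive edges of a path. -/
noncomputable def maxAngle (K : SimpleGraph V) {a b : V} (g : K.Walk a b) : ℕ∞ :=
  ⨆ (i : ℕ) (_ : 0 < i ∧ i < g.length),
    angle K (g.getVert i) (g.getVert (i - 1)) (g.getVert (i + 1))

/-- The cone of radius `d` and angle `θ` centred at `(e, v)`, where `e = (v, v')`. -/
def cone (K : SimpleGraph V) (d θ : ℕ) (v v' : V) : Set V :=
  {w | K.dist v w ≤ d ∧ ∃ g : K.Walk v w, IsGeodesic K g ∧ maxAngle K g ≤ θ ∧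
    (v ≠ w → angle K v v' (g.getVert 1) ≤ θ)}

/-- The union of the cones of radius and angle `N` centred at the edges of `g`. -/
def conicalNeighbourhood (K : SimpleGraph V) (N : ℕ) {a b : V} (g : K.Walk a b) : Set V :=
  {w | ∃ e ∈ g.darts, w ∈ cone K N N e.fst e.snd ∨ w ∈ cone K N N e.snd e.fst}

/-! ### Quasi-geodesics and the constants attached to them -/

/-- `Λ`-quasi-geodesic simplicial paths, in their arc length parametrization. -/
def IsQuasiGeodesic (K : SimpleGraph V) (Λ : ℕ) {a b : V} (q : K.Walk a b) : Prop :=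
  ∀ i j : ℕ, i ≤ j → j ≤ q.length →
    j - i ≤ Λ * K.dist (q.getVert i) (q.getVert j) ∧
    K.dist (q.getVert i) (q.getVert j) ≤ Λ * (j - i)

/-- All subpaths of length at most `L` are `Λ`-quasi-geodesic. -/
def IsLocalQuasiGeodesic (K : SimpleGraph V) (L Λ : ℕ) {a b : V} (q : K.Walk a b) : Prop :=
  ∀ i j : ℕ, i ≤ j → j ≤ q.length → j - i ≤ L →
    j - i ≤ Λ * K.dist (q.getVert i) (q.getVert j) ∧
    K.dist (q.getVert i) (q.getVert j) ≤ Λ * (j - i)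

/-- `Λ`-quasi-geodesics stay at distance at most `D` from geodesics with the same ends. -/
def IsStabilityConstant (K : SimpleGraph V) (Λ D : ℕ) : Prop :=
  ∀ (a b : V) (q g : K.Walk a b), IsQuasiGeodesic K Λ q → IsGeodesic K g →
    ∀ w ∈ q.support, ∃ w' ∈ g.support, K.dist w w' ≤ D

/-- `Λ`-quasi-geodesics stay in the cones of radius and angle `N` centred at the edges of
geodesics with the same ends. -/
def IsConicalConstant (K : SimpleGraph V) (Λ N : ℕ) : Prop :=
  ∀ (a b : V), a ≠ b → ∀ q g : K.Walk a b, IsQuasiGeodesic K Λ q → IsGeodesic K g →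
    ∀ w ∈ q.support, w ∈ conicalNeighbourhood K N g

/-- Every geodesic segment `g` of length `L` has at most `C` channels, a channel being a geodesic
not shorter than `g` that stays in the union of the cones of radius and angle `ε` centred at the
edges of `g`. -/
def IsChannelBound (K : SimpleGraph V) (ε L C : ℕ) : Prop :=
  ∀ (a b : V) (g : K.Walk a b), IsGeodesic K g → g.length = L →
    {s : List V | ∃ (a' b' : V) (h : K.Walk a' b'), IsGeodesic K h ∧ g.length ≤ h.length ∧
      (∀ w ∈ h.support, w ∈ conicalNeighbourhood K ε g) ∧ s = h.support}.encard ≤ C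

/-- `λ = 1000 δ`. -/
def lam (δ : ℕ) : ℕ := 1000 * δ

/-- `μ = (100 ε + λ²) · 40 λ`. -/
def mu (δ ε : ℕ) : ℕ := (100 * ε + lam δ ^ 2) * (40 * lam δ)

/-- `φ(n) = 24 (n + 1) Capa(μ) (2 ε + 1) ε`. -/
def phi (ε Cap n : ℕ) : ℕ := 24 * (n + 1) * Cap * (2 * ε + 1) * ε

/-! ### Coarse piecewise geodesics and cylinders -/

/-- `f`, with the subdivision `0 = c 0 ≤ d 0 ≤ c 1 ≤ ⋯ ≤ c N ≤ d N = length f`, is an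
`l`-coarse-piecewise-geodesic. -/
structure IsCoarsePiecewiseGeodesic (K : SimpleGraph V) (δ ε l : ℕ) {a b : V} (f : K.Walk a b)
    (N : ℕ) (c d : ℕ → ℕ) : Prop where
  local_quasi : IsLocalQuasiGeodesic K (40 * lam δ * (ε + 100 * lam δ * δ)) (500 * δ) f
  start : c 0 = 0
  finish : d N = f.length
  piece_le : ∀ i ≤ N, c i ≤ d i
  bridge_le : ∀ i < N, d i ≤ c (i + 1)
  local_geodesic : ∀ i ≤ N, ∀ s t : ℕ, c i ≤ s → s ≤ t → t ≤ d i → t - s ≤ mu δ ε →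
    K.dist (f.getVert s) (f.getVert t) = t - s
  piece_length : ∀ i, 0 < i → i < N → l ≤ d i - c i
  bridge_length : ∀ i < N, c (i + 1) - d i ≤ ε
  close : ∃ g : K.Walk a b, IsGeodesic K g ∧
    ∀ w ∈ f.support, ∃ w' ∈ g.support, K.dist w w' ≤ 2 * ε

/-- The `l`-cylinder of `x` and `y`. -/
def cylinder (K : SimpleGraph V) (δ ε l : ℕ) (x y : V) : Set V :=
  {v | ∃ (f : K.Walk x y) (N : ℕ) (c d : ℕ → ℕ), IsCoarsePiecewiseGeodesic K δ ε l f N c d ∧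
    ∃ i ≤ N, ∃ t : ℕ, c i ≤ t ∧ t ≤ d i ∧ f.getVert t = v ∧
      (f.getVert (c i) ≠ x → l ≤ K.dist (f.getVert (c i)) v) ∧
      (f.getVert (d i) ≠ y → l ≤ K.dist (f.getVert (d i)) v)}

/-- The Gromov product `(y · z)_x`. -/
noncomputable def gromovProduct (K : SimpleGraph V) (x y z : V) : ℝ :=
  ((K.dist x y : ℝ) + K.dist x z - K.dist y z) / 2

/-- `Cyl(x, y)` and `Cyl(x, z)` have the same trace on the ball of centre `x` and
radius `(y · z)_x - r`. -/
def CylindersAgree (K : SimpleGraph V) (δ ε l r : ℕ) (x y z : V) : Prop :=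
  cylinder K δ ε l x y ∩ {v | (K.dist x v : ℝ) ≤ gromovProduct K x y z - r} =
    cylinder K δ ε l x z ∩ {v | (K.dist x v : ℝ) ≤ gromovProduct K x y z - r}

/-! ### Slices -/

/-- `{v}` is a parabolic slice of the cylinder `C`. -/
def IsParabolicSlice (K : SimpleGraph V) (Θ : ℕ) (C : Set V) (v : V) : Prop :=
  v ∈ C ∧ ∃ w ∈ C, ∃ w' ∈ C, K.Adj v w ∧ K.Adj v w' ∧ (Θ : ℕ∞) ≤ angle K v w w'

/-- The angle of the (parabolic) slice `{v}` of the cylinder `C`. -/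
noncomputable def sliceAngle (K : SimpleGraph V) (C : Set V) (v : V) : ℕ∞ :=
  ⨆ (w ∈ C) (w' ∈ C) (_ : K.Adj v w) (_ : K.Adj v w'), angle K v w w'

/-- `N_R(x)`, for a cylinder `C` issued from `a`. -/
def rightSet (K : SimpleGraph V) (δ : ℕ) (C : Set V) (a x : V) : Set V :=
  {v | v ∈ C ∧ K.dist a x < K.dist a v ∧ 100 * δ < K.dist x v}

/-- `N_L(x)`, for a cylinder `C` issued from `a`. -/
def leftSet (K : SimpleGraph V) (δ : ℕ) (C : Set V) (a x : V) : Set V :=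
  {v | v ∈ C ∧ K.dist a v < K.dist a x ∧ 100 * δ < K.dist x v}

/-- The difference `Diff(x, y)` of two points of a cylinder `C` issued from `a`. -/
noncomputable def difference (K : SimpleGraph V) (δ : ℕ) (C : Set V) (a x y : V) : ℤ :=
  ((leftSet K δ C a x \ leftSet K δ C a y).ncard : ℤ)
    - ((leftSet K δ C a y \ leftSet K δ C a x).ncard : ℤ)
    + ((rightSet K δ C a y \ rightSet K δ C a x).ncard : ℤ)
    - ((rightSet K δ C a x \ rightSet K δ C a y).ncard : ℤ)

/-- `S` is a regular slice of `Cyl(a, b)`: a class of `Cyl(a, b) \ {a, b}` for the relation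
`Diff = 0`. -/
def IsRegularSlice (K : SimpleGraph V) (δ ε l : ℕ) (a b : V) (S : Set V) : Prop :=
  ∃ x ∈ cylinder K δ ε l a b \ {a, b},
    S = {y | y ∈ cylinder K δ ε l a b \ {a, b} ∧
      difference K δ (cylinder K δ ε l a b) a x y = 0}

/-- `Cyl(a, b)` is a (finite) cylinder without parabolic slice, and `R` is the list of its regular
slices in their order from `a` to `b`. The sign: `Diff(x, y)` is negative when `y` is further
from `a` than `x` is. -/
structure IsRegularSliceList (K : SimpleGraph V) (δ ε l Θ : ℕ) (a b : V) (R : List (Set V)) :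
    Prop where
  finite : (cylinder K δ ε l a b).Finite
  no_parabolic : ∀ v, ¬ IsParabolicSlice K Θ (cylinder K δ ε l a b) v
  mem_iff : ∀ S, S ∈ R ↔ IsRegularSlice K δ ε l a b S
  sorted : R.Pairwise fun S S' =>
    ∀ x ∈ S, ∀ y ∈ S', difference K δ (cylinder K δ ε l a b) a x y < 0

/-- `IsSliceSequence b a [v₁, …, v_k] L`: the list `L` consists of the regular slices of
`Cyl(a, v₁)`, then `{v₁}`, then the regular slices of `Cyl(v₁, v₂)`, then `{v₂}`, and so on up to
the regular slices of `Cyl(v_k, b)` and `{b}`. -/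
def IsSliceSequence (K : SimpleGraph V) (δ ε l Θ : ℕ) (b : V) :
    V → List V → List (Set V) → Prop
  | a, [], L => ∃ R, IsRegularSliceList K δ ε l Θ a b R ∧ L = R ++ [{b}]
  | a, v :: vs, L => ∃ R L', IsRegularSliceList K δ ε l Θ a v R ∧
      IsSliceSequence K δ ε l Θ b v vs L' ∧ L = R ++ {v} :: L'

/-- `L` is the ordered slice decomposition of `Cyl(a, b)`, and it is a partition of it. -/
structure IsSliceDecomposition (K : SimpleGraph V) (δ ε l Θ : ℕ) (a b : V) (L : List (Set V)) :
    Prop where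
  /-- If `a ≠ b`, the list starts with `{a}` and runs through the parabolic slices, in the order
  in which geodesics from `a` to `b` meet them, the regular slices between them, and `{b}`. -/
  sequence : a ≠ b → ∃ (vs : List V) (L' : List (Set V)),
    (∀ v, v ∈ vs ↔ IsParabolicSlice K Θ (cylinder K δ ε l a b) v) ∧
    (∀ g : K.Walk a b, IsGeodesic K g → vs.Sublist g.support) ∧
    IsSliceSequence K δ ε l Θ b a vs L' ∧ L = {a} :: L'
  degenerate : a = b → L = [{a}]
  disjoint : L.Pairwise Disjoint
  cover : (⋃ S ∈ L, S) = cylinder K δ ε l a b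

/-- A hole in the decomposition of the cylinder `C`: at most `M` slices, none of which is a
parabolic slice of angle more than `A`. -/
def IsHole (K : SimpleGraph V) (Θ M A : ℕ) (C : Set V) (H : List (Set V)) : Prop :=
  H.length ≤ M ∧ ∀ v, {v} ∈ H → IsParabolicSlice K Θ C v → sliceAngle K C v ≤ A

/-- The three cylinders of the triangle `(x, y, z)` have slice decompositions
`(S, H_z, T reversed)`, `(S, H_y, W reversed)`, `(T, H_x, W reversed)`, the holes having at most
`M` slices and no parabolic slice of angle more than `A`; or they have
decompositions of the form
`(S, {v}, T reversed)`, `(S, {v}, W reversed)`, `(T, {v}, W reversed)` where `{v}` is a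
parabolic slice of all three. -/
def SlicesFormTripod (K : SimpleGraph V) (δ ε l Θ M A : ℕ) (x y z : V) : Prop :=
  ∃ S T W : List (Set V),
    (∃ Hx Hy Hz : List (Set V),
      IsSliceDecomposition K δ ε l Θ x y (S ++ Hz ++ T.reverse) ∧
      IsSliceDecomposition K δ ε l Θ x z (S ++ Hy ++ W.reverse) ∧
      IsSliceDecomposition K δ ε l Θ y z (T ++ Hx ++ W.reverse) ∧
      IsHole K Θ M A (cylinder K δ ε l x y) Hz ∧
      IsHole K Θ M A (cylinder K δ ε l x z) Hy ∧
      IsHole K Θ M A (cylinder K δ ε l y z) Hx) ∨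
    (∃ v : V,
      IsParabolicSlice K Θ (cylinder K δ ε l x y) v ∧
      IsParabolicSlice K Θ (cylinder K δ ε l x z) v ∧
      IsParabolicSlice K Θ (cylinder K δ ε l y z) v ∧
      IsSliceDecomposition K δ ε l Θ x y (S ++ [{v}] ++ T.reverse) ∧
      IsSliceDecomposition K δ ε l Θ x z (S ++ [{v}] ++ W.reverse) ∧
      IsSliceDecomposition K δ ε l Θ y z (T ++ [{v}] ++ W.reverse))

end CanonicalSlices

open CanonicalSlices

/-!
# Canonical slices in triangles of cylinders

*Quasi-geodesics.* In a hyperbolic graph quasi-geodesics are stable (`quasiGeodesic_near_geodesic`),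
and a quasi-geodesic avoiding a vertex `v` is seen from `v` under an angle bounded in terms of its
distance to `v` (`angle_le_of_quasiGeodesic`). This gives the conical constant. Coarse piecewise
geodesics are global quasi-geodesics (`isQG_of_local`): the position of the projection to the
accompanying geodesic is a function on an interval which is locally expanding, and such a function
cannot come back. Fineness makes cones finite, and the cocompact action bounds their cardinality
(`exists_cone_bound`); hence a shell of a cylinder has a bounded number of vertices.

*Slices.* A vertex between `a` and `b` at which geodesics to `a` and to `b` make a large angle lies
on every quasi-geodesic from `a` to `b`, and cuts the cylinder into the cylinders of its two halves
(`Wide.cylinder_eq`). The parabolic slices are such vertices, so that slice decompositions exist and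
can be concatenated. In a finite cylinder the function `difference` is the coboundary of a height,
and the regular slices are the level sets of the latter. Far from the ends of the cylinder, all this
depends only on the cylinder near the given vertex, so two cylinders with the same origin that agree
near it have a long common prefix of slices (`IsSliceDecomposition.exists_common_prefix`).

*Agreement of cylinders.* Let `v` be a vertex of the cylinder of `x` and `y`, close to `x`, lying on
a piece of a piecewise geodesic `f`. One can leave `f` inside a piece before the centre of the
triangle and follow a geodesic to `z` (`IsPre.switch`). If the piece met by `f` at a given position
`P₀` is longer by a margin than the required `l`, this shows that `v` is in the cylinder of `x` and
`z`. So a failure for the length `l` yields a path with a short piece at the position `P₀`, an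
`IsObstruction`. If two lengths fail with paths having the same segment of length `μ` there, at the
same distance modulo `2 ε + 1` from the ends of their pieces, then splicing the paths
(`IsPre.splice`) gives a piecewise geodesic with a long piece, a contradiction
(`IsObstruction.false_of_eq`). As the possible segments are bounded in number, each oriented side of
a triangle excludes a bounded number of lengths (`ncard_not_subset_le`), and some length is good for
all the triangles considered. Nothing here involves `D` or `ρ`.

*Tripods.* In a triangle without parabolic slice common to two sides, the common prefixes at the
three corners cover the decompositions up to the holes, whose slices meet a bounded shell around the
centre. In general one cuts the triangle at a parabolic slice common to two sides, by induction on
the perimeter (`IsTameTriangle.hasTripod`), unless there is one common to the three sides, which is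
then the central slice. A parabolic slice of large angle is common to two sides, since the angles
between the direction to the third vertex and those to the two ends cannot both be small; so the
holes contain no such slice.
-/

namespace CanonicalSlices

variable {V : Type*} {K : SimpleGraph V}

/-! ### Edge paths and geodesics parametrized by integers -/

/-- `q 0, …, q n` are the successive vertices of a simplicial path. -/
def IsEdgePath (K : SimpleGraph V) (q : ℕ → V) (n : ℕ) : Prop :=
  ∀ k < n, K.Adj (q k) (q (k + 1))

/-- `g 0, …, g n` are the successive vertices of a geodesic. -/
def IsGeoFun (K : SimpleGraph V) (g : ℕ → V) (n : ℕ) : Prop :=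
  ∀ i j, i ≤ j → j ≤ n → K.dist (g i) (g j) = j - i

/-- The vertex `p` lies on some geodesic from `a` to `b`. -/
def Btw (K : SimpleGraph V) (a p b : V) : Prop :=
  K.dist a p + K.dist p b = K.dist a b

/-- The lower bound in the definition of a `Λ`-quasi-geodesic (the upper one holds for every
edge path). -/
def IsQG (K : SimpleGraph V) (Λ : ℕ) (q : ℕ → V) (n : ℕ) : Prop :=
  ∀ i j, i ≤ j → j ≤ n → j - i ≤ Λ * K.dist (q i) (q j)

/-- The path `q 0, …, q m` followed by `r 0, r 1, …`. -/
def catFun (q : ℕ → V) (m : ℕ) (r : ℕ → V) : ℕ → V :=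
  fun t => if t ≤ m then q t else r (t - m)

theorem catFun_of_le {q : ℕ → V} {m : ℕ} {r : ℕ → V} {t : ℕ} (h : t ≤ m) :
    catFun q m r t = q t := if_pos h

theorem catFun_of_ge {q : ℕ → V} {m : ℕ} {r : ℕ → V} (h0 : q m = r 0) {t : ℕ} (h : m ≤ t) :
    catFun q m r t = r (t - m) := by
  unfold catFun
  split_ifs with h1
  · obtain rfl : t = m := by omega
    simp [h0]
  · rfl

theorem IsEdgePath.cat {q r : ℕ → V} {m n : ℕ} (hq : IsEdgePath K q m) (hr : IsEdgePath K r n)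
    (h0 : q m = r 0) : IsEdgePath K (catFun q m r) (m + n) := by
  intro k hk
  rcases Nat.lt_or_ge k m with h | h
  · rw [catFun_of_le h.le, catFun_of_le (by omega)]
    exact hq k h
  · rw [catFun_of_ge h0 h, catFun_of_ge h0 (by omega)]
    have := hr (k - m) (by omega)
    rwa [show k - m + 1 = k + 1 - m by omega] at this

theorem IsEdgePath.shift {q : ℕ → V} {n : ℕ} (hq : IsEdgePath K q n) {i m : ℕ} (h : i + m ≤ n) :
    IsEdgePath K (fun k => q (i + k)) m := fun k hk => hq (i + k) (by omega)

theorem IsEdgePath.mono {q : ℕ → V} {n m : ℕ} (hq : IsEdgePath K q n) (h : m ≤ n) :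
    IsEdgePath K q m := fun k hk => hq k (by omega)

theorem IsEdgePath.reverse {q : ℕ → V} {n : ℕ} (hq : IsEdgePath K q n) :
    IsEdgePath K (fun k => q (n - k)) n := by
  intro k hk
  have := hq (n - (k + 1)) (by omega)
  rw [show n - (k + 1) + 1 = n - k by omega] at this
  exact this.symm

theorem IsEdgePath.exists_walk {q : ℕ → V} {n : ℕ} (hq : IsEdgePath K q n) :
    ∃ w : K.Walk (q 0) (q n), w.length = n ∧ ∀ k ≤ n, w.getVert k = q k := by
  induction n with
  | zero =>
    refine ⟨SimpleGraph.Walk.nil, rfl, fun k hk => ?_⟩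
    rw [Nat.le_zero.1 hk]
    simp
  | succ n ih =>
    obtain ⟨w, hw, hk⟩ := ih (hq.mono (Nat.le_succ n))
    refine ⟨w.concat (hq n (Nat.lt_succ_self n)), by simp [hw], ?_⟩
    intro k hkn
    rw [SimpleGraph.Walk.concat_eq_append, SimpleGraph.Walk.getVert_append]
    split_ifs with h
    · exact hk k (by omega)
    · rw [hw] at h ⊢
      rcases (show k = n ∨ k = n + 1 by omega) with rfl | rfl
      · simp
      · simp

theorem IsEdgePath.exists_walk' {q : ℕ → V} {n : ℕ} (hq : IsEdgePath K q n) {a b : V}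
    (ha : q 0 = a) (hb : q n = b) :
    ∃ w : K.Walk a b, w.length = n ∧ ∀ k ≤ n, w.getVert k = q k := by
  subst ha hb
  exact hq.exists_walk

theorem isEdgePath_getVert {a b : V} (w : K.Walk a b) : IsEdgePath K w.getVert w.length :=
  fun _ hk => w.adj_getVert_succ hk

theorem IsEdgePath.dist_le {q : ℕ → V} {n : ℕ} (hq : IsEdgePath K q n) {i j : ℕ} (hij : i ≤ j)
    (hj : j ≤ n) : K.dist (q i) (q j) ≤ j - i := by
  have h := hq.shift (i := i) (m := j - i) (by omega)
  have e : i + (j - i) = j := by omega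
  obtain ⟨w, hw, -⟩ := h.exists_walk' rfl (congrArg q e)
  exact (SimpleGraph.dist_le w).trans hw.le

theorem mem_support_iff_getVert {a b v : V} (w : K.Walk a b) :
    v ∈ w.support ↔ ∃ k ≤ w.length, w.getVert k = v := by
  rw [SimpleGraph.Walk.mem_support_iff_exists_getVert]
  exact ⟨fun ⟨k, h1, h2⟩ => ⟨k, h2, h1⟩, fun ⟨k, h1, h2⟩ => ⟨k, h2, h1⟩⟩

section Geo

theorem IsGeoFun.edgePath {g : ℕ → V} {n : ℕ} (hg : IsGeoFun K g n) : IsEdgePath K g n := by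
  intro k hk
  rw [← SimpleGraph.dist_eq_one_iff_adj, hg k (k + 1) (by omega) (by omega)]
  omega

theorem IsGeoFun.shift {g : ℕ → V} {n : ℕ} (hg : IsGeoFun K g n) {i m : ℕ} (h : i + m ≤ n) :
    IsGeoFun K (fun k => g (i + k)) m := fun a b h1 h2 => by
  rw [hg (i + a) (i + b) (by omega) (by omega)]; omega

theorem IsGeoFun.mono {g : ℕ → V} {n m : ℕ} (hg : IsGeoFun K g n) (h : m ≤ n) :
    IsGeoFun K g m := fun a b h1 h2 => hg a b h1 (by omega)

theorem IsGeoFun.reverse {g : ℕ → V} {n : ℕ} (hg : IsGeoFun K g n) :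
    IsGeoFun K (fun k => g (n - k)) n := fun a b h1 h2 => by
  rw [SimpleGraph.dist_comm, hg (n - b) (n - a) (by omega) (by omega)]; omega

theorem IsGeoFun.dist_zero {g : ℕ → V} {n : ℕ} (hg : IsGeoFun K g n) {k : ℕ} (hk : k ≤ n) :
    K.dist (g 0) (g k) = k := by rw [hg 0 k (by omega) hk]; omega

theorem IsGeoFun.dist_last {g : ℕ → V} {n : ℕ} (hg : IsGeoFun K g n) {k : ℕ} (hk : k ≤ n) :
    K.dist (g k) (g n) = n - k := hg k n hk le_rfl

theorem IsGeoFun.isQG {g : ℕ → V} {n : ℕ} (hg : IsGeoFun K g n) {Λ : ℕ} (hΛ : 1 ≤ Λ) :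
    IsQG K Λ g n := fun i j hij hj => by
  rw [hg i j hij hj]; exact Nat.le_mul_of_pos_left _ hΛ

theorem IsGeoFun.btw {g : ℕ → V} {n : ℕ} (hg : IsGeoFun K g n) {k : ℕ} (hk : k ≤ n) :
    Btw K (g 0) (g k) (g n) := by
  unfold Btw
  rw [hg.dist_zero hk, hg.dist_last hk, hg.dist_zero le_rfl]; omega

theorem Btw.symm {a p b : V} (h : Btw K a p b) : Btw K b p a := by
  unfold Btw at *
  rw [K.dist_comm (u := b), K.dist_comm (u := p) (v := a), K.dist_comm (u := b)]; omega

/-- An edge path whose length is the distance of its ends is geodesic. -/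
theorem IsEdgePath.isGeoFun (hc : K.Connected) {q : ℕ → V} {n : ℕ} (hq : IsEdgePath K q n)
    (h : n ≤ K.dist (q 0) (q n)) : IsGeoFun K q n := by
  intro i j hij hj
  have h1 := hq.dist_le (Nat.zero_le i) (by omega : i ≤ n)
  have h2 := hq.dist_le hij hj
  have h3 := hq.dist_le hj le_rfl
  have h4 := hc.dist_triangle (u := q 0) (v := q i) (w := q n)
  have h5 := hc.dist_triangle (u := q i) (v := q j) (w := q n)
  omega

theorem IsGeodesic.isGeoFun (hc : K.Connected) {a b : V} {g : K.Walk a b} (hg : IsGeodesic K g) :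
    IsGeoFun K g.getVert g.length := by
  refine (isEdgePath_getVert g).isGeoFun hc ?_
  rw [g.getVert_zero, g.getVert_length]
  exact hg.le

theorem exists_geodesic (hc : K.Connected) (a b : V) : ∃ g : K.Walk a b, IsGeodesic K g :=
  hc.exists_walk_length_eq_dist a b

theorem exists_geoFun (hc : K.Connected) (a b : V) :
    ∃ g : ℕ → V, g 0 = a ∧ g (K.dist a b) = b ∧ IsGeoFun K g (K.dist a b) := by
  obtain ⟨w, hw⟩ := exists_geodesic hc a b
  refine ⟨w.getVert, w.getVert_zero, ?_, ?_⟩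
  · rw [← show w.length = _ from hw, w.getVert_length]
  · rw [← show w.length = _ from hw]
    exact hw.isGeoFun hc

theorem IsGeoFun.length_eq {g : ℕ → V} {n : ℕ} (hg : IsGeoFun K g n) {a b : V} (ha : g 0 = a)
    (hb : g n = b) : n = K.dist a b := by
  subst ha hb; rw [hg.dist_zero le_rfl]

theorem IsGeoFun.exists_walk {g : ℕ → V} {n : ℕ} (hg : IsGeoFun K g n) {a b : V} (ha : g 0 = a)
    (hb : g n = b) :
    ∃ w : K.Walk a b, IsGeodesic K w ∧ w.length = n ∧ ∀ k ≤ n, w.getVert k = g k := by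
  obtain ⟨w, hw, hk⟩ := hg.edgePath.exists_walk' ha hb
  exact ⟨w, by rw [IsGeodesic, hw]; exact hg.length_eq ha hb, hw, hk⟩

theorem Btw.exists_geoFun (hc : K.Connected) {a p b : V} (h : Btw K a p b) :
    ∃ g : ℕ → V, g 0 = a ∧ g (K.dist a p) = p ∧ g (K.dist a b) = b ∧
      IsGeoFun K g (K.dist a b) := by
  obtain ⟨g1, h1, h2, h3⟩ := CanonicalSlices.exists_geoFun hc a p
  obtain ⟨g2, h4, h5, h6⟩ := CanonicalSlices.exists_geoFun hc p b
  have h0 : g1 (K.dist a p) = g2 0 := by rw [h2, h4]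
  have e : K.dist a p + K.dist p b = K.dist a b := h
  have hz : catFun g1 (K.dist a p) g2 0 = a := by rw [catFun_of_le (Nat.zero_le _), h1]
  have hl : catFun g1 (K.dist a p) g2 (K.dist a b) = b := by
    rw [catFun_of_ge h0 (by omega), show K.dist a b - K.dist a p = K.dist p b by omega, h5]
  refine ⟨catFun g1 (K.dist a p) g2, hz, ?_, hl, ?_⟩
  · rw [catFun_of_le le_rfl, h2]
  · refine IsEdgePath.isGeoFun hc ?_ ?_
    · rw [← e]; exact h3.edgePath.cat h6.edgePath h0
    · rw [hz, hl]

/-- Slimness of a geodesic triangle of which two sides are prescribed. -/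
theorem slim_fun (hc : K.Connected) {δ : ℕ} (hδ : IsHyperbolic K δ) {a b c p : V}
    (hp : Btw K a p b) {g h : ℕ → V} {n m : ℕ} (hg : IsGeoFun K g n) (hg0 : g 0 = b)
    (hgn : g n = c) (hh : IsGeoFun K h m) (hh0 : h 0 = a) (hhm : h m = c) :
    (∃ k ≤ n, K.dist p (g k) ≤ δ) ∨ ∃ k ≤ m, K.dist p (h k) ≤ δ := by
  obtain ⟨f, f0, fp, fb, hf⟩ := hp.exists_geoFun hc
  have e : K.dist a p + K.dist p b = K.dist a b := hp
  obtain ⟨wf, hwf, hwfl, hwfk⟩ := hf.exists_walk f0 fb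
  obtain ⟨wg, hwg, hwgl, hwgk⟩ := hg.exists_walk hg0 hgn
  obtain ⟨wh, hwh, hwhl, hwhk⟩ := hh.exists_walk hh0 hhm
  obtain ⟨w, hw, hd⟩ := hδ a b c wf wg wh hwf hwg hwh p
    ((mem_support_iff_getVert _).2 ⟨K.dist a p, by omega, by rw [hwfk _ (by omega), fp]⟩)
  rcases hw with hw | hw
  · obtain ⟨k, hk, rfl⟩ := (mem_support_iff_getVert _).1 hw
    exact Or.inl ⟨k, by omega, by rwa [← hwgk k (by omega)]⟩
  · obtain ⟨k, hk, rfl⟩ := (mem_support_iff_getVert _).1 hw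
    exact Or.inr ⟨k, by omega, by rwa [← hwhk k (by omega)]⟩

/-- Slimness of a geodesic triangle of which one side is prescribed. -/
theorem slim_fun_left (hc : K.Connected) {δ : ℕ} (hδ : IsHyperbolic K δ) {a b c p : V}
    (hp : Btw K a p b) {g : ℕ → V} {n : ℕ} (hg : IsGeoFun K g n) (hg0 : g 0 = b)
    (hgn : g n = c) :
    (∃ k ≤ n, K.dist p (g k) ≤ δ) ∨ ∃ w, Btw K a w c ∧ K.dist p w ≤ δ := by
  obtain ⟨h, h0, hm, hh⟩ := exists_geoFun hc a c
  rcases slim_fun hc hδ hp hg hg0 hgn hh h0 hm with h1 | ⟨k, hk, hd⟩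
  · exact Or.inl h1
  · exact Or.inr ⟨h k, by have := hh.btw hk; rwa [h0, hm] at this, hd⟩

theorem slim_btw (hc : K.Connected) {δ : ℕ} (hδ : IsHyperbolic K δ) {a b p : V}
    (hp : Btw K a p b) (c : V) :
    ∃ w, (Btw K b w c ∨ Btw K a w c) ∧ K.dist p w ≤ δ := by
  obtain ⟨g, h0, hm, hg⟩ := exists_geoFun hc b c
  rcases slim_fun_left hc hδ hp hg h0 hm with ⟨k, hk, hd⟩ | ⟨w, hw, hd⟩
  · exact ⟨g k, Or.inl (by have := hg.btw hk; rwa [h0, hm] at this), hd⟩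
  · exact ⟨w, Or.inr hw, hd⟩

theorem eq_of_dist_eq_zero (hc : K.Connected) {a b : V} (h : K.dist a b = 0) : a = b :=
  hc.dist_eq_zero_iff.1 h

theorem btw_left (a b : V) : Btw K a a b := by simp [Btw]

theorem btw_right (a b : V) : Btw K a b b := by simp [Btw]

/-- In a triangle `(x, y, z)`, a vertex of `[x, y]` closer to `x` than the Gromov product is close
to `[x, z]`. -/
theorem close_of_lt_gromov (hc : K.Connected) {δ : ℕ} (hδ : IsHyperbolic K δ) {x y z p : V}
    (hp : Btw K x p y) {h : ℕ → V} {m : ℕ} (hh : IsGeoFun K h m) (hh0 : h 0 = x) (hhm : h m = z)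
    (hlt : 2 * K.dist x p + 2 * δ + K.dist y z < K.dist x y + K.dist x z) :
    ∃ k ≤ m, K.dist p (h k) ≤ δ := by
  obtain ⟨g, h0, hm, hg⟩ := exists_geoFun hc y z
  rcases slim_fun hc hδ hp hg h0 hm hh hh0 hhm with ⟨k, hk, hd⟩ | h1
  · exfalso
    have h1 : K.dist y (g k) + K.dist (g k) z = K.dist y z := by
      have := hg.btw hk; rwa [h0, hm] at this
    have h2 : K.dist x p + K.dist p y = K.dist x y := hp
    have h3 := hc.dist_triangle (u := p) (v := g k) (w := y)
    have h4 := hc.dist_triangle (u := x) (v := p) (w := z)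
    have h5 := hc.dist_triangle (u := p) (v := g k) (w := z)
    have h6 := K.dist_comm (u := y) (v := g k)
    omega
  · exact h1

end Geo

/-! ### Paths confined to a set of vertices -/

/-- There is a path of length at most `m` from `a` to `b` all of whose vertices satisfy `P`. -/
def PathIn (K : SimpleGraph V) (P : V → Prop) (m : ℕ) (a b : V) : Prop :=
  ∃ w : K.Walk a b, w.length ≤ m ∧ ∀ u ∈ w.support, P u

theorem PathIn.refl {P : V → Prop} {a : V} (h : P a) (m : ℕ) : PathIn K P m a a :=
  ⟨SimpleGraph.Walk.nil, by simp, by simpa using h⟩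

theorem PathIn.symm {P : V → Prop} {m : ℕ} {a b : V} (h : PathIn K P m a b) :
    PathIn K P m b a := by
  obtain ⟨w, h1, h2⟩ := h
  exact ⟨w.reverse, by simpa using h1, by simpa using h2⟩

theorem PathIn.trans {P : V → Prop} {m n : ℕ} {a b c : V} (h : PathIn K P m a b)
    (h' : PathIn K P n b c) : PathIn K P (m + n) a c := by
  obtain ⟨w, h1, h2⟩ := h
  obtain ⟨w', h3, h4⟩ := h'
  refine ⟨w.append w', by rw [SimpleGraph.Walk.length_append]; omega, fun u hu => ?_⟩
  rcases (SimpleGraph.Walk.mem_support_append_iff _ _).1 hu with hu | hu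
  · exact h2 u hu
  · exact h4 u hu

theorem PathIn.mono {P : V → Prop} {m n : ℕ} {a b : V} (h : PathIn K P m a b) (hmn : m ≤ n) :
    PathIn K P n a b := by
  obtain ⟨w, h1, h2⟩ := h
  exact ⟨w, h1.trans hmn, h2⟩

theorem IsEdgePath.pathIn {P : V → Prop} {q : ℕ → V} {n i j : ℕ} (hq : IsEdgePath K q n)
    (hij : i ≤ j) (hj : j ≤ n) (h : ∀ k, i ≤ k → k ≤ j → P (q k)) :
    PathIn K P (j - i) (q i) (q j) := by
  have e : i + (j - i) = j := by omega
  obtain ⟨w, hw, hk⟩ := (hq.shift (i := i) (m := j - i) (by omega)).exists_walk' rfl (congrArg q e)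
  refine ⟨w, hw.le, fun u hu => ?_⟩
  obtain ⟨k, hk1, rfl⟩ := (mem_support_iff_getVert _).1 hu
  rw [hk k (by omega)]
  exact h _ (by omega) (by omega)

theorem PathIn.of_btw (hc : K.Connected) {P : V → Prop} {a b : V} (h : ∀ u, Btw K a u b → P u) :
    PathIn K P (K.dist a b) a b := by
  obtain ⟨g, h0, hm, hg⟩ := exists_geoFun hc a b
  have := hg.edgePath.pathIn (P := P) (Nat.zero_le _) le_rfl (fun k _ hk => h _ (by
    have := hg.btw hk; rwa [h0, hm] at this))
  rwa [h0, hm, Nat.sub_zero] at this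

/-! ### Stability of quasi-geodesics -/

/-- A path of length at most `2 ^ k` passes within `δ k + 1` of each vertex of a geodesic with the
same ends. -/
theorem PathIn.exists_near (hc : K.Connected) {δ : ℕ} (hδ : IsHyperbolic K δ) {P : V → Prop}
    (k : ℕ) : ∀ {m : ℕ} {a b p : V}, PathIn K P m a b → m ≤ 2 ^ k → Btw K a p b →
      ∃ u, P u ∧ K.dist p u ≤ δ * k + 1 := by
  induction k with
  | zero =>
    rintro m a b p ⟨w, h1, h2⟩ hm hp
    refine ⟨a, h2 a w.start_mem_support, ?_⟩
    have := SimpleGraph.dist_le w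
    have h3 : K.dist a p + K.dist p b = K.dist a b := hp
    rw [K.dist_comm]
    omega
  | succ k ih =>
    rintro m a b p ⟨w, h1, h2⟩ hm hp
    have hw := isEdgePath_getVert w
    have e : 2 ^ (k + 1) = 2 * 2 ^ k := pow_succ' 2 k
    have hP : ∀ t, P (w.getVert t) := fun t => h2 _ (w.getVert_mem_support t)
    have p1 := hw.pathIn (P := P) (i := 0) (j := w.length / 2) (by omega) (by omega)
      fun t _ _ => hP t
    have p2 := hw.pathIn (P := P) (i := w.length / 2) (j := w.length) (by omega) (by omega)
      fun t _ _ => hP t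
    rw [w.getVert_zero] at p1
    rw [w.getVert_length] at p2
    obtain ⟨z, hz, hd⟩ := slim_btw hc hδ hp (w.getVert (w.length / 2))
    have key : ∃ u, P u ∧ K.dist z u ≤ δ * k + 1 := by
      rcases hz with hz | hz
      · exact ih p2 (by omega) hz.symm
      · exact ih p1 (by omega) hz
    obtain ⟨u, hu, hd'⟩ := key
    refine ⟨u, hu, ?_⟩
    have := hc.dist_triangle (u := p) (v := z) (w := u)
    rw [Nat.mul_succ]
    omega

/-- A number bounded by a logarithm of a multiple of itself is bounded. -/
theorem exists_log_bound (δ c : ℕ) (hδ : 1 ≤ δ) :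
    ∃ M : ℕ, ∀ D, (∀ k, c * D ≤ 2 ^ k → D ≤ δ * k + 1) → D ≤ M := by
  set C := c * (δ + 1) with hC
  have h0 : ∀ k, 4 * C ≤ k → C * (k + 1) ≤ 2 ^ k := by
    intro k hk
    have e : 2 ^ k = 2 ^ (k / 2) * 2 ^ (k - k / 2) := by rw [← pow_add]; congr 1; omega
    have h1 : k / 2 + 1 ≤ 2 ^ (k / 2) := Nat.lt_two_pow_self
    have h2 : k - k / 2 + 1 ≤ 2 ^ (k - k / 2) := Nat.lt_two_pow_self
    rw [e]
    refine le_trans ?_ (Nat.mul_le_mul h1 h2)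
    calc C * (k + 1) ≤ C * (2 * (k - k / 2 + 1)) := Nat.mul_le_mul_left _ (by omega)
      _ = (2 * C) * (k - k / 2 + 1) := by ring
      _ ≤ _ := Nat.mul_le_mul_right _ (by omega)
  refine ⟨δ * (4 * C) + 1, fun D hD => ?_⟩
  by_contra hlt
  set k := (D - 2) / δ with hk
  have h1 : δ * k ≤ D - 2 := Nat.mul_div_le _ _
  have h2 : D - 2 < δ * (k + 1) := by
    rw [mul_comm]; exact Nat.lt_mul_of_div_lt (Nat.lt_succ_self _) (by omega)
  have h3 : 4 * C ≤ k := (Nat.le_div_iff_mul_le (by omega)).2 (by rw [mul_comm]; omega)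
  have h4 := hD k
  have h5 : ¬ c * D ≤ 2 ^ k := fun h => by have := h4 h; omega
  apply h5
  refine le_trans ?_ (h0 k h3)
  have h6 : D ≤ (δ + 1) * (k + 1) := by rw [add_mul]; omega
  calc c * D ≤ c * ((δ + 1) * (k + 1)) := Nat.mul_le_mul_left _ h6
    _ = C * (k + 1) := by rw [hC]; ring

/-- The distance from geodesics to `λ`-quasi-geodesics with the same ends is bounded by this
constant, which comes from the comparison of a logarithm with a linear function. -/
noncomputable def geoNearConst (δ : ℕ) : ℕ :=
  if h : 1 ≤ δ then (exists_log_bound δ (6 * lam δ + 2) h).choose else 0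

/-- The stability constant of `λ`-quasi-geodesics. -/
noncomputable def morseConst (δ : ℕ) : ℕ :=
  lam δ * (2 * geoNearConst δ + 1) + geoNearConst δ

theorem IsEdgePath.pathIn' {P : V → Prop} {q : ℕ → V} {n i j : ℕ} (hq : IsEdgePath K q n)
    (hi : i ≤ n) (hj : j ≤ n) (h : ∀ k ≤ n, P (q k)) :
    PathIn K P (max (j - i) (i - j)) (q i) (q j) := by
  rcases le_total i j with hij | hij
  · exact (hq.pathIn hij hj fun k _ hk => h k (by omega)).mono (le_max_left _ _)
  · exact (hq.pathIn hij hi fun k _ hk => h k (by omega)).symm.mono (le_max_right _ _)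

theorem IsQG.sub_le {Λ n : ℕ} {q : ℕ → V} (hQ : IsQG K Λ q n) {i j : ℕ} (hi : i ≤ n)
    (hj : j ≤ n) : max (j - i) (i - j) ≤ Λ * K.dist (q i) (q j) := by
  rcases le_total i j with hij | hij
  · have := hQ i j hij hj
    rw [Nat.max_le]; constructor <;> omega
  · have := hQ j i hij hi
    rw [K.dist_comm] at this
    rw [Nat.max_le]; constructor <;> omega

/-- Around the vertex of the geodesic furthest from the quasi-geodesic, at distance `D`, one can
make a detour of linear length in `D` outside the ball of radius `D`. By hyperbolicity such a detour
has exponential length. -/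
theorem geodesic_near_quasiGeodesic (hc : K.Connected) {δ : ℕ} (hδ1 : 1 ≤ δ)
    (hδ : IsHyperbolic K δ) {q : ℕ → V} {n : ℕ} (hq : IsEdgePath K q n)
    (hQ : IsQG K (lam δ) q n) {g : ℕ → V} {m : ℕ} (hg : IsGeoFun K g m) (h0 : g 0 = q 0)
    (hm : g m = q n) : ∀ i ≤ m, ∃ t ≤ n, K.dist (g i) (q t) ≤ geoNearConst δ := by
  -- `f i` is the distance from `g i` to the path `q`.
  have hex : ∀ i, ∃ D, (∃ t ≤ n, K.dist (g i) (q t) = D) ∧ ∀ t ≤ n, D ≤ K.dist (g i) (q t) := by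
    intro i
    have hne : (Finset.range (n + 1)).Nonempty := ⟨0, by simp⟩
    obtain ⟨t, ht, hmin⟩ := Finset.exists_min_image (Finset.range (n + 1))
      (fun t => K.dist (g i) (q t)) hne
    exact ⟨_, ⟨t, by simpa [Nat.lt_succ_iff] using ht, rfl⟩,
      fun s hs => hmin s (by simpa [Nat.lt_succ_iff] using hs)⟩
  choose f hf1 hf2 using hex
  obtain ⟨i0, hi0, hmax⟩ := Finset.exists_max_image (Finset.range (m + 1)) f ⟨0, by simp⟩
  have hi0 : i0 ≤ m := by simpa [Nat.lt_succ_iff] using hi0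
  have hmax : ∀ i ≤ m, f i ≤ f i0 := fun i hi => hmax i (by simpa [Nat.lt_succ_iff] using hi)
  suffices hM : f i0 ≤ geoNearConst δ by
    intro i hi
    obtain ⟨t, ht, he⟩ := hf1 i
    exact ⟨t, ht, by rw [he]; exact (hmax i hi).trans hM⟩
  set D := f i0 with hD
  -- From a vertex `g j` at distance `2 D` from `g i0`, or an end of `g`, the path `q` is
  -- reached within distance `D` and far from `g i0`.
  have leg : ∀ j ≤ m, (max (j - i0) (i0 - j) = 2 * D ∨ ((j = 0 ∨ j = m) ∧
      max (j - i0) (i0 - j) ≤ 2 * D)) → ∃ t ≤ n,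
      PathIn K (fun u => D ≤ K.dist (g i0) u) D (g j) (q t) ∧ K.dist (g j) (q t) ≤ D := by
    intro j hj h
    rcases h with h | ⟨h | h, -⟩
    · obtain ⟨t, ht, he⟩ := hf1 j
      have hle : K.dist (g j) (q t) ≤ D := by rw [he]; exact hmax j hj
      refine ⟨t, ht, (PathIn.of_btw hc fun u hu => ?_).mono hle, hle⟩
      have h1 : K.dist (g j) u + K.dist u (q t) = K.dist (g j) (q t) := hu
      have h2 := hc.dist_triangle (u := g i0) (v := u) (w := g j)
      have h3 : K.dist (g i0) (g j) = 2 * D := by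
        rw [← h]
        rcases le_total i0 j with h4 | h4
        · rw [hg i0 j h4 hj]; omega
        · rw [K.dist_comm, hg j i0 h4 hi0]; omega
      have h5 := K.dist_comm (u := g j) (v := u)
      show D ≤ _
      omega
    · subst h
      refine ⟨0, Nat.zero_le _, ?_, by rw [h0]; simp⟩
      rw [h0]
      exact PathIn.refl (P := fun u => D ≤ K.dist (g i0) u) (hf2 i0 0 (Nat.zero_le _)) _
    · subst h
      refine ⟨n, le_rfl, ?_, by rw [hm]; simp⟩
      rw [hm]
      exact PathIn.refl (P := fun u => D ≤ K.dist (g i0) u) (hf2 i0 n le_rfl) _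
  obtain ⟨t1, ht1, p1, d1⟩ := leg (i0 - 2 * D) (by omega) (by omega)
  obtain ⟨t2, ht2, p2, d2⟩ := leg (min (i0 + 2 * D) m) (by omega) (by omega)
  have p3 := hq.pathIn' (P := fun u => D ≤ K.dist (g i0) u) ht1 ht2 fun k hk => hf2 i0 k hk
  have hlen := hQ.sub_le ht1 ht2
  set a := g (i0 - 2 * D)
  set b := g (min (i0 + 2 * D) m)
  have dab : K.dist a b ≤ 4 * D := by
    rw [hg _ _ (by omega) (by omega)]; omega
  have d3 : K.dist (q t1) (q t2) ≤ 6 * D := by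
    have e1 := hc.dist_triangle (u := q t1) (v := a) (w := q t2)
    have e2 := hc.dist_triangle (u := a) (v := b) (w := q t2)
    have e3 := K.dist_comm (u := q t1) (v := a)
    omega
  have pp := (p1.trans p3).trans p2.symm
  have hbtw : Btw K a (g i0) b := by
    have e1 := hg (i0 - 2 * D) i0 (by omega) hi0
    have e2 := hg i0 (min (i0 + 2 * D) m) (by omega) (by omega)
    have e3 := hg (i0 - 2 * D) (min (i0 + 2 * D) m) (by omega) (by omega)
    unfold Btw
    rw [e1, e2, e3]; omega
  have hall : ∀ k, (6 * lam δ + 2) * D ≤ 2 ^ k → D ≤ δ * k + 1 := by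
    intro k hk
    have hle : D + max (t2 - t1) (t1 - t2) + D ≤ 2 ^ k := by
      have := Nat.mul_le_mul_left (lam δ) d3
      have e : (6 * lam δ + 2) * D = lam δ * (6 * D) + 2 * D := by ring
      omega
    obtain ⟨u, hu1, hu2⟩ := pp.exists_near hc hδ k hle hbtw
    exact hu1.trans hu2
  unfold geoNearConst
  rw [dif_pos hδ1]
  exact (exists_log_bound δ (6 * lam δ + 2) hδ1).choose_spec D hall

/-- Stability of quasi-geodesics: a vertex far from the geodesic lies between two times at which
the quasi-geodesic is close to consecutive vertices of the geodesic, hence at close times. -/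
theorem quasiGeodesic_near_geodesic (hc : K.Connected) {δ : ℕ} (hδ1 : 1 ≤ δ)
    (hδ : IsHyperbolic K δ) {q : ℕ → V} {n : ℕ} (hq : IsEdgePath K q n)
    (hQ : IsQG K (lam δ) q n) {g : ℕ → V} {m : ℕ} (hg : IsGeoFun K g m) (h0 : g 0 = q 0)
    (hm : g m = q n) {t : ℕ} (ht : t ≤ n) : ∃ i ≤ m, K.dist (q t) (g i) ≤ morseConst δ := by
  set M := geoNearConst δ with hM
  have near := geodesic_near_quasiGeodesic hc hδ1 hδ hq hQ hg h0 hm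
  classical
  let P : ℕ → Prop := fun i => ∃ s ≤ t, K.dist (g i) (q s) ≤ M
  have hP0 : P 0 := ⟨0, Nat.zero_le _, by rw [h0]; simp⟩
  set i := Nat.findGreatest P m with hi
  have hPi : P i := Nat.findGreatest_spec (P := P) (Nat.zero_le m) hP0
  have him : i ≤ m := Nat.findGreatest_le m
  obtain ⟨s, hs, hd⟩ := hPi
  refine ⟨i, him, ?_⟩
  -- Either `i` is the last index, or the next vertex of `g` is close to a later vertex of `q`.
  have key : t - s ≤ lam δ * (2 * M + 1) := by
    rcases Nat.lt_or_ge i m with h | h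
    · have hn : ¬ P (i + 1) := Nat.findGreatest_is_greatest (Nat.lt_succ_self i) h
      obtain ⟨s', hs', hd'⟩ := near (i + 1) h
      have hts : t < s' := by
        by_contra hle
        exact hn ⟨s', by omega, hd'⟩
      have h1 := hQ s s' (by omega) hs'
      have h2 := hg i (i + 1) (by omega) h
      have h3 := hc.dist_triangle (u := q s) (v := g i) (w := q s')
      have h4 := hc.dist_triangle (u := g i) (v := g (i + 1)) (w := q s')
      have h6 := K.dist_comm (u := q s) (v := g i)
      have h5 : K.dist (q s) (q s') ≤ 2 * M + 1 := by omega
      have := Nat.mul_le_mul_left (lam δ) h5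
      omega
    · have him' : i = m := le_antisymm him h
      have h1 := hQ s n (by omega) le_rfl
      rw [him', hm, K.dist_comm] at hd
      have := Nat.mul_le_mul_left (lam δ) (show K.dist (q s) (q n) ≤ 2 * M + 1 by omega)
      omega
  have h1 := hq.dist_le hs ht
  have h2 := hc.dist_triangle (u := q t) (v := q s) (w := g i)
  have h3 := K.dist_comm (u := q t) (v := q s)
  have h4 := K.dist_comm (u := q s) (v := g i)
  unfold morseConst
  rw [← hM]
  omega

theorem isQG_getVert {Λ : ℕ} {a b : V} {q : K.Walk a b} (h : IsQuasiGeodesic K Λ q) :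
    IsQG K Λ q.getVert q.length := fun i j hij hj => (h i j hij hj).1

theorem isStabilityConstant_of_morseConst_le (hc : K.Connected) {δ : ℕ} (hδ1 : 1 ≤ δ)
    (hδ : IsHyperbolic K δ) {D : ℕ} (hD : morseConst δ ≤ D) :
    IsStabilityConstant K (lam δ) D := by
  intro a b q g hq hg w hw
  obtain ⟨t, ht, rfl⟩ := (mem_support_iff_getVert _).1 hw
  obtain ⟨i, hi, h⟩ := quasiGeodesic_near_geodesic hc hδ1 hδ (isEdgePath_getVert q)
    (isQG_getVert hq) (hg.isGeoFun hc) (by simp) (by simp) ht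
  exact ⟨_, g.getVert_mem_support i, h.trans hD⟩

variable {δ : ℕ}

/-! ### Angles -/

/-- A connected `δ`-hyperbolic graph with `δ ≥ 2`. -/
structure IsHypGraph (K : SimpleGraph V) (δ : ℕ) : Prop where
  conn : K.Connected
  hyp : IsHyperbolic K δ
  two_le : 2 ≤ δ

/-- `(v, e)` is the first edge of a geodesic from `v` to `w`. -/
def FE (K : SimpleGraph V) (v e w : V) : Prop :=
  K.Adj v e ∧ K.dist v w = K.dist e w + 1

theorem PathIn.angle_le {v a b : V} {m : ℕ} (h : PathIn K (· ≠ v) m a b) : angle K v a b ≤ m := by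
  obtain ⟨w, h1, h2⟩ := h
  refine (iInf₂_le w fun hv => h2 v hv rfl).trans ?_
  exact_mod_cast h1

theorem pathIn_of_angle_le {v a b : V} {m : ℕ} (h : angle K v a b ≤ m) :
    PathIn K (· ≠ v) m a b := by
  have h1 : angle K v a b < (m : ℕ∞) + 1 := lt_of_le_of_lt h (by
    exact_mod_cast Nat.lt_succ_self m)
  obtain ⟨w, hw⟩ := iInf_lt_iff.1 h1
  obtain ⟨hv, hw⟩ := iInf_lt_iff.1 hw
  refine ⟨w, ?_, fun u hu hne => hv (hne ▸ hu)⟩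
  have : (w.length : ℕ∞) < ((m + 1 : ℕ) : ℕ∞) := by simpa using hw
  exact Nat.lt_succ_iff.1 (by exact_mod_cast this)

theorem angle_le_iff {v a b : V} {m : ℕ} : angle K v a b ≤ m ↔ PathIn K (· ≠ v) m a b :=
  ⟨pathIn_of_angle_le, PathIn.angle_le⟩

theorem le_angle_iff {v a b : V} {n : ℕ} :
    (n : ℕ∞) ≤ angle K v a b ↔ ∀ m, PathIn K (· ≠ v) m a b → n ≤ m := by
  constructor
  · intro h m hm
    exact_mod_cast h.trans hm.angle_le
  · intro h
    by_contra hlt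
    push Not at hlt
    obtain ⟨m, hm⟩ := ENat.ne_top_iff_exists.1 hlt.ne_top
    have h1 := h m (pathIn_of_angle_le hm.symm.le)
    rw [← hm] at hlt
    have : m < n := by exact_mod_cast hlt
    omega

/-- A geodesic avoids the vertices that are not between its ends. -/
theorem PathIn.avoid (hc : K.Connected) {s t v : V} (h : K.dist s t < K.dist s v + K.dist v t) :
    PathIn K (· ≠ v) (K.dist s t) s t := by
  refine PathIn.of_btw hc fun u hu he => ?_
  subst he
  have : K.dist s u + K.dist u t = K.dist s t := hu
  omega

theorem exists_FE (hc : K.Connected) {v w : V} (h : v ≠ w) : ∃ e, FE K v e w := by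
  obtain ⟨g, h0, hm, hg⟩ := exists_geoFun hc v w
  have hpos := hc.pos_dist_of_ne h
  refine ⟨g 1, ?_, ?_⟩
  · have := hg.edgePath 0 hpos
    rwa [h0] at this
  · have := hg.dist_last (k := 1) hpos
    rw [hm] at this
    omega

theorem FE.ne {v e w : V} (h : FE K v e w) : v ≠ w := by
  rintro rfl
  have := h.2
  simp at this

theorem FE.adj {v e w : V} (h : FE K v e w) : K.Adj v e := h.1

theorem FE.btw {v e w : V} (h : FE K v e w) : Btw K v e w := by
  have := SimpleGraph.dist_eq_one_iff_adj.2 h.1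
  have := h.2
  unfold Btw
  omega

theorem FE.pathIn (hc : K.Connected) {v e w : V} (h : FE K v e w) :
    PathIn K (· ≠ v) (K.dist e w) e w := by
  refine PathIn.avoid hc ?_
  have := h.2
  omega

theorem FE.of_geo {g : ℕ → V} {n : ℕ} (hg : IsGeoFun K g n) {i j : ℕ} (hij : i < j) (hj : j ≤ n) :
    FE K (g i) (g (i + 1)) (g j) := by
  refine ⟨hg.edgePath i (by omega), ?_⟩
  rw [hg i j hij.le hj, hg (i + 1) j hij hj]
  omega

theorem FE.of_geo' {g : ℕ → V} {n : ℕ} (hg : IsGeoFun K g n) {i j : ℕ} (hij : i < j) (hj : j ≤ n) :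
    FE K (g j) (g (j - 1)) (g i) := by
  refine ⟨?_, ?_⟩
  · have := hg.edgePath (j - 1) (by omega)
    rw [show j - 1 + 1 = j by omega] at this
    exact this.symm
  · have h1 := hg i j hij.le hj
    have h2 := hg i (j - 1) (by omega) (by omega)
    rw [K.dist_comm, h1, K.dist_comm, h2]
    omega

theorem FE.exists_geoFun (hc : K.Connected) {v e w : V} (h : FE K v e w) :
    ∃ g : ℕ → V, g 0 = v ∧ g 1 = e ∧ g (K.dist v w) = w ∧ IsGeoFun K g (K.dist v w) := by
  obtain ⟨g, h0, h1, h2, h3⟩ := h.btw.exists_geoFun hc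
  rw [SimpleGraph.dist_eq_one_iff_adj.2 h.1] at h1
  exact ⟨g, h0, h1, h2, h3⟩

theorem IsQG.inj {Λ n : ℕ} {q : ℕ → V} (hQ : IsQG K Λ q n) {i j : ℕ}
    (hi : i ≤ n) (hj : j ≤ n) (h : q i = q j) : i = j := by
  have := hQ.sub_le hi hj
  rw [h] at this
  simp at this
  omega

theorem IsQG.shift {Λ n : ℕ} {q : ℕ → V} (hQ : IsQG K Λ q n) {i m : ℕ} (h : i + m ≤ n) :
    IsQG K Λ (fun k => q (i + k)) m := fun a b h1 h2 => by
  have := hQ (i + a) (i + b) (by omega) (by omega)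
  show b - a ≤ Λ * K.dist (q (i + a)) (q (i + b))
  omega

theorem IsQG.mono {Λ n m : ℕ} {q : ℕ → V} (hQ : IsQG K Λ q n) (h : m ≤ n) : IsQG K Λ q m :=
  fun a b h1 h2 => hQ a b h1 (by omega)

theorem IsQG.reverse {Λ n : ℕ} {q : ℕ → V} (hQ : IsQG K Λ q n) :
    IsQG K Λ (fun k => q (n - k)) n := fun a b h1 h2 => by
  have := hQ (n - b) (n - a) (by omega) (by omega)
  rw [K.dist_comm] at this
  show b - a ≤ Λ * K.dist (q (n - a)) (q (n - b))
  omega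

/-- The length of the initial part of a quasi-geodesic after which it is far from its origin. -/
noncomputable def escapeConst (δ B : ℕ) : ℕ := lam δ * (B + morseConst δ + δ + 1)

/-- Bounds the angle at `v` between geodesics to two points of a quasi-geodesic avoiding `v`,
one of which is at distance at most `B` from `v`. -/
noncomputable def angConst (δ B : ℕ) : ℕ :=
  2 * B + 2 * escapeConst δ B + 2 * morseConst δ + 2 * δ

theorem lam_pos (H : 2 ≤ δ) : 0 < lam δ := by unfold lam; omega

/-- The path goes along the quasi-geodesic until it is far from `v`, jumps to the geodesic from
`v` to the end, and comes back along it. -/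
theorem angle_le_of_quasiGeodesic (H : IsHypGraph K δ) {q : ℕ → V} {n : ℕ}
    (hq : IsEdgePath K q n) (hQ : IsQG K (lam δ) q n) {v : V} (hv : ∀ k ≤ n, q k ≠ v) {B : ℕ}
    (hB : K.dist v (q 0) ≤ B) {e e' : V} (he : FE K v e (q 0)) (he' : FE K v e' (q n)) :
    PathIn K (· ≠ v) (angConst δ B) e e' := by
  have hc := H.conn
  set m := escapeConst δ B with hm
  have p1 := he.pathIn hc
  have d1 := he.2
  have d2 := he'.2
  unfold angConst
  rw [← hm]
  rcases Nat.lt_or_ge m n with hmn | hmn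
  · have p2 := hq.pathIn (P := (· ≠ v)) (Nat.zero_le m) hmn.le fun k _ hk => hv k (by omega)
    have hR : B + morseConst δ + δ + 1 ≤ K.dist (q 0) (q m) := by
      have h1 := hQ 0 m (Nat.zero_le _) hmn.le
      rw [hm, escapeConst, Nat.sub_zero] at h1
      rw [hm, escapeConst]
      exact Nat.le_of_mul_le_mul_left h1 (lam_pos H.two_le)
    have hR' := hq.dist_le (Nat.zero_le m) hmn.le
    obtain ⟨g, g0, gn, hg⟩ := exists_geoFun hc (q 0) (q n)
    obtain ⟨i, hi, di⟩ := quasiGeodesic_near_geodesic hc (by have := H.two_le; omega) H.hyp hq hQ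
      hg g0 gn hmn.le
    obtain ⟨g', g'0, g'1, g'n, hg'⟩ := he'.exists_geoFun hc
    have hbt : Btw K (q 0) (g i) (q n) := by have := hg.btw hi; rwa [g0, gn] at this
    have t1 := hc.dist_triangle (u := q 0) (v := g i) (w := q m)
    have c1 := K.dist_comm (u := g i) (v := q m)
    have c2 := K.dist_comm (u := v) (v := q 0)
    have c3 := K.dist_comm (u := v) (v := q m)
    have t2 := hc.dist_triangle (u := q 0) (v := v) (w := q m)
    have t5 := hc.dist_triangle (u := v) (v := q 0) (w := q m)
    rcases slim_fun_left hc H.hyp hbt hg'.reverse (c := v) (by simpa using g'n)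
      (by simpa using g'0) with ⟨k, hk, dk⟩ | ⟨z, hz, dz⟩
    · -- the jump lands on the geodesic from `v` through `e'`
      set j := K.dist v (q n) - k with hj
      have dj : K.dist v (g' j) = j := by
        have := hg'.dist_zero (k := j) (by omega); rwa [g'0] at this
      have t3 := hc.dist_triangle (u := q m) (v := g i) (w := g' j)
      have t4 := hc.dist_triangle (u := v) (v := q m) (w := g' j)
      have t6 := hc.dist_triangle (u := v) (v := g' j) (w := q m)
      have c4 := K.dist_comm (u := g' j) (v := q m)
      have p3 := PathIn.avoid hc (s := q m) (t := g' j) (v := v) (by omega)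
      have p4 := hg'.edgePath.pathIn (P := (· ≠ v)) (i := 1) (j := j) (by omega) (by omega)
        fun k hk1 hk2 h => by
          have := hg'.dist_zero (k := k) (by omega)
          rw [g'0, h] at this
          simp at this
          omega
      rw [g'1] at p4
      refine (((p1.trans p2).trans p3).trans p4.symm).mono ?_
      omega
    · exfalso
      have hz' : K.dist (q 0) z + K.dist z v = K.dist (q 0) v := hz
      have t3 := hc.dist_triangle (u := q 0) (v := z) (w := g i)
      have c4 := K.dist_comm (u := z) (v := g i)
      omega
  · have p2 := hq.pathIn (P := (· ≠ v)) (Nat.zero_le n) le_rfl fun k _ hk => hv k (by omega)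
    have p3 := (he'.pathIn hc).symm
    have h1 := hq.dist_le (Nat.zero_le n) le_rfl
    have h2 := hc.dist_triangle (u := v) (v := q 0) (w := q n)
    refine ((p1.trans p2).trans p3).mono ?_
    omega

theorem angle_right (H : IsHypGraph K δ) {q : ℕ → V} {n : ℕ}
    (hq : IsEdgePath K q n) (hQ : IsQG K (lam δ) q n) {v : V} {t : ℕ} (ht : t ≤ n)
    (hv : ∀ k, t ≤ k → k ≤ n → q k ≠ v) {B : ℕ}
    (hB : K.dist v (q t) ≤ B) {e e' : V} (he : FE K v e (q t)) (he' : FE K v e' (q n)) :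
    PathIn K (· ≠ v) (angConst δ B) e e' := by
  have e1 : t + (n - t) = n := by omega
  refine angle_le_of_quasiGeodesic H (hq.shift (i := t) (m := n - t) (by omega))
    (hQ.shift (by omega)) (fun k hk => hv _ (by omega) (by omega)) hB he ?_
  rw [e1]
  exact he'

theorem angle_left (H : IsHypGraph K δ) {q : ℕ → V} {n : ℕ}
    (hq : IsEdgePath K q n) (hQ : IsQG K (lam δ) q n) {v : V} {t : ℕ} (ht : t ≤ n)
    (hv : ∀ k ≤ t, q k ≠ v) {B : ℕ}
    (hB : K.dist v (q t) ≤ B) {e e' : V} (he : FE K v e (q t)) (he' : FE K v e' (q 0)) :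
    PathIn K (· ≠ v) (angConst δ B) e e' := by
  have e1 : n - (n - t) = t := by omega
  refine angle_right H hq.reverse hQ.reverse (t := n - t) (by omega)
    (fun k h1 h2 => hv _ (by omega)) ?_ ?_ ?_
  · rwa [e1]
  · rwa [e1]
  · simpa using he'

/-- A quasi-geodesic avoids `v` after or before any of its vertices other than `v`. -/
theorem IsQG.avoid_or {Λ n : ℕ} {q : ℕ → V} (hQ : IsQG K Λ q n) {t : ℕ}
    (ht : t ≤ n) {v : V} (hv : q t ≠ v) :
    (∀ k, t ≤ k → k ≤ n → q k ≠ v) ∨ ∀ k ≤ t, q k ≠ v := by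
  by_contra hcon
  push Not at hcon
  obtain ⟨⟨k, h1, h2, h3⟩, k', h4, h5⟩ := hcon
  have := hQ.inj h2 (h4.trans ht) (h3.trans h5.symm)
  obtain rfl : k = t := by omega
  exact hv h3

/-- If the first edges of geodesics from `v` to `s` and to `t` make an angle more than `13 δ`,
then `v` lies between `s` and `t`. -/
theorem btw_of_wide (H : IsHypGraph K δ) {v e e' s t : V} (he : FE K v e s) (he' : FE K v e' t)
    (hw : ¬ PathIn K (· ≠ v) (13 * δ) e e') : Btw K s v t := by
  have hc := H.conn
  have h2 := H.two_le
  by_contra hb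
  have hlt : K.dist s t < K.dist s v + K.dist v t :=
    lt_of_le_of_ne (hc.dist_triangle) fun h => hb h.symm
  apply hw
  obtain ⟨G, G0, G1, Gn, hG⟩ := he.exists_geoFun hc
  obtain ⟨G', G'0, G'1, G'n, hG'⟩ := he'.exists_geoFun hc
  obtain ⟨h, h0, hn, hh⟩ := exists_geoFun hc s t
  have hpos := hc.pos_dist_of_ne he.ne
  have hpos' := hc.pos_dist_of_ne he'.ne
  -- The path goes along a geodesic up to distance `2 δ + 1` from `v`.
  have leg : ∀ {G : ℕ → V} {N : ℕ} {r : ℕ}, IsGeoFun K G N → G 0 = v → 1 ≤ r → r ≤ N →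
      PathIn K (· ≠ v) (r - 1) (G 1) (G r) ∧ K.dist v (G r) = r := by
    intro G N r hG G0 h1 hr
    refine ⟨hG.edgePath.pathIn h1 hr fun k hk1 hk2 h => ?_, ?_⟩
    · have := hG.dist_zero (k := k) (by omega)
      rw [G0, h] at this
      simp at this
      omega
    · have := hG.dist_zero hr
      rwa [G0] at this
  -- From there it jumps to the opposite side, unless the two geodesics are close.
  have key : ∀ {G : ℕ → V} {s' : V} {r : ℕ}, IsGeoFun K G (K.dist v s') → G 0 = v →
      G (K.dist v s') = s' → (∃ j ≤ K.dist s t, h j = s') →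
      r = min (2 * δ + 1) (K.dist v s') → 0 < K.dist v s' →
      (2 * δ + 1 ≤ K.dist v s' → ∃ j ≤ K.dist s t, K.dist (G r) (h j) ≤ δ) →
      ∃ j ≤ K.dist s t, K.dist (G r) (h j) ≤ δ ∧ PathIn K (· ≠ v) δ (G r) (h j) := by
    intro G s' r hG G0 Gn ⟨j0, hj0, hj0'⟩ hr hpos hnear
    have hd := (leg hG G0 (r := r) (by omega) (by omega)).2
    rcases Nat.lt_or_ge (K.dist v s') (2 * δ + 1) with hlt | hge
    · clear hnear
      have e1 : r = K.dist v s' := by omega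
      refine ⟨j0, hj0, ?_, ?_⟩
      · rw [hj0', e1, Gn]; simp
      · rw [hj0', e1, Gn]
        refine PathIn.refl (P := (· ≠ v)) ?_ _
        rintro rfl
        simp at hpos
    · obtain ⟨j, hj, hd'⟩ := hnear hge
      clear hnear
      refine ⟨j, hj, hd', (PathIn.avoid hc ?_).mono hd'⟩
      have c := K.dist_comm (u := v) (v := G r)
      omega
  set r := min (2 * δ + 1) (K.dist v s) with hr
  set r' := min (2 * δ + 1) (K.dist v t) with hr'
  obtain ⟨l1, l2⟩ := leg hG G0 (r := r) (by omega) (by omega)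
  obtain ⟨l1', l2'⟩ := leg hG' G'0 (r := r') (by omega) (by omega)
  rw [G1] at l1
  rw [G'1] at l1'
  by_contra hA
  have near1 : 2 * δ + 1 ≤ K.dist v s → ∃ j ≤ K.dist s t, K.dist (G r) (h j) ≤ δ := by
    intro hge
    have hb : Btw K v (G r) s := by have := hG.btw (k := r) (by omega); rwa [G0, Gn] at this
    rcases slim_fun hc H.hyp hb hh h0 hn hG' G'0 G'n with h1 | ⟨k, hk, hd⟩
    · exact h1
    · exfalso
      apply hA
      have dk : K.dist v (G' k) = k := by have := hG'.dist_zero hk; rwa [G'0] at this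
      have t1 := hc.dist_triangle (u := v) (v := G r) (w := G' k)
      have t2 := hc.dist_triangle (u := v) (v := G' k) (w := G r)
      have c := K.dist_comm (u := G r) (v := G' k)
      have c' := K.dist_comm (u := v) (v := G r)
      have p2 := (leg hG' G'0 (r := k) (by omega) hk).1
      rw [G'1] at p2
      refine ((l1.trans (PathIn.avoid hc (by omega))).trans p2.symm).mono ?_
      omega
  have near2 : 2 * δ + 1 ≤ K.dist v t → ∃ j ≤ K.dist s t, K.dist (G' r') (h j) ≤ δ := by
    intro hge
    have hb : Btw K v (G' r') t := by have := hG'.btw (k := r') (by omega); rwa [G'0, G'n] at this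
    rcases slim_fun hc H.hyp hb hh.reverse (by simpa using hn) (by simpa using h0) hG G0 Gn with
      ⟨k, hk, hd⟩ | ⟨k, hk, hd⟩
    · exact ⟨_, by omega, hd⟩
    · exfalso
      apply hA
      have dk : K.dist v (G k) = k := by have := hG.dist_zero hk; rwa [G0] at this
      have t1 := hc.dist_triangle (u := v) (v := G' r') (w := G k)
      have t2 := hc.dist_triangle (u := v) (v := G k) (w := G' r')
      have c := K.dist_comm (u := G' r') (v := G k)
      have c' := K.dist_comm (u := v) (v := G' r')
      have p2 := (leg hG G0 (r := k) (by omega) hk).1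
      rw [G1] at p2
      refine ((l1'.trans (PathIn.avoid hc (by omega))).trans p2.symm).symm.mono ?_
      omega
  obtain ⟨j, hj, dj, pj⟩ := key hG G0 Gn ⟨0, by omega, h0⟩ hr hpos near1
  obtain ⟨j', hj', dj', pj'⟩ := key hG' G'0 G'n ⟨_, le_rfl, hn⟩ hr' hpos' near2
  clear near1 near2
  have hav : ∀ k ≤ K.dist s t, h k ≠ v := by
    intro k hk he
    have := hh.btw hk
    rw [h0, hn, he] at this
    exact hb this
  have p3 := hh.edgePath.pathIn' (P := (· ≠ v)) hj hj' hav
  have hjj : max (j' - j) (j - j') ≤ 6 * δ + 2 := by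
    have d1 : max (j' - j) (j - j') = K.dist (h j) (h j') := by
      rcases le_total j j' with hle | hle
      · rw [hh j j' hle hj']; omega
      · rw [K.dist_comm, hh j' j hle hj]; omega
    have t1 := hc.dist_triangle (u := h j) (v := G r) (w := h j')
    have t2 := hc.dist_triangle (u := G r) (v := v) (w := h j')
    have t3 := hc.dist_triangle (u := v) (v := G' r') (w := h j')
    have c1 := K.dist_comm (u := h j) (v := G r)
    have c2 := K.dist_comm (u := G r) (v := v)
    omega
  refine hA (((((l1.trans pj).trans p3).trans pj'.symm).trans l1'.symm).mono ?_)
  omega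

theorem maxAngle_le {a b : V} {g : K.Walk a b} {N : ℕ}
    (h : ∀ i, 0 < i → i < g.length →
      PathIn K (· ≠ g.getVert i) N (g.getVert (i - 1)) (g.getVert (i + 1))) :
    maxAngle K g ≤ N :=
  iSup₂_le fun i hi => (h i hi.1 hi.2).angle_le

theorem mem_conicalNeighbourhood_of_left {a b : V} {g : K.Walk a b} {N i : ℕ} (hi : i < g.length)
    {w : V} (h : w ∈ cone K N N (g.getVert i) (g.getVert (i + 1)) ∨
      w ∈ cone K N N (g.getVert (i + 1)) (g.getVert i)) : w ∈ conicalNeighbourhood K N g := by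
  have hlt : i < g.darts.length := by simpa using hi
  refine ⟨g.darts[i], List.getElem_mem hlt, ?_⟩
  rw [SimpleGraph.Walk.darts_getElem_eq_getVert]
  exact h

/-- A vertex `w` of a quasi-geodesic is joined to a nearest vertex of the geodesic by a geodesic
`h`. At each vertex `u` of `h`, the quasi-geodesic and the geodesic have parts avoiding `u` that
lead from near `u` to the same end, whence a bound for the angle of `h` at `u`. -/
theorem isConicalConstant_of_le (H : IsHypGraph K δ) {N : ℕ}
    (hN : 2 * angConst δ (morseConst δ) ≤ N) : IsConicalConstant K (lam δ) N := by
  intro a b hab q g hQ hgeo w hw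
  have hc := H.conn
  have hq := isEdgePath_getVert q
  have hQ := isQG_getVert hQ
  have hg := hgeo.isGeoFun hc
  have hlen : 0 < g.length := by rw [show g.length = _ from hgeo]; exact hc.pos_dist_of_ne hab
  obtain ⟨t, ht, rfl⟩ := (mem_support_iff_getVert _).1 hw
  -- `g i` is a vertex of `g` nearest to `w`
  obtain ⟨i, hi, hmin⟩ := Finset.exists_min_image (Finset.range (g.length + 1))
    (fun i => K.dist (q.getVert t) (g.getVert i)) ⟨0, by simp⟩
  have hi : i ≤ g.length := by simpa [Nat.lt_succ_iff] using hi
  have hmin : ∀ j ≤ g.length, K.dist (q.getVert t) (g.getVert i) ≤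
    K.dist (q.getVert t) (g.getVert j) := fun j hj => hmin j (by simpa [Nat.lt_succ_iff] using hj)
  obtain ⟨j0, hj0, dj0⟩ := quasiGeodesic_near_geodesic hc (by have := H.two_le; omega) H.hyp hq hQ
      hg (by simp) (by simp) ht
  set D := morseConst δ
  have hD : K.dist (q.getVert t) (g.getVert i) ≤ D := (hmin j0 hj0).trans dj0
  obtain ⟨h, hh⟩ := exists_geodesic hc (g.getVert i) (q.getVert t)
  have hhg := hh.isGeoFun hc
  have hhl : h.length = K.dist (g.getVert i) (q.getVert t) := hh
  have cc := K.dist_comm (u := g.getVert i) (v := q.getVert t)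
  have hDN : D ≤ N := by unfold angConst at hN; omega
  by_cases hwi : g.getVert i = q.getVert t
  · have hmem : ∀ v', q.getVert t ∈ cone K N N (g.getVert i) v' := by
      intro v'
      refine ⟨by omega, h, hh, maxAngle_le fun j h1 h2 => ?_, fun hne => absurd hwi hne⟩
      rw [hhl, hwi] at h2
      simp at h2
    rcases Nat.lt_or_ge i g.length with hlt | hge
    · exact mem_conicalNeighbourhood_of_left hlt (Or.inl (hmem _))
    · refine mem_conicalNeighbourhood_of_left (i := i - 1) (by omega) (Or.inr ?_)
      rw [show i - 1 + 1 = i by omega]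
      exact hmem _
  · have hpos : 0 < h.length := by rw [hhl]; exact hc.pos_dist_of_ne hwi
    have hΛ := lam_pos H.two_le
    have qg_g := hg.isQG (Λ := lam δ) hΛ
    have hmax : maxAngle K h ≤ N := by
      refine maxAngle_le fun j h1 h2 => ?_
      set u := h.getVert j with hu
      have d0 : K.dist (g.getVert i) u = j := by
        have := hhg.dist_zero (k := j) h2.le; rwa [h.getVert_zero] at this
      have d1 : K.dist u (q.getVert t) = h.length - j := by
        have := hhg.dist_last (k := j) h2.le; rwa [h.getVert_length] at this
      have fe1 : FE K u (h.getVert (j + 1)) (q.getVert t) := by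
        have := FE.of_geo hhg h2 le_rfl; rwa [h.getVert_length] at this
      have fe2 : FE K u (h.getVert (j - 1)) (g.getVert i) := by
        have := FE.of_geo' hhg h1 h2.le; rwa [h.getVert_zero] at this
      have hug : ∀ k ≤ g.length, g.getVert k ≠ u := by
        intro k hk he
        have := hmin k hk
        rw [he, K.dist_comm (v := u)] at this
        omega
      have c1 := K.dist_comm (u := g.getVert i) (v := u)
      rcases hQ.avoid_or ht (v := u) (fun he => by
          have e0 : K.dist u (q.getVert t) = 0 := by rw [he]; simp
          omega) with hv | hv
      · obtain ⟨e, he⟩ := exists_FE hc (v := u) (w := b)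
          (by have := hv _ ht le_rfl; rw [q.getVert_length] at this; exact this.symm)
        have r1 := angle_right H hq hQ ht hv (B := D) (by omega) fe1 (by rwa [q.getVert_length])
        have r2 := angle_right H hg.edgePath qg_g hi (fun k _ hk => hug k hk) (B := D) (by omega)
          fe2 (by rwa [g.getVert_length])
        exact (r2.trans r1.symm).mono (by omega)
      · obtain ⟨e, he⟩ := exists_FE hc (v := u) (w := a)
          (by have := hv 0 (Nat.zero_le _); rw [q.getVert_zero] at this; exact this.symm)
        have r1 := angle_left H hq hQ ht hv (B := D) (by omega) fe1 (by rwa [q.getVert_zero])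
        have r2 := angle_left H hg.edgePath qg_g hi (fun k hk => hug k (by omega)) (B := D)
          (by omega) fe2 (by rwa [g.getVert_zero])
        exact (r2.trans r1.symm).mono (by omega)
    have fe : FE K (g.getVert i) (h.getVert 1) (q.getVert t) := by
      have := FE.of_geo hhg hpos le_rfl
      rwa [h.getVert_length, h.getVert_zero] at this
    rcases hQ.avoid_or ht (v := g.getVert i) (fun he => hwi he.symm) with hv | hv
    · have hlt : i < g.length := by
        rcases Nat.lt_or_ge i g.length with hlt | hge
        · exact hlt
        · exfalso
          apply hv _ ht le_rfl
          rw [q.getVert_length, show i = g.length by omega, g.getVert_length]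
      refine mem_conicalNeighbourhood_of_left hlt (Or.inl ⟨by omega, h, hh, hmax, fun _ => ?_⟩)
      have fe' := FE.of_geo hg hlt le_rfl
      rw [g.getVert_length] at fe'
      have r1 := angle_right H hq hQ ht hv (B := D) (by omega) fe (by rwa [q.getVert_length])
      exact (r1.symm.mono (by omega)).angle_le
    · have hlt : 0 < i := by
        rcases Nat.eq_zero_or_pos i with h0 | hlt
        · exfalso
          apply hv 0 (Nat.zero_le _)
          rw [q.getVert_zero, h0, g.getVert_zero]
        · exact hlt
      refine mem_conicalNeighbourhood_of_left (i := i - 1) (by omega) (Or.inr ?_)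
      rw [show i - 1 + 1 = i by omega]
      refine ⟨by omega, h, hh, hmax, fun _ => ?_⟩
      have fe' := FE.of_geo' hg hlt hi
      rw [g.getVert_zero] at fe'
      have r1 := angle_left H hq hQ ht hv (B := D) (by omega) fe (by rwa [q.getVert_zero])
      exact (r1.symm.mono (by omega)).angle_le

/-! ### Finiteness of cones and of sets of channels -/

/-- In a fine graph, only finitely many edges make a bounded angle with a given edge. -/
theorem finite_small_angle (hfine : IsFine K) {v v' : V} (hv : K.Adj v v') (θ : ℕ) :
    {u | K.Adj v u ∧ PathIn K (· ≠ v) θ v' u}.Finite := by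
  classical
  set S := {s : Set (Sym2 V) | ∃ (x : V) (c : K.Walk x x),
      c.IsCycle ∧ c.length < θ + 3 ∧ s(v, v') ∈ c.edges ∧ s = {f | f ∈ c.edges}} with hS
  have hSfin : S.Finite := hfine (θ + 3) s(v, v') hv
  have hfin : ({v'} ∪ ⋃ s ∈ S, {u | s(u, v) ∈ s}).Finite := by
    refine (Set.finite_singleton _).union (hSfin.biUnion fun s hs => ?_)
    obtain ⟨x, c, -, -, -, rfl⟩ := hs
    refine Set.Finite.preimage (f := fun u => s(u, v)) (fun a _ b _ h => ?_)
      (s := {f | f ∈ c.edges}) (List.finite_toSet _)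
    exact Sym2.congr_left.1 h
  refine hfin.subset ?_
  rintro u ⟨hu, w, hw, hav⟩
  by_cases huv : u = v'
  · exact Or.inl huv
  refine Or.inr ?_
  have hvw : v ∉ w.bypass.support := fun h => hav v (w.support_bypass_subset_support h) rfl
  set p : K.Walk v' v := w.bypass.concat hu.symm with hp
  have hpp : p.IsPath := (w.bypass_isPath).concat hvw hu.symm
  have hcyc : (SimpleGraph.Walk.cons hv p).IsCycle := by
    rw [SimpleGraph.Walk.cons_isCycle_iff]
    refine ⟨hpp, fun h => ?_⟩
    rw [hp, SimpleGraph.Walk.edges_concat] at h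
    simp only [List.mem_append, List.concat_eq_append, List.mem_singleton] at h
    rcases h with h | h
    · exact hvw (SimpleGraph.Walk.fst_mem_support_of_mem_edges _ h)
    · rw [Sym2.eq_iff] at h
      rcases h with h | h
      · exact hv.ne h.2.symm
      · exact huv h.2.symm
  simp only [Set.mem_iUnion]
  refine ⟨_, ⟨v, _, hcyc, ?_, by simp, rfl⟩, ?_⟩
  · have := w.length_bypass_le_length
    rw [SimpleGraph.Walk.length_cons, hp, SimpleGraph.Walk.length_concat]
    omega
  · show s(u, v) ∈ (SimpleGraph.Walk.cons hv p).edges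
    simp [hp, SimpleGraph.Walk.edges_concat]

/-- The vertices reached from the edge `(v, v')` by at most `d` steps with angles at most `θ`. -/
def turnSet (K : SimpleGraph V) (θ d : ℕ) (v v' : V) : Set V :=
  {w | ∃ (q : ℕ → V) (n : ℕ), n ≤ d ∧ IsEdgePath K q n ∧ q 0 = v ∧ q n = w ∧
    (0 < n → PathIn K (· ≠ v) θ v' (q 1)) ∧
    ∀ i, 0 < i → i < n → PathIn K (· ≠ q i) θ (q (i - 1)) (q (i + 1))}

/-- A tree of finite height, finitely branching by fineness of the graph. -/
theorem finite_turnSet (hfine : IsFine K) (θ d : ℕ) :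
    ∀ {v v' : V}, K.Adj v v' → (turnSet K θ d v v').Finite := by
  induction d with
  | zero =>
    intro v v' _
    refine (Set.finite_singleton v).subset ?_
    rintro w ⟨q, n, hn, -, h0, hw, -⟩
    obtain rfl : n = 0 := by omega
    rw [← hw, h0]; rfl
  | succ d ih =>
    intro v v' hv
    refine ((Set.finite_singleton v).union ((finite_small_angle hfine hv θ).biUnion
      (t := fun u => turnSet K θ d u v ∩ {_w | K.Adj u v}) fun u hu =>
        (ih hu.1.symm).subset Set.inter_subset_left)).subset ?_
    rintro w ⟨q, n, hn, hq, h0, hw, h1, h2⟩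
    rcases Nat.eq_zero_or_pos n with rfl | hpos
    · exact Or.inl (by rw [← hw, h0]; rfl)
    · have ha : K.Adj v (q 1) := by have := hq 0 hpos; rwa [h0] at this
      refine Or.inr (Set.mem_biUnion (x := q 1) ⟨ha, h1 hpos⟩ ⟨?_, ha.symm⟩)
      refine ⟨fun k => q (1 + k), n - 1, by omega, hq.shift (by omega), rfl, ?_, ?_, ?_⟩
      · show q (1 + (n - 1)) = w
        rw [show 1 + (n - 1) = n by omega, hw]
      · intro hn1
        have := h2 1 one_pos (by omega)
        simpa [h0] using this
      · intro i hi1 hi2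
        have := h2 (1 + i) (by omega) (by omega)
        rwa [show 1 + i - 1 = 1 + (i - 1) by omega] at this

theorem finite_cone (hfine : IsFine K) (d θ : ℕ) {v v' : V}
    (hv : K.Adj v v') : (cone K d θ v v').Finite := by
  refine (finite_turnSet hfine θ d hv).subset ?_
  rintro w ⟨hd, g, hg, hmax, h1⟩
  have hl : g.length = K.dist v w := hg
  refine ⟨g.getVert, g.length, by omega, isEdgePath_getVert g, by simp, by simp, ?_, ?_⟩
  · intro hpos
    refine pathIn_of_angle_le (h1 ?_)
    rintro rfl
    rw [SimpleGraph.dist_self] at hl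
    omega
  · intro i hi1 hi2
    exact pathIn_of_angle_le ((le_iSup₂ (f := fun (i : ℕ) (_ : 0 < i ∧ i < g.length) =>
      angle K (g.getVert i) (g.getVert (i - 1)) (g.getVert (i + 1))) i ⟨hi1, hi2⟩).trans hmax)

section Action

variable {Γ : Type*} [Group Γ] [MulAction Γ V]

/-- The action of a group element as a graph homomorphism. -/
def smulHom (hadj : ∀ (γ : Γ) (a b : V), K.Adj (γ • a) (γ • b) ↔ K.Adj a b) (γ : Γ) :
    K →g K := ⟨fun a => γ • a, fun {a b} h => (hadj γ a b).2 h⟩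

theorem smul_dist (hc : K.Connected)
    (hadj : ∀ (γ : Γ) (a b : V), K.Adj (γ • a) (γ • b) ↔ K.Adj a b) (γ : Γ) (a b : V) :
    K.dist (γ • a) (γ • b) = K.dist a b := by
  have key : ∀ (γ : Γ) (a b : V), K.dist (γ • a) (γ • b) ≤ K.dist a b := by
    intro γ a b
    obtain ⟨w, hw⟩ := hc.exists_walk_length_eq_dist a b
    rw [← hw, ← SimpleGraph.Walk.length_map (smulHom hadj γ) w]
    exact SimpleGraph.dist_le (w.map (smulHom hadj γ))
  refine le_antisymm (key γ a b) ?_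
  have := key γ⁻¹ (γ • a) (γ • b)
  rwa [inv_smul_smul, inv_smul_smul] at this

theorem exists_smul_walk (hadj : ∀ (γ : Γ) (a b : V), K.Adj (γ • a) (γ • b) ↔ K.Adj a b) (γ : Γ)
    {a b : V} (w : K.Walk a b) : ∃ w' : K.Walk (γ • a) (γ • b), w'.length = w.length ∧
      ∀ k, w'.getVert k = γ • w.getVert k :=
  ⟨w.map (smulHom hadj γ), SimpleGraph.Walk.length_map _ _,
    fun k => SimpleGraph.Walk.getVert_map _ _ k⟩

theorem PathIn.smul (hadj : ∀ (γ : Γ) (a b : V), K.Adj (γ • a) (γ • b) ↔ K.Adj a b) (γ : Γ)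
    {v a b : V} {m : ℕ} (h : PathIn K (· ≠ v) m a b) :
    PathIn K (· ≠ γ • v) m (γ • a) (γ • b) := by
  obtain ⟨w, h1, h2⟩ := h
  obtain ⟨w', hl, hk⟩ := exists_smul_walk hadj γ w
  refine ⟨w', hl.trans_le h1, fun u hu => ?_⟩
  obtain ⟨k, -, rfl⟩ := (mem_support_iff_getVert _).1 hu
  rw [hk]
  exact fun h => h2 _ (w.getVert_mem_support k) (MulAction.injective γ h)

theorem smul_mem_cone (hc : K.Connected)
    (hadj : ∀ (γ : Γ) (a b : V), K.Adj (γ • a) (γ • b) ↔ K.Adj a b) (γ : Γ)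
    {d θ : ℕ} {v v' w : V} (h : w ∈ cone K d θ v v') : γ • w ∈ cone K d θ (γ • v) (γ • v') := by
  obtain ⟨hd, g, hg, hmax, h1⟩ := h
  obtain ⟨g', hl, hk⟩ := exists_smul_walk hadj γ g
  refine ⟨by rwa [smul_dist hc hadj], g', ?_, ?_, ?_⟩
  · show g'.length = K.dist (γ • v) (γ • w)
    rw [hl, smul_dist hc hadj]
    exact hg
  · refine maxAngle_le fun i hi1 hi2 => ?_
    rw [hl] at hi2
    have := pathIn_of_angle_le ((le_iSup₂ (f := fun (i : ℕ) (_ : 0 < i ∧ i < g.length) =>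
      angle K (g.getVert i) (g.getVert (i - 1)) (g.getVert (i + 1))) i ⟨hi1, hi2⟩).trans hmax)
    rw [hk, hk, hk]
    exact this.smul hadj γ
  · intro hne
    have := pathIn_of_angle_le (h1 fun h => hne (by rw [h]))
    rw [hk]
    exact (this.smul hadj γ).angle_le

/-- The cones of given radius and angle are finite, of bounded cardinality. -/
theorem exists_cone_bound {𝒢 : Set (Subgroup Γ)} (hK : IsAssociatedGraph Γ 𝒢 K δ) (N : ℕ) :
    ∃ P : ℕ, ∀ v v' : V, K.Adj v v' → (cone K N N v v').Finite ∧ (cone K N N v v').ncard ≤ P := by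
  have hc := hK.connected
  obtain ⟨T, hT, hT'⟩ := hK.finite_edge_orbits
  have hfin : {p : V × V | s(p.1, p.2) ∈ T}.Finite := by
    refine Set.Finite.preimage' (f := fun p : V × V => s(p.1, p.2)) hT fun e _ => ?_
    induction e using Sym2.ind with
    | _ a b =>
      refine (Set.toFinite {(a, b), (b, a)}).subset ?_
      rintro ⟨p, q⟩ h
      have h : s(p, q) = s(a, b) := h
      rw [Sym2.eq_iff] at h
      simp only [Set.mem_insert_iff, Set.mem_singleton_iff, Prod.mk.injEq]
      exact h
  obtain ⟨P, hP⟩ := (hfin.image fun p => (cone K N N p.1 p.2).ncard).bddAbove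
  refine ⟨P, fun v v' hv => ⟨finite_cone hK.fine N N hv, ?_⟩⟩
  obtain ⟨γ, hγ⟩ := hT' v v' hv
  have hγv : K.Adj (γ • v) (γ • v') := (hK.adj_smul γ v v').2 hv
  refine le_trans ?_ (hP ⟨(γ • v, γ • v'), hγ, rfl⟩)
  exact Set.ncard_le_ncard_of_injOn (fun w => γ • w)
    (fun w hw => smul_mem_cone hc hK.adj_smul γ hw) (fun a _ b _ h => MulAction.injective γ h)
    (finite_cone hK.fine N N hγv)

end Action

/-- Every cone of radius and angle `N` has at most `P` elements. -/
def ConeBound (K : SimpleGraph V) (N P : ℕ) : Prop :=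
  ∀ v v' : V, K.Adj v v' → (cone K N N v v').Finite ∧ (cone K N N v v').ncard ≤ P

/-- The vertices of a conical neighbourhood in a shell of thickness `L` around the origin. -/
theorem ConeBound.window (hc : K.Connected) {N P : ℕ} (hP : ConeBound K N P) {a b : V}
    {g : K.Walk a b} (hg : IsGeodesic K g) (s L : ℕ) :
    {w | w ∈ conicalNeighbourhood K N g ∧ s ≤ K.dist a w ∧ K.dist a w ≤ s + L}.Finite ∧
    {w | w ∈ conicalNeighbourhood K N g ∧ s ≤ K.dist a w ∧ K.dist a w ≤ s + L}.ncard ≤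
      (L + 2 * N + 2) * (2 * P) := by
  classical
  have hgf := hg.isGeoFun hc
  let f : ℕ → Finset V := fun i => if h : i < g.length then
    (hP _ _ (g.adj_getVert_succ h)).1.toFinset ∪ (hP _ _ (g.adj_getVert_succ h).symm).1.toFinset
    else ∅
  have hf : ∀ i, (f i).card ≤ 2 * P := by
    intro i
    simp only [f]
    split_ifs with h
    · refine (Finset.card_union_le _ _).trans ?_
      rw [← Set.ncard_eq_toFinset_card _ (hP _ _ (g.adj_getVert_succ h)).1,
        ← Set.ncard_eq_toFinset_card _ (hP _ _ (g.adj_getVert_succ h).symm).1]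
      have h1 := (hP _ _ (g.adj_getVert_succ h)).2
      have h2 := (hP _ _ (g.adj_getVert_succ h).symm).2
      omega
    · simp
  set Q := {w | w ∈ conicalNeighbourhood K N g ∧ s ≤ K.dist a w ∧ K.dist a w ≤ s + L} with hQ
  set F := (Finset.Icc (s - N - 1) (s + L + N)).biUnion f with hF
  have hsub : Q ⊆ F := by
    rintro w ⟨⟨e, he, hw⟩, h1, h2⟩
    obtain ⟨i, hi, rfl⟩ := List.getElem_of_mem he
    rw [SimpleGraph.Walk.darts_getElem_eq_getVert] at hw
    have hi' : i < g.length := by simpa using hi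
    have d1 := hgf.dist_zero (k := i) hi'.le
    have d2 := hgf.dist_zero (k := i + 1) hi'
    rw [g.getVert_zero] at d1 d2
    have hwd : (K.dist (g.getVert i) w ≤ N ∨ K.dist (g.getVert (i + 1)) w ≤ N) :=
      hw.imp (fun h => h.1) fun h => h.1
    have t1 := hc.dist_triangle (u := a) (v := g.getVert i) (w := w)
    have t2 := hc.dist_triangle (u := a) (v := w) (w := g.getVert i)
    have t3 := hc.dist_triangle (u := a) (v := g.getVert (i + 1)) (w := w)
    have t4 := hc.dist_triangle (u := a) (v := w) (w := g.getVert (i + 1))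
    have c1 := K.dist_comm (u := w) (v := g.getVert i)
    have c2 := K.dist_comm (u := w) (v := g.getVert (i + 1))
    simp only [hF, Finset.coe_biUnion, Set.mem_iUnion, Finset.mem_coe, Finset.mem_Icc]
    refine ⟨i, by omega, ?_⟩
    simp only [f, dif_pos hi', Finset.mem_union, Set.Finite.mem_toFinset]
    exact hw
  refine ⟨(Finset.finite_toSet F).subset hsub, ?_⟩
  calc Q.ncard ≤ (F : Set V).ncard := Set.ncard_le_ncard hsub (Finset.finite_toSet F)
    _ = F.card := Set.ncard_coe_finset F
    _ ≤ (Finset.Icc (s - N - 1) (s + L + N)).card * (2 * P) :=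
      Finset.card_biUnion_le_card_mul _ _ _ fun i _ => hf i
    _ ≤ _ := by
      refine Nat.mul_le_mul_right _ ?_
      rw [Nat.card_Icc]
      omega

theorem encard_lists_le (Q : Set V) (hQ : Q.Finite) (M : ℕ) :
    {s : List V | s.length ≤ M ∧ ∀ w ∈ s, w ∈ Q}.encard ≤ (((Q.ncard + 1) ^ M : ℕ) : ℕ∞) := by
  classical
  set S := {s : List V | s.length ≤ M ∧ ∀ w ∈ s, w ∈ Q} with hS
  let F : List V → (Fin M → Option V) := fun s i => s[(i : ℕ)]?
  have hinj : Set.InjOn F S := by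
    intro s hs t ht h
    apply List.ext_getElem?
    intro i
    rcases Nat.lt_or_ge i M with hi | hi
    · exact congrFun h ⟨i, hi⟩
    · have h1 := hs.1
      have h2 := ht.1
      rw [List.getElem?_eq_none (by omega), List.getElem?_eq_none (by omega)]
  rw [← hinj.encard_image]
  let R : Finset (Option V) := insert none (hQ.toFinset.map Function.Embedding.some)
  have hR : R.card ≤ Q.ncard + 1 := by
    refine (Finset.card_insert_le _ _).trans ?_
    rw [Finset.card_map, ← Set.ncard_eq_toFinset_card _ hQ]
  have hsub : F '' S ⊆ ((Fintype.piFinset fun _ : Fin M => R : Finset (Fin M → Option V)) :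
      Set (Fin M → Option V)) := by
    rintro _ ⟨s, hs, rfl⟩
    simp only [Finset.mem_coe, Fintype.mem_piFinset]
    intro i
    simp only [F, R, Finset.mem_insert, Finset.mem_map, Set.Finite.mem_toFinset]
    rcases Nat.lt_or_ge (i : ℕ) s.length with hi | hi
    · rw [List.getElem?_eq_getElem hi]
      exact Or.inr ⟨_, hs.2 _ (List.getElem_mem hi), rfl⟩
    · exact Or.inl (List.getElem?_eq_none hi)
  refine (Set.encard_le_encard hsub).trans ?_
  rw [Set.encard_coe_eq_coe_finsetCard, Fintype.card_piFinset_const]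
  exact_mod_cast Nat.pow_le_pow_left hR M

/-- A channel is a list of bounded length of vertices of a finite set of bounded cardinality. -/
theorem ConeBound.isChannelBound (hc : K.Connected) {N P : ℕ} (hP : ConeBound K N P) {L C : ℕ}
    (hC : ((L + N + 2 * N + 2) * (2 * P) + 1) ^ (2 * (L + 1 + N) + 1) ≤ C) :
    IsChannelBound K N L C := by
  intro a b g hg hl
  have hgf := hg.isGeoFun hc
  obtain ⟨hfin, hcard⟩ := hP.window hc hg 0 (L + N)
  set Q := {w | w ∈ conicalNeighbourhood K N g ∧ 0 ≤ K.dist a w ∧ K.dist a w ≤ 0 + (L + N)}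
  have hmem : ∀ w ∈ conicalNeighbourhood K N g, w ∈ Q := by
    intro w hw
    refine ⟨hw, Nat.zero_le _, ?_⟩
    obtain ⟨e, he, hw⟩ := hw
    obtain ⟨i, hi, rfl⟩ := List.getElem_of_mem he
    rw [SimpleGraph.Walk.darts_getElem_eq_getVert] at hw
    have hi' : i < g.length := by simpa using hi
    have d1 := hgf.dist_zero (k := i) hi'.le
    have d2 := hgf.dist_zero (k := i + 1) hi'
    rw [g.getVert_zero] at d1 d2
    have hwd : (K.dist (g.getVert i) w ≤ N ∨ K.dist (g.getVert (i + 1)) w ≤ N) :=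
      hw.imp (fun h => h.1) fun h => h.1
    have t1 := hc.dist_triangle (u := a) (v := g.getVert i) (w := w)
    have t3 := hc.dist_triangle (u := a) (v := g.getVert (i + 1)) (w := w)
    omega
  refine le_trans (Set.encard_le_encard (t := {s : List V | s.length ≤ 2 * (L + 1 + N) + 1 ∧
    ∀ w ∈ s, w ∈ Q}) ?_) ((encard_lists_le Q hfin _).trans ?_)
  · rintro s ⟨a', b', h, hh, -, hmemh, rfl⟩
    refine ⟨?_, fun w hw => hmem w (hmemh w hw)⟩
    rw [SimpleGraph.Walk.length_support]
    have h1 := (hmem _ (hmemh a' h.start_mem_support)).2.2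
    have h2 := (hmem _ (hmemh b' h.end_mem_support)).2.2
    have t := hc.dist_triangle (u := a') (v := a) (w := b')
    have c := K.dist_comm (u := a') (v := a)
    have hl' : h.length = K.dist a' b' := hh
    omega
  · exact_mod_cast (Nat.pow_le_pow_left (Nat.add_le_add_right hcard 1) _).trans hC

/-! ### From local to global quasi-geodesics -/

variable {ε : ℕ}

/-- A discrete intermediate value property. -/
theorem exists_crossing {P : ℕ → ℤ} {n : ℕ} {E : ℤ} (hE : 0 ≤ E)
    (hstep : ∀ k < n, |P (k + 1) - P k| ≤ E) {s t : ℕ} (hst : s ≤ t) (ht : t ≤ n) {c : ℤ}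
    (hc : (P s ≤ c ∧ c ≤ P t) ∨ (P t ≤ c ∧ c ≤ P s)) :
    ∃ r, s ≤ r ∧ r ≤ t ∧ |P r - c| ≤ E := by
  induction t, hst using Nat.le_induction with
  | base => exact ⟨s, le_rfl, le_rfl, by rw [abs_le]; omega⟩
  | succ t hst ih =>
    by_cases h : (P s ≤ c ∧ c ≤ P t) ∨ (P t ≤ c ∧ c ≤ P s)
    · obtain ⟨r, h1, h2, h3⟩ := ih (by omega) h
      exact ⟨r, h1, by omega, h3⟩
    · have := abs_le.1 (hstep t (by omega))
      exact ⟨t + 1, by omega, le_rfl, by rw [abs_le]; omega⟩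

section LocalGlobal

variable {P : ℕ → ℤ} {n : ℕ} {a E : ℤ}

/-- A coarsely continuous function on an interval which is locally a coarse dilatation. -/
structure IsLocallyExpanding (P : ℕ → ℤ) (n : ℕ) (a E : ℤ) : Prop where
  one_le : 1 ≤ a
  one_le' : 1 ≤ E
  step : ∀ k < n, |P (k + 1) - P k| ≤ 5 * E
  expand : ∀ s t : ℕ, s ≤ t → t ≤ n → (t : ℤ) - s ≤ 80 * (a * E) →
    (t : ℤ) - s ≤ a * (|P t - P s| + 4 * E)

theorem IsLocallyExpanding.neg (h : IsLocallyExpanding P n a E) :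
    IsLocallyExpanding (fun k => - P k) n a E where
  one_le := h.one_le
  one_le' := h.one_le'
  step k hk := by rw [← abs_neg]; simpa [sub_eq_add_neg, add_comm] using h.step k hk
  expand s t hst ht hle := by
    have e : |(-P t) - (-P s)| = |P t - P s| := by rw [← abs_neg]; congr 1; ring
    rw [e]
    exact h.expand s t hst ht hle

/-- A lower bound on `P` over an interval of length at least `b a E`. -/
theorem IsLocallyExpanding.le_abs (h : IsLocallyExpanding P n a E) {s t : ℕ} (hst : s ≤ t)
    (ht : t ≤ n) (hle : (t : ℤ) - s ≤ 80 * (a * E)) {b : ℤ} (hb : b * (a * E) ≤ (t : ℤ) - s) :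
    (b - 4) * E ≤ |P t - P s| := by
  have h1 := h.expand s t hst ht hle
  have h0 := h.one_le
  by_contra hlt
  push Not at hlt
  have h2 : a * (|P t - P s| + 4 * E) < a * (b * E) :=
    mul_lt_mul_of_pos_left (by linarith) (by linarith)
  have h3 : a * (b * E) = b * (a * E) := by ring
  linarith

/-- The inductive step of the fact that `P` does not come back, for a return from above: between
`P s` and `P m` there is a value taken at a time `s'` after `s` and nearly taken again at a time
`t'` after `m`. -/
theorem IsLocallyExpanding.no_return_aux (h : IsLocallyExpanding P n a E) {s t : ℕ}
    (ht : t ≤ n) (hlong : 80 * (a * E) < (t : ℤ) - s)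
    (IH : ∀ s' t' : ℕ, s' ≤ t' → t' ≤ n → t' - s' < t - s → 40 * (a * E) ≤ (t' : ℤ) - s' →
      5 * E < |P t' - P s'|) (hret : |P t - P s| ≤ 5 * E) {m : ℕ}
    (hm : (m : ℤ) = s + 40 * (a * E)) (hup : P s ≤ P m) : False := by
  have ha := h.one_le
  have hE := h.one_le'
  have hw : 1 ≤ a * E := by nlinarith
  have hsm : s ≤ m := by omega
  have hmt : m ≤ t := by omega
  have hmm := h.le_abs hsm (by omega) (by omega) (b := 40) (by omega)
  rw [abs_of_nonneg (by omega)] at hmm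
  have hret' := abs_le.1 hret
  obtain ⟨s', h1, h2, h3⟩ := exists_crossing (by omega) h.step hsm (by omega)
    (c := P s + 20 * E) (Or.inl ⟨by omega, by omega⟩)
  have h3' := abs_le.1 h3
  obtain ⟨t', h4, h5, h6⟩ := exists_crossing (by omega) h.step hmt ht
    (c := P s') (Or.inr ⟨by omega, by omega⟩)
  have hs' : s ≠ s' := by
    rintro rfl
    omega
  rcases le_or_gt (40 * (a * E)) ((t' : ℤ) - s') with hl | hl
  · have := IH s' t' (by omega) (by omega) (by omega) hl
    omega
  · have h7 := h.expand s' t' (by omega) (by omega) (by omega)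
    have h8 : a * (|P t' - P s'| + 4 * E) ≤ a * (9 * E) :=
      mul_le_mul_of_nonneg_left (by linarith) (by linarith)
    have h9 : a * (9 * E) = 9 * (a * E) := by ring
    have h10 := h.le_abs h1 (by omega) (by omega) (b := 31) (by omega)
    have h11 : |P s' - P s| ≤ 25 * E := abs_le.2 (by omega)
    omega

/-- `P` does not come back near a value taken long before: in a shortest return, the two times at
which a suitable intermediate value is taken would give a shorter one. -/
theorem IsLocallyExpanding.no_return (h : IsLocallyExpanding P n a E) (k : ℕ) :
    ∀ s t : ℕ, s ≤ t → t ≤ n → t - s ≤ k → 40 * (a * E) ≤ (t : ℤ) - s →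
      5 * E < |P t - P s| := by
  induction k using Nat.strong_induction_on with
  | _ k ih =>
    intro s t hst ht hk hle
    have ha := h.one_le
    have hE := h.one_le'
    have hw : 1 ≤ a * E := by nlinarith
    rcases le_or_gt ((t : ℤ) - s) (80 * (a * E)) with hs | hlong
    · have := h.le_abs hst ht hs (b := 40) hle
      omega
    · by_contra hret
      push Not at hret
      have IH : ∀ s' t' : ℕ, s' ≤ t' → t' ≤ n → t' - s' < t - s → 40 * (a * E) ≤ (t' : ℤ) - s' →
          5 * E < |P t' - P s'| := fun s' t' h1 h2 h3 h4 =>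
        ih (t' - s') (by omega) s' t' h1 h2 le_rfl h4
      obtain ⟨m, hm⟩ : ∃ m : ℕ, (m : ℤ) = s + 40 * (a * E) :=
        ⟨(s + 40 * (a * E)).toNat, Int.toNat_of_nonneg (by omega)⟩
      rcases le_total (P s) (P m) with hup | hup
      · exact h.no_return_aux ht hlong IH hret hm hup
      · have e : ∀ x y : ℕ, |(-P x) - (-P y)| = |P x - P y| := fun x y => by
          rw [← abs_neg]; congr 1; ring
        exact h.neg.no_return_aux ht hlong (fun s' t' h1 h2 h3 h4 => by
          rw [e]; exact IH s' t' h1 h2 h3 h4) (by rw [e]; exact hret) hm (neg_le_neg hup)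

/-- Since `P` does not come back, it goes on in the direction taken at first, and the local lower
bounds for its progress add up. -/
theorem IsLocallyExpanding.progress (h : IsLocallyExpanding P n a E) {s m : ℕ}
    (hm : (m : ℤ) = s + 40 * (a * E)) (hup : P s ≤ P m) (k : ℕ) :
    ∀ t : ℕ, t ≤ k → t ≤ n → m ≤ t → 9 * ((t : ℤ) - s) ≤ 10 * (a * (P t - P s)) := by
  have ha := h.one_le
  have hE := h.one_le'
  have hw : 1 ≤ a * E := by nlinarith
  have NR := fun s t h1 h2 h3 => h.no_return _ s t h1 h2 le_rfl h3
  induction k with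
  | zero => intro t ht _ hmt; omega
  | succ k ih =>
    intro t htk ht hmt
    have hpos : P s < P t := by
      by_contra hle
      push Not at hle
      obtain ⟨r, h1, h2, h3⟩ := exists_crossing (by omega) h.step hmt ht
        (c := P s) (Or.inr ⟨hle, hup⟩)
      have := NR s r (by omega) (by omega) (by omega)
      omega
    rcases le_or_gt ((t : ℤ) - s) (80 * (a * E)) with hs | hlong
    · have h1 := h.expand s t (by omega) ht hs
      rw [abs_of_pos (by omega), mul_add] at h1
      have h2 : a * (4 * E) = 4 * (a * E) := by ring
      omega
    · obtain ⟨t', ht'⟩ : ∃ t' : ℕ, (t' : ℤ) = t - 40 * (a * E) :=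
        ⟨((t : ℤ) - 40 * (a * E)).toNat, Int.toNat_of_nonneg (by omega)⟩
      have h1 := ih t' (by omega) (by omega) (by omega)
      have h2 := h.le_abs (s := t') (t := t) (by omega) ht (by omega) (b := 40) (by omega)
      have h3 : P t' ≤ P t := by
        by_contra hlt
        push Not at hlt
        obtain ⟨r, h4, h5, h6⟩ := exists_crossing (by omega) h.step (s := s) (t := t') (by omega)
          (by omega) (c := P t) (Or.inl ⟨hpos.le, hlt.le⟩)
        have := NR r t (by omega) ht (by omega)
        rw [abs_sub_comm] at this
        omega
      rw [abs_of_nonneg (by omega)] at h2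
      have h4 : a * (P t' - P s + 36 * E) ≤ a * (P t - P s) :=
        mul_le_mul_of_nonneg_left (by linarith) (by linarith)
      have h5 : a * (P t' - P s + 36 * E) = a * (P t' - P s) + 36 * (a * E) := by ring
      omega

theorem IsLocallyExpanding.global (h : IsLocallyExpanding P n a E) {s t : ℕ} (ht : t ≤ n)
    (hle : 40 * (a * E) ≤ (t : ℤ) - s) : 9 * ((t : ℤ) - s) ≤ 10 * (a * |P t - P s|) := by
  have ha := h.one_le
  have hE := h.one_le'
  have hw : 1 ≤ a * E := by nlinarith
  obtain ⟨m, hm⟩ : ∃ m : ℕ, (m : ℤ) = s + 40 * (a * E) :=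
    ⟨(s + 40 * (a * E)).toNat, Int.toNat_of_nonneg (by omega)⟩
  rcases le_total (P s) (P m) with hup | hup
  · refine (h.progress hm hup t t le_rfl ht (by omega)).trans ?_
    have := mul_le_mul_of_nonneg_left (le_abs_self (P t - P s)) (by linarith : 0 ≤ a)
    linarith
  · refine (h.neg.progress hm (neg_le_neg hup) t t le_rfl ht (by omega)).trans ?_
    have := mul_le_mul_of_nonneg_left (neg_le_abs (P t - P s)) (by linarith : 0 ≤ a)
    have e : -P t - -P s = -(P t - P s) := by ring
    rw [e]
    linarith

end LocalGlobal

/-- The scale at which coarse piecewise geodesics are quasi-geodesics. -/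
def locScale (δ ε : ℕ) : ℕ := 40 * lam δ * (ε + 100 * lam δ * δ)

/-- A path staying `2 ε`-close to a geodesic which is locally, at a suitable scale, a
`λ / 2`-quasi-geodesic is globally a `λ`-quasi-geodesic. -/
theorem isQG_of_local (H : IsHypGraph K δ) {f : ℕ → V} {n : ℕ} (hf : IsEdgePath K f n)
    (hloc : ∀ i j, i ≤ j → j ≤ n → j - i ≤ locScale δ ε → j - i ≤ 500 * δ * K.dist (f i) (f j))
    {g : ℕ → V} {m : ℕ} (hg : IsGeoFun K g m)
    (hclose : ∀ k ≤ n, ∃ j ≤ m, K.dist (f k) (g j) ≤ 2 * ε) : IsQG K (lam δ) f n := by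
  have hc := H.conn
  have h2 := H.two_le
  have hex : ∀ k, ∃ j, j ≤ m ∧ (k ≤ n → K.dist (f k) (g j) ≤ 2 * ε) := by
    intro k
    rcases Nat.lt_or_ge n k with h | h
    · exact ⟨0, Nat.zero_le _, fun h' => by omega⟩
    · obtain ⟨j, hj, hd⟩ := hclose k h
      exact ⟨j, hj, fun _ => hd⟩
  choose pos hpos hd using hex
  set E := ε + 100 * lam δ * δ with hE
  have hE1 : ε + 1 ≤ E := by
    have : 0 < 100 * lam δ * δ := Nat.mul_pos (Nat.mul_pos (by norm_num) (lam_pos h2)) (by omega)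
    omega
  have hL : locScale δ ε = 80 * (500 * δ * E) := by
    unfold locScale; rw [← hE]; unfold lam; ring
  -- the positions along `g` of points of `f`
  have hdist : ∀ i j, i ≤ n → j ≤ n →
      |(pos j : ℤ) - pos i| ≤ K.dist (f i) (f j) + 4 * ε ∧
      (K.dist (f i) (f j) : ℤ) ≤ |(pos j : ℤ) - pos i| + 4 * ε := by
    intro i j hi hj
    have e : |(pos j : ℤ) - pos i| = K.dist (g (pos i)) (g (pos j)) := by
      rcases le_total (pos i) (pos j) with h | h
      · rw [hg _ _ h (hpos j), abs_of_nonneg (by omega)]; omega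
      · rw [K.dist_comm, hg _ _ h (hpos i), abs_of_nonpos (by omega)]; omega
    have d1 := hd i hi
    have d2 := hd j hj
    have t1 := hc.dist_triangle (u := f i) (v := g (pos i)) (w := f j)
    have t2 := hc.dist_triangle (u := g (pos i)) (v := g (pos j)) (w := f j)
    have t3 := hc.dist_triangle (u := g (pos i)) (v := f i) (w := g (pos j))
    have t4 := hc.dist_triangle (u := f i) (v := f j) (w := g (pos j))
    have c1 := K.dist_comm (u := f i) (v := g (pos i))
    have c2 := K.dist_comm (u := f j) (v := g (pos j))
    rw [e]
    omega
  have hexp : IsLocallyExpanding (fun k => (pos k : ℤ)) n ((500 * δ : ℕ) : ℤ) (E : ℤ) := by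
    refine ⟨by omega, by omega, fun k hk => ?_, fun s t hst ht hle => ?_⟩
    · have h1 := (hdist k (k + 1) (by omega) (by omega)).1
      have h3 := hf.dist_le (Nat.le_succ k) hk
      simp only [Nat.succ_eq_add_one] at h3
      omega
    · have h1 := hloc s t hst ht (by rw [hL]; zify [hst]; push_cast at hle ⊢; linarith)
      have h3 := (hdist s t (by omega) ht).2
      have h4 : (t : ℤ) - s ≤ ((500 * δ : ℕ) : ℤ) * K.dist (f s) (f t) := by
        zify [hst] at h1; push_cast; linarith
      refine h4.trans (mul_le_mul_of_nonneg_left ?_ (by omega))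
      omega
  intro s t hst ht
  rcases Nat.lt_or_ge (locScale δ ε) (t - s) with hlong | hshort
  · have hlong' : 80 * (((500 * δ : ℕ) : ℤ) * E) < (t : ℤ) - s := by
      rw [hL] at hlong; zify [hst] at hlong; push_cast; linarith
    have h0 : (0 : ℤ) ≤ ((500 * δ : ℕ) : ℤ) * E := by positivity
    have h1 := hexp.global (s := s) ht (by linarith)
    have h3 := (hdist s t (by omega) ht).1
    have h4 : ((500 * δ : ℕ) : ℤ) * |(pos t : ℤ) - pos s| ≤
        ((500 * δ : ℕ) : ℤ) * (K.dist (f s) (f t) + 4 * E) :=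
      mul_le_mul_of_nonneg_left (by omega) (by omega)
    rw [mul_add] at h4
    have h5 : ((500 * δ : ℕ) : ℤ) * (4 * E) = 4 * (((500 * δ : ℕ) : ℤ) * E) := by ring
    have h6 : (lam δ : ℤ) * K.dist (f s) (f t) =
        2 * (((500 * δ : ℕ) : ℤ) * K.dist (f s) (f t)) := by
      unfold lam; push_cast; ring
    zify [hst]
    linarith
  · refine (hloc s t hst ht hshort).trans (Nat.mul_le_mul_right _ ?_)
    unfold lam; omega

/-! ### Piecewise geodesics and cylinders -/

/-- The bound for all the angles occurring below which are not large. -/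
noncomputable def baseAngle (δ : ℕ) : ℕ := angConst δ (3 * morseConst δ + 2)

/-- A hyperbolic graph together with a constant `ε` which is large compared to all the
hyperbolicity, stability and angle constants. -/
structure IsSetup (K : SimpleGraph V) (δ ε : ℕ) : Prop extends IsHypGraph K δ where
  eps_large : 1000 * (baseAngle δ + δ + 1) ≤ ε

theorem angConst_mono {B B' : ℕ} (h : B ≤ B') : angConst δ B ≤ angConst δ B' := by
  have : escapeConst δ B ≤ escapeConst δ B' := Nat.mul_le_mul_left _ (by omega)
  unfold angConst
  omega

theorem morse_le_baseAngle : 6 * morseConst δ + 2 * δ ≤ baseAngle δ := by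
  unfold baseAngle angConst; omega

theorem eighty_thousand_mul_le_locScale (h : 2 ≤ δ) : 80000 * (ε + 1) ≤ locScale δ ε := by
  have h1 : 80000 ≤ 40 * lam δ := by unfold lam; omega
  have h2 : 1 ≤ 100 * lam δ * δ :=
    Nat.mul_pos (Nat.mul_pos (by norm_num) (lam_pos h)) (by omega)
  exact Nat.mul_le_mul h1 (by omega)

theorem ten_mul_locScale_le_mu : 10 * locScale δ ε ≤ mu δ ε := by
  have e : mu δ ε = 10 * locScale δ ε + 90 * ε * (40 * lam δ) := by
    unfold mu locScale lam; ring
  omega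

/-- A distance from the ends of a stretch of path beyond which slimness of quadrilaterals
applies. -/
noncomputable def marg (δ : ℕ) : ℕ := morseConst δ + 2 * δ + 1

theorem IsSetup.marg_le (S : IsSetup K δ ε) : 100 * marg δ ≤ ε := by
  have h1 := S.eps_large
  have h2 := morse_le_baseAngle (δ := δ)
  unfold marg
  omega

theorem IsSetup.near (S : IsSetup K δ ε) {q : ℕ → V} {n : ℕ} (hq : IsEdgePath K q n)
    (hQ : IsQG K (lam δ) q n) {g : ℕ → V} {m : ℕ} (hg : IsGeoFun K g m) (h0 : g 0 = q 0)
    (hm : g m = q n) {t : ℕ} (ht : t ≤ n) : ∃ i ≤ m, K.dist (q t) (g i) ≤ morseConst δ :=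
  quasiGeodesic_near_geodesic S.conn (by have := S.two_le; omega) S.hyp hq hQ hg h0 hm ht

theorem IsGeoFun.exists_sub {g : ℕ → V} {n : ℕ} (hg : IsGeoFun K g n) {i j : ℕ} (hi : i ≤ n)
    (hj : j ≤ n) : ∃ (h : ℕ → V) (m : ℕ), IsGeoFun K h m ∧ h 0 = g i ∧ h m = g j ∧
      ∀ k ≤ m, ∃ k' ≤ n, h k = g k' := by
  rcases le_total i j with hij | hij
  · refine ⟨fun k => g (i + k), j - i, hg.shift (by omega), rfl, ?_,
      fun k hk => ⟨i + k, by omega, rfl⟩⟩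
    show g (i + (j - i)) = g j
    congr 1; omega
  · refine ⟨fun k => g (i - k), i - j, ?_, rfl, ?_, fun k hk => ⟨i - k, by omega, rfl⟩⟩
    · exact (hg.mono hi).reverse.mono (by omega)
    · show g (i - (i - j)) = g j
      congr 1; omega

/-- A vertex well inside a geodesic stretch of a quasi-geodesic is `2 δ`-close to every geodesic
with the same ends as the quasi-geodesic. -/
theorem IsSetup.close_of_stretch (S : IsSetup K δ ε) {q : ℕ → V} {n : ℕ} (hq : IsEdgePath K q n)
    (hQ : IsQG K (lam δ) q n) {g : ℕ → V} {m : ℕ} (hg : IsGeoFun K g m) (h0 : g 0 = q 0)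
    (hm : g m = q n) {lo t hi : ℕ} (hlt : lo ≤ t) (hth : t ≤ hi) (hhn : hi ≤ n)
    (hgeo : K.dist (q lo) (q hi) = hi - lo) (hlo : lo = 0 ∨ marg δ ≤ t - lo)
    (hhi : hi = n ∨ marg δ ≤ hi - t) : ∃ j ≤ m, K.dist (q t) (g j) ≤ 2 * δ := by
  have hc := S.conn
  have e1 := hq.dist_le hlt (by omega)
  have e2 := hq.dist_le hth hhn
  have e3 := hc.dist_triangle (u := q lo) (v := q t) (w := q hi)
  have hbt : Btw K (q lo) (q t) (q hi) := by unfold Btw; omega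
  have d1 : K.dist (q lo) (q t) = t - lo := by omega
  have d2 : K.dist (q t) (q hi) = hi - t := by omega
  have end1 : ∃ i ≤ m, (lo = 0 → g i = q lo) ∧ K.dist (q lo) (g i) ≤ morseConst δ := by
    rcases Nat.eq_zero_or_pos lo with h | h
    · exact ⟨0, Nat.zero_le _, fun _ => by rw [h, h0], by rw [h, h0]; simp⟩
    · obtain ⟨i, hi, hd⟩ := S.near hq hQ hg h0 hm (t := lo) (by omega)
      exact ⟨i, hi, fun h' => by omega, hd⟩
  have end2 : ∃ i ≤ m, (hi = n → g i = q hi) ∧ K.dist (q hi) (g i) ≤ morseConst δ := by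
    by_cases h : hi = n
    · exact ⟨m, le_rfl, fun _ => by rw [h, hm], by rw [h, hm]; simp⟩
    · obtain ⟨i, hi, hd⟩ := S.near hq hQ hg h0 hm hhn
      exact ⟨i, hi, fun h' => absurd h' h, hd⟩
  obtain ⟨i, hi1, gi, di⟩ := end1
  obtain ⟨j, hj1, gj, dj⟩ := end2
  obtain ⟨z, hz, dz⟩ := slim_btw hc S.hyp hbt (g j)
  have hzz : Btw K (q lo) z (g j) ∨ K.dist (q t) (g j) ≤ 2 * δ := by
    rcases hz with hz | hz
    · right
      have hz' : K.dist (q hi) z + K.dist z (g j) = K.dist (q hi) (g j) := hz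
      have t1 := hc.dist_triangle (u := q t) (v := z) (w := q hi)
      have t2 := hc.dist_triangle (u := q t) (v := z) (w := g j)
      have c1 := K.dist_comm (u := q hi) (v := z)
      rcases hhi with h | h
      · have e : K.dist (q hi) (g j) = 0 := by rw [gj h]; simp
        omega
      · unfold marg at h
        omega
    · exact Or.inl hz
  rcases hzz with hz | hz
  · obtain ⟨h, k, hh, hh0, hhk, hsub⟩ := hg.exists_sub hj1 hi1
    rcases slim_fun_left hc S.hyp hz hh hh0 hhk with ⟨r, hr, dr⟩ | ⟨y, hy, dy⟩
    · obtain ⟨r', hr', e⟩ := hsub r hr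
      refine ⟨r', hr', ?_⟩
      have t1 := hc.dist_triangle (u := q t) (v := z) (w := h r)
      rw [← e]; omega
    · refine ⟨i, hi1, ?_⟩
      have hy' : K.dist (q lo) y + K.dist y (g i) = K.dist (q lo) (g i) := hy
      have t1 := hc.dist_triangle (u := q t) (v := z) (w := y)
      have t2 := hc.dist_triangle (u := q t) (v := y) (w := g i)
      have t3 := hc.dist_triangle (u := q lo) (v := y) (w := q t)
      have c1 := K.dist_comm (u := q t) (v := y)
      rcases hlo with h | h
      · have e : K.dist (q lo) (g i) = 0 := by rw [gi h]; simp
        omega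
      · unfold marg at h
        omega
  · exact ⟨j, hj1, hz⟩

/-- A coarse piecewise geodesic, without the condition on the lengths of its pieces. -/
structure IsPre (K : SimpleGraph V) (δ ε : ℕ) (x y : V) (f : ℕ → V) (n N : ℕ) (c d : ℕ → ℕ) :
    Prop where
  edge : IsEdgePath K f n
  first : f 0 = x
  last : f n = y
  loc : ∀ i j, i ≤ j → j ≤ n → j - i ≤ locScale δ ε → j - i ≤ 500 * δ * K.dist (f i) (f j)
  start : c 0 = 0
  finish : d N = n
  piece_le : ∀ i ≤ N, c i ≤ d i
  bridge_le : ∀ i < N, d i ≤ c (i + 1)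
  geo : ∀ i ≤ N, ∀ s t : ℕ, c i ≤ s → s ≤ t → t ≤ d i → t - s ≤ mu δ ε →
    K.dist (f s) (f t) = t - s
  bridge_length : ∀ i < N, c (i + 1) - d i ≤ ε
  close : ∃ (g : ℕ → V) (m : ℕ), IsGeoFun K g m ∧ g 0 = x ∧ g m = y ∧
    ∀ k ≤ n, ∃ j ≤ m, K.dist (f k) (g j) ≤ 2 * ε

/-- All the pieces but the first and the last have length at least `l`. -/
def PiecesGE (l N : ℕ) (c d : ℕ → ℕ) : Prop := ∀ i, 0 < i → i < N → l ≤ d i - c i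

/-- The vertex `v = f t` is at distance at least `l` from the ends of the piece of index `i`,
except from those which are ends of `f`. -/
structure IsDeep (K : SimpleGraph V) (l : ℕ) (x y : V) (f : ℕ → V) (N : ℕ) (c d : ℕ → ℕ)
    (i t : ℕ) : Prop where
  le : i ≤ N
  ge_c : c i ≤ t
  le_d : t ≤ d i
  left : f (c i) ≠ x → l ≤ K.dist (f (c i)) (f t)
  right : f (d i) ≠ y → l ≤ K.dist (f (d i)) (f t)

theorem IsPre.d_le_c {x y : V} {f : ℕ → V} {n N : ℕ} {c d : ℕ → ℕ}
    (h : IsPre K δ ε x y f n N c d) {i j : ℕ} (hij : i < j) (hj : j ≤ N) :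
    d i ≤ c j := by
  induction j, hij using Nat.le_induction with
  | base => exact h.bridge_le i (by omega)
  | succ j hij ih =>
    have := ih (by omega)
    have h1 := h.piece_le j (by omega)
    have h2 := h.bridge_le j (by omega)
    omega

theorem IsPre.d_le {x y : V} {f : ℕ → V} {n N : ℕ} {c d : ℕ → ℕ}
    (h : IsPre K δ ε x y f n N c d) {i : ℕ} (hi : i ≤ N) : d i ≤ n := by
  rcases Nat.lt_or_ge i N with hlt | hge
  · have h1 := h.d_le_c hlt le_rfl
    have h2 := h.piece_le N le_rfl
    rw [h.finish] at h2
    omega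
  · rw [show i = N by omega, h.finish]

theorem mem_cylinder_iff (hc : K.Connected) {l : ℕ} {x y v : V} :
    v ∈ cylinder K δ ε l x y ↔ ∃ (f : ℕ → V) (n N : ℕ) (c d : ℕ → ℕ),
      IsPre K δ ε x y f n N c d ∧ PiecesGE l N c d ∧
        ∃ i t, IsDeep K l x y f N c d i t ∧ f t = v := by
  constructor
  · rintro ⟨f, N, c, d, h, i, hi, t, h1, h2, rfl, h3, h4⟩
    refine ⟨f.getVert, f.length, N, c, d, ⟨isEdgePath_getVert f, f.getVert_zero, f.getVert_length,
      fun i j h1 h2 h3 => (h.local_quasi i j h1 h2 h3).1, h.start, h.finish, h.piece_le,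
      h.bridge_le, h.local_geodesic, h.bridge_length, ?_⟩, h.piece_length,
      i, t, ⟨hi, h1, h2, h3, h4⟩, rfl⟩
    obtain ⟨g, hg, hcl⟩ := h.close
    refine ⟨g.getVert, g.length, hg.isGeoFun hc, g.getVert_zero, g.getVert_length, fun k hk => ?_⟩
    obtain ⟨w, hw, hd⟩ := hcl _ (f.getVert_mem_support k)
    obtain ⟨j, hj, rfl⟩ := (mem_support_iff_getVert _).1 hw
    exact ⟨j, hj, hd⟩
  · rintro ⟨f, n, N, c, d, h, hp, i, t, hD, rfl⟩
    have hdn : d i ≤ n := h.d_le hD.le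
    obtain ⟨w, hw, hk⟩ := h.edge.exists_walk' h.first h.last
    have ht : t ≤ n := hD.le_d.trans hdn
    have hcn : c i ≤ n := hD.ge_c.trans ht
    refine ⟨w, N, c, d, ⟨?_, h.start, by rw [h.finish, hw], h.piece_le, h.bridge_le, ?_, hp,
      h.bridge_length, ?_⟩, i, hD.le, t, hD.ge_c, hD.le_d, hk t ht, ?_, ?_⟩
    · intro a b hab hb hL
      rw [hw] at hb
      rw [hk a (by omega), hk b hb]
      refine ⟨h.loc a b hab hb hL, (h.edge.dist_le hab hb).trans ?_⟩
      rcases Nat.eq_zero_or_pos (500 * δ) with h0 | hpos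
      · have := h.loc a b hab hb hL
        rw [h0] at this ⊢
        omega
      · exact Nat.le_mul_of_pos_left _ hpos
    · intro j hj s t h1 h2 h3 h4
      have := h.d_le hj
      rw [hk s (by omega), hk t (by omega)]
      exact h.geo j hj s t h1 h2 h3 h4
    · obtain ⟨g, m, hg, g0, gm, hcl⟩ := h.close
      obtain ⟨wg, hwg, hwgl, hwgk⟩ := hg.exists_walk g0 gm
      refine ⟨wg, hwg, fun u hu => ?_⟩
      obtain ⟨k, hk1, rfl⟩ := (mem_support_iff_getVert _).1 hu
      rw [hw] at hk1
      obtain ⟨j, hj, hd⟩ := hcl k hk1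
      exact ⟨_, wg.getVert_mem_support j, by rw [hk k hk1, hwgk j hj]; exact hd⟩
    · rw [hk _ hcn]; exact hD.left
    · rw [hk _ hdn]; exact hD.right

section Pre

variable {x y : V} {f : ℕ → V} {n N l : ℕ} {c d : ℕ → ℕ}

theorem IsPre.isQG (H : IsHypGraph K δ) (h : IsPre K δ ε x y f n N c d) :
    IsQG K (lam δ) f n := by
  obtain ⟨g, m, hg, -, -, hcl⟩ := h.close
  exact isQG_of_local H h.edge h.loc hg hcl

theorem IsPre.near (S : IsSetup K δ ε) (h : IsPre K δ ε x y f n N c d) {g : ℕ → V} {m : ℕ}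
    (hg : IsGeoFun K g m) (h0 : g 0 = x) (hm : g m = y) {t : ℕ} (ht : t ≤ n) :
    ∃ i ≤ m, K.dist (f t) (g i) ≤ morseConst δ :=
  S.near h.edge (h.isQG S.toIsHypGraph) hg (h0.trans h.first.symm) (hm.trans h.last.symm) ht

theorem IsSetup.morse_le (S : IsSetup K δ ε) : 1000 * (morseConst δ + δ + 1) ≤ ε := by
  have h1 := S.eps_large
  have h2 := morse_le_baseAngle (δ := δ)
  omega

/-- The closeness condition follows from stability for any quasi-geodesic. -/
theorem IsSetup.exists_close (S : IsSetup K δ ε) (hf : IsEdgePath K f n)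
    (hQ : IsQG K (lam δ) f n) (hx : f 0 = x) (hy : f n = y) :
    ∃ (g : ℕ → V) (m : ℕ), IsGeoFun K g m ∧ g 0 = x ∧ g m = y ∧
      ∀ k ≤ n, ∃ j ≤ m, K.dist (f k) (g j) ≤ 2 * ε := by
  obtain ⟨g, h0, hm, hg⟩ := exists_geoFun S.conn x y
  refine ⟨g, _, hg, h0, hm, fun k hk => ?_⟩
  obtain ⟨j, hj, hd⟩ := S.near hf hQ hg (h0.trans hx.symm) (hm.trans hy.symm) hk
  have := S.morse_le
  exact ⟨j, hj, by omega⟩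

theorem IsPre.reverse (h : IsPre K δ ε x y f n N c d) :
    IsPre K δ ε y x (fun k => f (n - k)) n N (fun i => n - d (N - i)) (fun i => n - c (N - i)) where
  edge := h.edge.reverse
  first := by simpa using h.last
  last := by simpa using h.first
  loc i j hij hj hL := by
    have := h.loc (n - j) (n - i) (by omega) (by omega) (by omega)
    rw [K.dist_comm] at this
    show j - i ≤ 500 * δ * K.dist (f (n - i)) (f (n - j))
    omega
  start := by simp [h.finish]
  finish := by simp [h.start]
  piece_le i hi := by
    have := h.piece_le (N - i) (by omega)
    omega
  bridge_le i hi := by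
    have := h.bridge_le (N - (i + 1)) (by omega)
    rw [show N - (i + 1) + 1 = N - i by omega] at this
    omega
  geo i hi s t hs hst ht hmu := by
    have h1 := h.d_le (i := N - i) (by omega)
    have h2 := h.piece_le (N - i) (by omega)
    have := h.geo (N - i) (by omega) (n - t) (n - s) (by omega) (by omega) (by omega) (by omega)
    rw [K.dist_comm] at this
    show K.dist (f (n - s)) (f (n - t)) = _
    omega
  bridge_length i hi := by
    have := h.bridge_length (N - (i + 1)) (by omega)
    have h1 := h.d_le (i := N - i) (by omega)
    have h2 := h.piece_le (N - i) (by omega)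
    rw [show N - (i + 1) + 1 = N - i by omega] at this
    omega
  close := by
    obtain ⟨g, m, hg, h0, hm, hcl⟩ := h.close
    refine ⟨fun k => g (m - k), m, hg.reverse, by simpa using hm, by simpa using h0, fun k hk => ?_⟩
    obtain ⟨j, hj, hd⟩ := hcl (n - k) (by omega)
    refine ⟨m - j, by omega, ?_⟩
    show K.dist (f (n - k)) (g (m - (m - j))) ≤ _
    rwa [show m - (m - j) = j by omega]

theorem IsPre.piecesGE_reverse (h : IsPre K δ ε x y f n N c d) (hp : PiecesGE l N c d) :
    PiecesGE l N (fun i => n - d (N - i)) (fun i => n - c (N - i)) := by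
  intro i h1 h2
  have := hp (N - i) (by omega) (by omega)
  have h3 := h.d_le (i := N - i) (by omega)
  have h4 := h.piece_le (N - i) (by omega)
  show l ≤ (n - c (N - i)) - (n - d (N - i))
  omega

theorem IsPre.isDeep_reverse (h : IsPre K δ ε x y f n N c d) {i t : ℕ}
    (hD : IsDeep K l x y f N c d i t) :
    IsDeep K l y x (fun k => f (n - k)) N (fun i => n - d (N - i)) (fun i => n - c (N - i))
      (N - i) (n - t) := by
  have h1 := hD.le
  have h2 := hD.ge_c
  have h3 := hD.le_d
  have h4 := h.d_le h1
  have e1 : N - (N - i) = i := by omega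
  have e2 : n - (n - t) = t := by omega
  have e3 : n - (n - d i) = d i := by omega
  have e4 : n - (n - c i) = c i := by omega
  refine ⟨by omega, by rw [e1]; omega, by rw [e1]; omega, ?_, ?_⟩
  · simp only [e1, e2, e3]
    exact hD.right
  · simp only [e1, e2, e4]
    exact hD.left

theorem cylinder_symm (hc : K.Connected) (l : ℕ) (x y : V) :
    cylinder K δ ε l x y = cylinder K δ ε l y x := by
  have key : ∀ x y : V, cylinder K δ ε l x y ⊆ cylinder K δ ε l y x := by
    intro x y v hv
    obtain ⟨f, n, N, c, d, h, hp, i, t, hD, rfl⟩ := (mem_cylinder_iff hc).1 hv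
    refine (mem_cylinder_iff hc).2 ⟨_, n, N, _, _, h.reverse, h.piecesGE_reverse hp, _, _,
      h.isDeep_reverse hD, ?_⟩
    have := h.d_le hD.le
    have := hD.le_d
    show f (n - (n - t)) = f t
    congr 1; omega
  exact Set.Subset.antisymm (key x y) (key y x)

theorem isPre_of_geo (H : IsHypGraph K δ) {g : ℕ → V} {m : ℕ} (hg : IsGeoFun K g m) :
    IsPre K δ ε (g 0) (g m) g m 0 (fun _ => 0) (fun _ => m) where
  edge := hg.edgePath
  first := rfl
  last := rfl
  loc i j hij hj _ := by
    rw [hg i j hij hj]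
    exact Nat.le_mul_of_pos_left _ (by have := H.two_le; omega)
  start := rfl
  finish := rfl
  piece_le _ _ := Nat.zero_le _
  bridge_le _ h := absurd h (Nat.not_lt_zero _)
  geo _ _ s t _ hst ht _ := hg s t hst ht
  bridge_length _ h := absurd h (Nat.not_lt_zero _)
  close := ⟨g, m, hg, rfl, rfl, fun k hk => ⟨k, hk, by simp⟩⟩

theorem mem_cylinder_of_btw (H : IsHypGraph K δ) {v : V} (hv : Btw K x v y) :
    v ∈ cylinder K δ ε l x y := by
  obtain ⟨g, h0, hv', hm, hg⟩ := hv.exists_geoFun H.conn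
  have hle : K.dist x v ≤ K.dist x y := by
    have : K.dist x v + K.dist v y = K.dist x y := hv
    omega
  have hpre := isPre_of_geo (ε := ε) H hg
  rw [h0, hm] at hpre
  exact (mem_cylinder_iff H.conn).2 ⟨g, _, 0, _, _, hpre, fun i _ h => absurd h (Nat.not_lt_zero _),
    0, K.dist x v, ⟨le_rfl, Nat.zero_le _, hle, fun h => absurd h0 h, fun h => absurd hm h⟩, hv'⟩

theorem left_mem_cylinder (H : IsHypGraph K δ) (x y : V) : x ∈ cylinder K δ ε l x y :=
  mem_cylinder_of_btw H (btw_left x y)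

theorem right_mem_cylinder (H : IsHypGraph K δ) (x y : V) : y ∈ cylinder K δ ε l x y :=
  mem_cylinder_of_btw H (btw_right x y)

/-- An initial part of a piecewise geodesic is a piecewise geodesic. -/
theorem IsPre.trunc (S : IsSetup K δ ε) (h : IsPre K δ ε x y f n N c d) {τ : ℕ} (hτ : τ ≤ n) :
    ∃ N' ≤ N, IsPre K δ ε x (f τ) f τ N' (fun i => min (c i) τ) (fun i => min (d i) τ) ∧
      (∀ j < N', d j < τ) ∧ τ ≤ d N' := by
  classical
  have hex : ∃ i, τ ≤ d i := ⟨N, by rw [h.finish]; exact hτ⟩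
  set N' := Nat.find hex with hN'
  have h1 : τ ≤ d N' := Nat.find_spec hex
  have h2 : ∀ j < N', d j < τ := fun j hj => Nat.lt_of_not_le (Nat.find_min hex hj)
  have h3 : N' ≤ N := Nat.find_min' hex (by rw [h.finish]; exact hτ)
  refine ⟨N', h3, ?_, h2, h1⟩
  refine ⟨h.edge.mono hτ, h.first, rfl, fun i j hij hj => h.loc i j hij (by omega),
    by simp [h.start], by simpa using h1, fun i hi => ?_, fun i hi => ?_, ?_, fun i hi => ?_,
    S.exists_close (h.edge.mono hτ) ((h.isQG S.toIsHypGraph).mono hτ) h.first rfl⟩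
  · have := h.piece_le i (by omega)
    omega
  · have := h.bridge_le i (by omega)
    omega
  · intro i hi s t hs hst ht hmu
    rcases Nat.lt_or_ge τ (c i) with hlt | hge
    · rw [show s = t by omega]; simp
    · exact h.geo i (by omega) s t (by omega) hst (by omega) hmu
  · have := h.bridge_length i (by omega)
    have h4 := h2 i hi
    omega

theorem IsPre.mem_cylinder_trunc (S : IsSetup K δ ε) (h : IsPre K δ ε x y f n N c d)
    (hp : PiecesGE l N c d) {i t : ℕ} (hD : IsDeep K l x y f N c d i t) {τ : ℕ} (hτ : τ ≤ n)
    (ht : t ≤ τ) : f t ∈ cylinder K δ ε l x (f τ) := by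
  have hQ := h.isQG S.toIsHypGraph
  obtain ⟨N', hN', h', hlt, hge⟩ := h.trunc S hτ
  have hD1 := hD.ge_c
  have hD2 := hD.le_d
  rcases Nat.lt_or_ge N' i with hi | hi
  · have := h.d_le_c hi hD.le
    rw [show t = τ by omega]
    exact right_mem_cylinder S.toIsHypGraph _ _
  · refine (mem_cylinder_iff S.conn).2 ⟨f, τ, N', _, _, h', ?_, i, t, ⟨hi, ?_, ?_, ?_, ?_⟩, rfl⟩
    · intro j h1 h2
      have h3 := hlt j h2
      have h4 := hp j h1 (by omega)
      have h5 := h.piece_le j (by omega)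
      show l ≤ min (d j) τ - min (c j) τ
      omega
    · show min (c i) τ ≤ t
      omega
    · show t ≤ min (d i) τ
      omega
    · show f (min (c i) τ) ≠ x → l ≤ K.dist (f (min (c i) τ)) (f t)
      rw [show min (c i) τ = c i by omega]
      exact hD.left
    · show f (min (d i) τ) ≠ f τ → l ≤ K.dist (f (min (d i) τ)) (f t)
      intro hne
      rcases Nat.lt_or_ge (d i) τ with h1 | h1
      · rw [show min (d i) τ = d i by omega] at hne ⊢
        refine hD.right fun he => ?_
        rw [← h.last] at he
        have := hQ.inj (by omega) le_rfl he
        omega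
      · exact absurd (by rw [show min (d i) τ = τ by omega]) hne

/-- A vertex deep in a piece is `2 δ`-close to geodesics: it is in the middle of a geodesic stretch
long enough, unless this stretch begins or ends with the path, for the bound not to depend on the
stability constant. -/
theorem IsPre.close_of_isDeep (S : IsSetup K δ ε) (h : IsPre K δ ε x y f n N c d)
    (hl : mu δ ε ≤ l) {i t : ℕ} (hD : IsDeep K l x y f N c d i t) {g : ℕ → V} {m : ℕ}
    (hg : IsGeoFun K g m) (h0 : g 0 = x) (hm : g m = y) :
    ∃ j ≤ m, K.dist (f t) (g j) ≤ 2 * δ := by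
  have hQ := h.isQG S.toIsHypGraph
  have hD1 := hD.ge_c
  have hD2 := hD.le_d
  have hdn := h.d_le hD.le
  have k1 := S.marg_le
  have k2 := eighty_thousand_mul_le_locScale (ε := ε) S.two_le
  have k3 := ten_mul_locScale_le_mu (δ := δ) (ε := ε)
  refine S.close_of_stretch h.edge hQ hg (h0.trans h.first.symm) (hm.trans h.last.symm)
    (lo := max (c i) (t - marg δ)) (hi := min (d i) (t + marg δ)) (by omega) (by omega) (by omega)
    (h.geo i hD.le _ _ (by omega) (by omega) (by omega) (by omega)) ?_ ?_
  · by_cases hx : f (c i) = x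
    · rw [← h.first] at hx
      have := hQ.inj (by omega) (Nat.zero_le _) hx
      omega
    · have h1 := hD.left hx
      have h2 := h.edge.dist_le hD1 (by omega)
      omega
  · by_cases hy : f (d i) = y
    · rw [← h.last] at hy
      have := hQ.inj (by omega) le_rfl hy
      omega
    · have h1 := hD.right hy
      have h2 := h.edge.dist_le hD2 (by omega)
      rw [K.dist_comm] at h1
      omega

theorem cylinder_close (S : IsSetup K δ ε) (hl : mu δ ε ≤ l) {v : V}
    (hv : v ∈ cylinder K δ ε l x y) {g : ℕ → V} {m : ℕ}
    (hg : IsGeoFun K g m) (h0 : g 0 = x) (hm : g m = y) :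
    ∃ j ≤ m, K.dist v (g j) ≤ 2 * δ := by
  obtain ⟨f, n, N, c, d, h, -, i, t, hD, rfl⟩ := (mem_cylinder_iff S.conn).1 hv
  exact h.close_of_isDeep S hl hD hg h0 hm

/-- Every vertex of a cylinder lies on a quasi-geodesic with the same ends. -/
theorem exists_quasiGeodesic_of_mem_cylinder (H : IsHypGraph K δ) {v : V}
    (hv : v ∈ cylinder K δ ε l x y) : ∃ (f : ℕ → V) (n t : ℕ), IsEdgePath K f n ∧
      IsQG K (lam δ) f n ∧ f 0 = x ∧ f n = y ∧ t ≤ n ∧ f t = v := by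
  obtain ⟨f, n, N, c, d, h, -, i, t, hD, rfl⟩ := (mem_cylinder_iff H.conn).1 hv
  exact ⟨f, n, t, h.edge, h.isQG H, h.first, h.last, hD.le_d.trans (h.d_le hD.le), rfl⟩

theorem cylinder_self (H : IsHypGraph K δ) (x : V) : cylinder K δ ε l x x = {x} := by
  refine Set.Subset.antisymm (fun v hv => ?_)
    (Set.singleton_subset_iff.2 (left_mem_cylinder H x x))
  obtain ⟨f, n, t, -, hQ, h0, hn, ht, rfl⟩ := exists_quasiGeodesic_of_mem_cylinder H hv
  have := hQ.inj (Nat.zero_le _) le_rfl (h0.trans hn.symm)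
  rw [show t = 0 by omega, h0]
  rfl

theorem IsSetup.isConicalConstant (S : IsSetup K δ ε) : IsConicalConstant K (lam δ) ε := by
  refine isConicalConstant_of_le S.toIsHypGraph ?_
  have h1 := S.eps_large
  have h2 : angConst δ (morseConst δ) ≤ baseAngle δ := angConst_mono (by omega)
  omega

theorem IsEdgePath.exists_quasiGeodesic_walk (H : IsHypGraph K δ) (hf : IsEdgePath K f n)
    (hQ : IsQG K (lam δ) f n) (hx : f 0 = x) (hy : f n = y) :
    ∃ w : K.Walk x y, IsQuasiGeodesic K (lam δ) w ∧ ∀ k ≤ n, f k ∈ w.support := by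
  obtain ⟨w, hw, hk⟩ := hf.exists_walk' hx hy
  refine ⟨w, fun i j hij hj => ?_, fun k hkn => ?_⟩
  · rw [hw] at hj
    rw [hk i (by omega), hk j hj]
    exact ⟨hQ i j hij hj, (hf.dist_le hij hj).trans (Nat.le_mul_of_pos_left _ (lam_pos H.two_le))⟩
  · rw [← hk k hkn]
    exact w.getVert_mem_support k

theorem cylinder_subset_conical (S : IsSetup K δ ε) (hxy : x ≠ y) {g : K.Walk x y}
    (hg : IsGeodesic K g) : cylinder K δ ε l x y ⊆ conicalNeighbourhood K ε g := by
  intro v hv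
  obtain ⟨f, n, t, hf, hQ, h0, hn, ht, rfl⟩ :=
    exists_quasiGeodesic_of_mem_cylinder S.toIsHypGraph hv
  obtain ⟨w, hw, hk⟩ := hf.exists_quasiGeodesic_walk S.toIsHypGraph hQ h0 hn
  exact S.isConicalConstant x y hxy w g hw hg _ (hk t ht)

theorem dist_le_of_mem_cylinder (S : IsSetup K δ ε) (hl : mu δ ε ≤ l) {v : V}
    (hv : v ∈ cylinder K δ ε l x y) : K.dist x v + K.dist v y ≤ K.dist x y + 4 * δ := by
  obtain ⟨g, h0, hm, hg⟩ := exists_geoFun S.conn x y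
  obtain ⟨j, hj, hd⟩ := cylinder_close S hl hv hg h0 hm
  have hb := hg.btw hj
  rw [h0, hm] at hb
  have hb' : K.dist x (g j) + K.dist (g j) y = K.dist x y := hb
  have t1 := S.conn.dist_triangle (u := x) (v := g j) (w := v)
  have t2 := S.conn.dist_triangle (u := v) (v := g j) (w := y)
  have c1 := K.dist_comm (u := g j) (v := v)
  omega

theorem cylinder_window (S : IsSetup K δ ε) {P : ℕ} (hP : ConeBound K ε P) (hxy : x ≠ y)
    (s L : ℕ) : {w | w ∈ cylinder K δ ε l x y ∧ s ≤ K.dist x w ∧ K.dist x w ≤ s + L}.Finite ∧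
    {w | w ∈ cylinder K δ ε l x y ∧ s ≤ K.dist x w ∧ K.dist x w ≤ s + L}.ncard ≤
      (L + 2 * ε + 2) * (2 * P) := by
  obtain ⟨g, hg⟩ := exists_geodesic S.conn x y
  obtain ⟨h1, h2⟩ := hP.window S.conn hg s L
  have hsub : {w | w ∈ cylinder K δ ε l x y ∧ s ≤ K.dist x w ∧ K.dist x w ≤ s + L} ⊆
      {w | w ∈ conicalNeighbourhood K ε g ∧ s ≤ K.dist x w ∧ K.dist x w ≤ s + L} :=
    fun w hw => ⟨cylinder_subset_conical S hxy hg hw.1, hw.2⟩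
  exact ⟨h1.subset hsub, (Set.ncard_le_ncard hsub h1).trans h2⟩

theorem finite_cylinder (S : IsSetup K δ ε) {P : ℕ} (hP : ConeBound K ε P) (hl : mu δ ε ≤ l)
    (x y : V) : (cylinder K δ ε l x y).Finite := by
  rcases eq_or_ne x y with rfl | hxy
  · rw [cylinder_self S.toIsHypGraph]; exact Set.finite_singleton _
  · refine (cylinder_window S hP hxy (l := l) 0 (K.dist x y + 4 * δ)).1.subset fun v hv => ?_
    have := dist_le_of_mem_cylinder S hl hv
    exact ⟨hv, Nat.zero_le _, by omega⟩

end Pre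

/-! ### Vertices with large angles -/

/-- The angle at `v` between geodesics from `v` to `a` and to `b` is always larger than `B`. -/
def Wide (K : SimpleGraph V) (B : ℕ) (a v b : V) : Prop :=
  v ≠ a ∧ v ≠ b ∧ ∀ e e', FE K v e a → FE K v e' b → ¬ PathIn K (· ≠ v) B e e'

theorem hundred_mul_le_baseAngle (H : 2 ≤ δ) : 100 * δ ≤ baseAngle δ := by
  have h : lam δ ≤ escapeConst δ (3 * morseConst δ + 2) := Nat.le_mul_of_pos_right _ (by omega)
  unfold lam at h
  unfold baseAngle angConst
  omega

theorem Wide.mono {B B' : ℕ} {a v b : V} (h : Wide K B a v b) (hB : B' ≤ B) : Wide K B' a v b :=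
  ⟨h.1, h.2.1, fun e e' he he' hp => h.2.2 e e' he he' (hp.mono hB)⟩

theorem Wide.symm {B : ℕ} {a v b : V} (h : Wide K B a v b) : Wide K B b v a :=
  ⟨h.2.1, h.1, fun e e' he he' hp => h.2.2 e' e he' he hp.symm⟩

theorem Wide.btw (H : IsHypGraph K δ) {B : ℕ} {a v b : V} (h : Wide K B a v b)
    (hB : 13 * δ ≤ B) : Btw K a v b := by
  obtain ⟨e, he⟩ := exists_FE H.conn h.1
  obtain ⟨e', he'⟩ := exists_FE H.conn h.2.1
  exact btw_of_wide H he he' fun hp => h.2.2 e e' he he' (hp.mono hB)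

/-- Two geodesics with the same ends make a small angle. -/
theorem pathIn_of_FE (H : IsHypGraph K δ) {v e e' a : V} (he : FE K v e a) (he' : FE K v e' a) :
    PathIn K (· ≠ v) (13 * δ) e e' := by
  by_contra hp
  have h : K.dist a v + K.dist v a = K.dist a a := btw_of_wide H he he' hp
  rw [SimpleGraph.dist_self] at h
  exact he.ne (eq_of_dist_eq_zero H.conn (by omega))

theorem Wide.of_one (H : IsHypGraph K δ) {B : ℕ} {a v b e e' : V} (he : FE K v e a)
    (he' : FE K v e' b) (h : ¬ PathIn K (· ≠ v) (B + 26 * δ) e e') : Wide K B a v b := by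
  refine ⟨he.ne, he'.ne, fun f f' hf hf' hp => h ?_⟩
  refine (((pathIn_of_FE H he hf).trans hp).trans (pathIn_of_FE H hf' he')).mono (by omega)

theorem FE.self {v w : V} (h : K.Adj v w) : FE K v w w :=
  ⟨h, by rw [SimpleGraph.dist_self, SimpleGraph.dist_eq_one_iff_adj.2 h]⟩

section Path

variable {q : ℕ → V} {n : ℕ}

theorem angConst_one_le : angConst δ 1 ≤ baseAngle δ := angConst_mono (by omega)

/-- A neighbour of `v` on a quasi-geodesic is seen from `v` in the direction of one of its
ends. -/
theorem IsQG.end_direction (H : IsHypGraph K δ) (hq : IsEdgePath K q n) (hQ : IsQG K (lam δ) q n)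
    {v : V} {t : ℕ} (ht : t ≤ n) (hv : K.Adj v (q t)) :
    (v ≠ q n ∧ ∀ e, FE K v e (q n) → PathIn K (· ≠ v) (baseAngle δ) (q t) e) ∨
      (v ≠ q 0 ∧ ∀ e, FE K v e (q 0) → PathIn K (· ≠ v) (baseAngle δ) (q t) e) := by
  have h1 : K.dist v (q t) ≤ 1 := (SimpleGraph.dist_eq_one_iff_adj.2 hv).le
  rcases hQ.avoid_or ht hv.ne.symm with h | h
  · exact Or.inl ⟨(h n ht le_rfl).symm, fun e he =>
      (angle_right H hq hQ ht h h1 (FE.self hv) he).mono angConst_one_le⟩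
  · exact Or.inr ⟨(h 0 (Nat.zero_le _)).symm, fun e he =>
      (angle_left H hq hQ ht h h1 (FE.self hv) he).mono angConst_one_le⟩

/-- Quasi-geodesics pass through the vertices where geodesics make a large angle. -/
theorem Wide.exists_eq (H : IsHypGraph K δ) (hq : IsEdgePath K q n) (hQ : IsQG K (lam δ) q n)
    {v : V} {B : ℕ} (hW : Wide K B (q 0) v (q n)) (hB : 3 * baseAngle δ ≤ B) :
    ∃ t ≤ n, q t = v := by
  classical
  have hc := H.conn
  have hA := hundred_mul_le_baseAngle H.two_le
  by_contra hne
  push Not at hne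
  have key : ∀ t ≤ n, ¬ K.dist v (q t) ≤ 3 * morseConst δ + 2 := by
    intro t ht hd
    obtain ⟨e, he⟩ := exists_FE hc (hne t ht).symm
    obtain ⟨e1, he1⟩ := exists_FE hc hW.1
    obtain ⟨e2, he2⟩ := exists_FE hc hW.2.1
    have p1 := angle_left H hq hQ ht (fun k hk => hne k (by omega)) hd he he1
    have p2 := angle_right H hq hQ ht (fun k _ hk => hne k hk) hd he he2
    refine hW.2.2 e1 e2 he1 he2 ((p1.symm.trans p2).mono ?_)
    change baseAngle δ + baseAngle δ ≤ B
    omega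
  have hb := hW.btw H (by omega)
  obtain ⟨g, g0, gv, gm, hg⟩ := hb.exists_geoFun hc
  set k0 := K.dist (q 0) v with hk0
  set m := K.dist (q 0) (q n) with hm
  have hk0m : k0 ≤ m := by
    have : K.dist (q 0) v + K.dist v (q n) = K.dist (q 0) (q n) := hb
    omega
  have hex : ∃ t, t ≤ n ∧ ∃ i, k0 ≤ i ∧ i ≤ m ∧ K.dist (q t) (g i) ≤ morseConst δ :=
    ⟨n, le_rfl, m, hk0m, le_rfl, by rw [gm]; simp⟩
  obtain ⟨h1, i, h2, h3, h4⟩ := Nat.find_spec hex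
  set t := Nat.find hex with ht
  have hi : K.dist v (g i) = i - k0 := by rw [← gv]; exact hg k0 i h2 h3
  rcases Nat.eq_zero_or_pos t with h0 | hpos
  · rw [h0] at h4
    have e1 : K.dist (q 0) (g i) = i := by rw [← g0]; exact hg.dist_zero h3
    refine key 0 (Nat.zero_le _) ?_
    have c1 := K.dist_comm (u := v) (v := q 0)
    omega
  · obtain ⟨j, hj, hjd⟩ := quasiGeodesic_near_geodesic hc (by have := H.two_le; omega) H.hyp hq hQ
      hg g0 gm (t := t - 1) (by omega)
    have hjk : j < k0 := by
      by_contra hge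
      exact Nat.find_min hex (m := t - 1) (by omega) ⟨by omega, j, by omega, hj, hjd⟩
    have e1 := hg j i (by omega) h3
    have e2 := hq.dist_le (i := t - 1) (j := t) (by omega) h1
    have t1 := hc.dist_triangle (u := g j) (v := q (t - 1)) (w := g i)
    have t2 := hc.dist_triangle (u := q (t - 1)) (v := q t) (w := g i)
    have t3 := hc.dist_triangle (u := v) (v := g i) (w := q t)
    have c1 := K.dist_comm (u := q (t - 1)) (v := g j)
    have c2 := K.dist_comm (u := q t) (v := g i)
    exact key t h1 (by omega)

/-- The points of a quasi-geodesic ending at `v` are all seen from `v` in the same direction. -/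
theorem IsQG.same_direction (H : IsHypGraph K δ) (hq : IsEdgePath K q n) (hQ : IsQG K (lam δ) q n)
    {s : ℕ} (hs : s < n) {e e' : V} (he : FE K (q n) e (q s)) (he' : FE K (q n) e' (q 0)) :
    PathIn K (· ≠ q n) (2 * baseAngle δ) e e' := by
  have hadj : K.Adj (q n) (q (n - 1)) := by
    have := hq (n - 1) (by omega)
    rw [show n - 1 + 1 = n by omega] at this
    exact this.symm
  have h1 : K.dist (q n) (q (n - 1)) ≤ 1 := (SimpleGraph.dist_eq_one_iff_adj.2 hadj).le
  have hne : ∀ k ≤ n - 1, q k ≠ q n := fun k hk heq => by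
    have := hQ.inj (by omega) le_rfl heq
    omega
  have p1 := angle_left H (hq.mono (by omega : n - 1 ≤ n)) (hQ.mono (by omega)) le_rfl hne h1
    (FE.self hadj) he'
  have e1 : s + (n - 1 - s) = n - 1 := by omega
  have p2 := angle_left H (q := fun k => q (s + k)) (n := n - 1 - s) (v := q n)
    (hq.shift (by omega)) (hQ.shift (by omega)) le_rfl (fun k hk => hne _ (by omega)) (B := 1)
    (e := q (n - 1)) (by simpa [e1] using h1) (by simpa [e1] using FE.self hadj) (by simpa using he)
  have := angConst_one_le (δ := δ)
  exact (p2.symm.trans p1).mono (by omega)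

end Path

section Cylinder

variable {a b v w w' : V} {l Θ : ℕ}

theorem end_direction_of_mem_cylinder (S : IsSetup K δ ε) (hw : w ∈ cylinder K δ ε l a b)
    (hv : K.Adj v w) : (v ≠ b ∧ ∀ e, FE K v e b → PathIn K (· ≠ v) (baseAngle δ) w e) ∨
      (v ≠ a ∧ ∀ e, FE K v e a → PathIn K (· ≠ v) (baseAngle δ) w e) := by
  obtain ⟨f, n, t, hf, hQ, rfl, rfl, ht, rfl⟩ :=
    exists_quasiGeodesic_of_mem_cylinder S.toIsHypGraph hw
  exact hQ.end_direction S.toIsHypGraph hf ht hv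

theorem pathIn_of_mem_cylinder_left (S : IsSetup K δ ε) (hw : w ∈ cylinder K δ ε l a b)
    (hw' : w' ∈ cylinder K δ ε l a b) (hv : K.Adj a w) (hv' : K.Adj a w') :
    PathIn K (· ≠ a) (2 * baseAngle δ) w w' := by
  have h1 := end_direction_of_mem_cylinder S hw hv
  have h2 := end_direction_of_mem_cylinder S hw' hv'
  simp only [ne_eq, not_true_eq_false, false_and, or_false] at h1 h2
  obtain ⟨e, he⟩ := exists_FE S.conn h1.1
  exact ((h1.2 e he).trans (h2.2 e he).symm).mono (by omega)

theorem pathIn_of_mem_cylinder (S : IsSetup K δ ε) (hw : w ∈ cylinder K δ ε l a b)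
    (hw' : w' ∈ cylinder K δ ε l a b) (hv : K.Adj v w) (hv' : K.Adj v w') {e e' : V}
    (he : FE K v e a) (he' : FE K v e' b) {m : ℕ} (hm : PathIn K (· ≠ v) m e e') :
    PathIn K (· ≠ v) (m + 2 * baseAngle δ) w w' := by
  rcases end_direction_of_mem_cylinder S hw hv with h1 | h1 <;>
    rcases end_direction_of_mem_cylinder S hw' hv' with h2 | h2
  · exact ((h1.2 e' he').trans (h2.2 e' he').symm).mono (by omega)
  · exact (((h1.2 e' he').trans hm.symm).trans (h2.2 e he).symm).mono (by omega)
  · exact (((h1.2 e he).trans hm).trans (h2.2 e' he').symm).mono (by omega)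
  · exact ((h1.2 e he).trans (h2.2 e he).symm).mono (by omega)

/-- A vertex of a cylinder at which neighbours in the cylinder make a large angle is wide. -/
theorem wide_of_mem_cylinder (S : IsSetup K δ ε) (hw : w ∈ cylinder K δ ε l a b)
    (hw' : w' ∈ cylinder K δ ε l a b) (hv : K.Adj v w) (hv' : K.Adj v w') {B : ℕ}
    (hB : ¬ PathIn K (· ≠ v) (B + 2 * baseAngle δ) w w') : Wide K B a v b := by
  refine ⟨?_, ?_, fun e e' he he' hp => hB (pathIn_of_mem_cylinder S hw hw' hv hv' he he' hp)⟩
  · rintro rfl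
    exact hB ((pathIn_of_mem_cylinder_left S hw hw' hv hv').mono (by omega))
  · rintro rfl
    rw [cylinder_symm S.conn] at hw hw'
    exact hB ((pathIn_of_mem_cylinder_left S hw hw' hv hv').mono (by omega))

theorem IsParabolicSlice.wide (S : IsSetup K δ ε)
    (h : IsParabolicSlice K Θ (cylinder K δ ε l a b) v) {B : ℕ}
    (hB : B + 2 * baseAngle δ < Θ) : Wide K B a v b := by
  obtain ⟨-, w, hw, w', hw', hv, hv', hang⟩ := h
  refine wide_of_mem_cylinder S hw hw' hv hv' fun hp => ?_
  have := le_angle_iff.1 hang _ hp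
  omega

/-- The neighbours of `v` are taken on a geodesic from `a` to `b` through `v`. -/
theorem Wide.isParabolicSlice (H : IsHypGraph K δ) {B : ℕ} (hW : Wide K B a v b)
    (hB : 13 * δ ≤ B) (hΘ : Θ ≤ B + 1) : IsParabolicSlice K Θ (cylinder K δ ε l a b) v := by
  have hb : K.dist a v + K.dist v b = K.dist a b := hW.btw H hB
  have hc := H.conn
  obtain ⟨e, he⟩ := exists_FE hc hW.1
  obtain ⟨e', he'⟩ := exists_FE hc hW.2.1
  have c1 := K.dist_comm (u := v) (v := a)
  have c2 := K.dist_comm (u := e) (v := a)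
  have c3 := K.dist_comm (u := v) (v := e)
  refine ⟨mem_cylinder_of_btw H hb, e, mem_cylinder_of_btw H ?_, e', mem_cylinder_of_btw H ?_,
    he.adj, he'.adj, le_angle_iff.2 fun m hm => ?_⟩
  · have h1 := he.2
    have h2 := SimpleGraph.dist_eq_one_iff_adj.2 he.adj
    have t1 := hc.dist_triangle (u := e) (v := v) (w := b)
    have t2 := hc.dist_triangle (u := a) (v := e) (w := b)
    unfold Btw
    omega
  · have h1 := he'.2
    have h2 := SimpleGraph.dist_eq_one_iff_adj.2 he'.adj
    have t1 := hc.dist_triangle (u := a) (v := v) (w := e')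
    have t2 := hc.dist_triangle (u := a) (v := e') (w := b)
    unfold Btw
    omega
  · by_contra hlt
    exact hW.2.2 e e' he he' (hm.mono (by omega))

/-- The vertex `w` lies on a quasi-geodesic from `a` to `b`. -/
def OnQG (K : SimpleGraph V) (δ : ℕ) (a w b : V) : Prop :=
  ∃ (f : ℕ → V) (n t : ℕ), IsEdgePath K f n ∧ IsQG K (lam δ) f n ∧ f 0 = a ∧ f n = b ∧ t ≤ n ∧
    f t = w

theorem OnQG.of_mem_cylinder (H : IsHypGraph K δ) (hw : w ∈ cylinder K δ ε l a b) :
    OnQG K δ a w b := exists_quasiGeodesic_of_mem_cylinder H hw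

theorem OnQG.symm (h : OnQG K δ a w b) : OnQG K δ b w a := by
  obtain ⟨f, n, t, hf, hQ, h0, hn, ht, hft⟩ := h
  refine ⟨fun k => f (n - k), n, n - t, hf.reverse, hQ.reverse, by simpa using hn,
    by simpa using h0, by omega, ?_⟩
  show f (n - (n - t)) = w
  rw [← hft]
  congr 1; omega

/-- A wide vertex separates the points of the quasi-geodesics on its two sides. -/
theorem Wide.of_onQG (H : IsHypGraph K δ) {B : ℕ}
    (hW : Wide K (B + 4 * baseAngle δ) a v b) (hw : OnQG K δ a w v) (hwv : w ≠ v)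
    (hw' : OnQG K δ v w' b) (hwv' : w' ≠ v) : Wide K B w v w' := by
  obtain ⟨f, n, s, hf, hQ, hf0, hfn, hs, hfs⟩ := hw
  obtain ⟨g, m, t, hg, hQ', hg0, hgm, ht, hgt⟩ := hw'.symm
  obtain ⟨e1, he1⟩ := exists_FE H.conn hW.1
  obtain ⟨e2, he2⟩ := exists_FE H.conn hW.2.1
  refine ⟨hwv.symm, hwv'.symm, fun e e' he he' hp => hW.2.2 e1 e2 he1 he2 ?_⟩
  have hsn : s < n := lt_of_le_of_ne hs fun h => hwv (by rw [← hfs, h, hfn])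
  have htm : t < m := lt_of_le_of_ne ht fun h => hwv' (by rw [← hgt, h, hgm])
  have p1 := hQ.same_direction H hf hsn (e := e) (e' := e1) (by rw [hfn, hfs]; exact he)
    (by rw [hfn, hf0]; exact he1)
  have p2 := hQ'.same_direction H hg htm (e := e') (e' := e2) (by rw [hgm, hgt]; exact he')
    (by rw [hgm, hg0]; exact he2)
  rw [hfn] at p1
  rw [hgm] at p2
  exact ((p1.symm.trans hp).trans p2).mono (by omega)

theorem Wide.btw_of_onQG (H : IsHypGraph K δ) {B : ℕ} (hB : 5 * baseAngle δ ≤ B)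
    (hW : Wide K B a v b) (hw : OnQG K δ a w v) (hw' : OnQG K δ v w' b) : Btw K w v w' := by
  have hA := hundred_mul_le_baseAngle H.two_le
  rcases eq_or_ne w v with rfl | h1
  · exact btw_left _ _
  rcases eq_or_ne w' v with rfl | h2
  · exact btw_right _ _
  exact (Wide.of_onQG H (B := B - 4 * baseAngle δ) (hW.mono (by omega)) hw h1 hw' h2).btw
    H (by omega)

/-- Followed by a geodesic, a piecewise geodesic ending at a wide vertex remains a piecewise
geodesic: its last piece and the geodesic form a local geodesic. -/
theorem Wide.cylinder_left_subset (S : IsSetup K δ ε) {B : ℕ} (hB : 5 * baseAngle δ ≤ B)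
    (hW : Wide K B a v b) : cylinder K δ ε l a v ⊆ cylinder K δ ε l a b := by
  have H := S.toIsHypGraph
  have hc := S.conn
  have hA := hundred_mul_le_baseAngle H.two_le
  rintro u hu
  obtain ⟨f, n, N₀, c₀, d₀, h₀, hp, i, t, hD, rfl⟩ := (mem_cylinder_iff hc).1 hu
  obtain ⟨N, hN, h, hlt, hge⟩ := h₀.trunc S le_rfl
  have hn : ∀ i, i ≤ N₀ → min (d₀ i) n = d₀ i := fun i hi => min_eq_left (h₀.d_le hi)
  rcases Nat.lt_or_ge N i with hiN | hiN
  · have h1 := h₀.d_le_c hiN hD.le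
    have h2 := hD.ge_c
    have h3 := hD.le_d
    have h4 := h₀.d_le hD.le
    rw [show t = n by omega, h₀.last]
    exact mem_cylinder_of_btw H (hW.btw H (by omega))
  obtain ⟨g, g0, gm, hg⟩ := exists_geoFun hc v b
  set m := K.dist v b with hm
  have hfg : f n = g 0 := by rw [h₀.last, g0]
  have hcl : ∀ k ≤ n, catFun f n g k = f k := fun k hk => catFun_of_le hk
  have hcr : ∀ k, n ≤ k → catFun f n g k = g (k - n) := fun k hk => catFun_of_ge hfg hk
  have hQ := h₀.isQG H
  -- The vertex `v` is a gate, so distances from the path to the geodesic add up.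
  have hmid : ∀ s t, s ≤ n → n ≤ t → t ≤ n + m →
      K.dist (catFun f n g s) (catFun f n g t) = K.dist (f s) (f n) + (t - n) := by
    intro s t hs ht htm
    rw [hcl s hs, hcr t ht]
    have hb : Btw K (f s) v (g (t - n)) := hW.btw_of_onQG H hB
      ⟨f, n, s, h₀.edge, hQ, h₀.first, h₀.last, hs, rfl⟩
      ⟨g, m, t - n, hg.edgePath, hg.isQG (lam_pos H.two_le), g0, gm, by omega, rfl⟩
    have hb' : K.dist (f s) v + K.dist v (g (t - n)) = K.dist (f s) (g (t - n)) := hb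
    have e1 := hg.dist_zero (k := t - n) (by omega)
    rw [g0] at e1
    rw [h₀.last, ← hb', e1]
  have hright : ∀ s t, n ≤ s → s ≤ t → t ≤ n + m →
      K.dist (catFun f n g s) (catFun f n g t) = t - s := by
    intro s t hs hst ht
    rw [hcr s hs, hcr t (by omega), hg _ _ (by omega) (by omega)]
    omega
  have hedge := h₀.edge.cat hg.edgePath hfg
  have hexp : ∀ (Λ : ℕ) (s t : ℕ), 1 ≤ Λ → s ≤ t → t ≤ n + m →
      (∀ j, s ≤ j → j ≤ n → j ≤ t → j - s ≤ Λ * K.dist (f s) (f j)) →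
      t - s ≤ Λ * K.dist (catFun f n g s) (catFun f n g t) := by
    intro Λ s t hΛ hst ht hloc
    rcases Nat.lt_or_ge n s with hs | hs
    · rw [hright s t hs.le hst ht]
      exact Nat.le_mul_of_pos_left _ hΛ
    rcases Nat.lt_or_ge n t with ht' | ht'
    · rw [hmid s t hs ht'.le ht, Nat.mul_add]
      have h1 := hloc n hs le_rfl ht'.le
      have h2 : t - n ≤ Λ * (t - n) := Nat.le_mul_of_pos_left _ hΛ
      omega
    · rw [hcl s hs, hcl t ht']
      exact hloc t hst ht' le_rfl
  have hQ' : IsQG K (lam δ) (catFun f n g) (n + m) := fun s t hst ht =>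
    hexp _ s t (lam_pos H.two_le) hst ht fun j hj1 hj2 _ => hQ s j hj1 hj2
  have hlast : catFun f n g (n + m) = b := by rw [hcr _ (by omega), ← gm]; congr 1; omega
  have hfirst : catFun f n g 0 = a := (hcl 0 (Nat.zero_le _)).trans h₀.first
  have hdN : d₀ N = n := le_antisymm (h₀.d_le hN) hge
  refine (mem_cylinder_iff hc).2 ⟨catFun f n g, n + m, N, c₀,
    fun j => if j = N then n + m else d₀ j,
    ⟨hedge, hfirst, hlast, fun s t hst ht hL => ?_, h₀.start, if_pos rfl, fun j hj => ?_,
      fun j hj => ?_, ?_, fun j hj => ?_, S.exists_close hedge hQ' hfirst hlast⟩, ?_, i, t,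
    ⟨hiN, hD.ge_c, ?_, ?_, ?_⟩, hcl t (hD.le_d.trans (h₀.d_le hD.le))⟩
  · exact hexp _ s t (by have := H.two_le; omega) hst ht
      fun j hj1 hj2 hj3 => h₀.loc s j hj1 hj2 (by omega)
  · have := h₀.piece_le j (by omega)
    show c₀ j ≤ if j = N then n + m else d₀ j
    split_ifs with hjN
    · subst hjN; omega
    · exact this
  · have := h₀.bridge_le j (by omega)
    show (if j = N then n + m else d₀ j) ≤ _
    rwa [if_neg (by omega)]
  · intro j hj s t hs hst ht hmu
    have ht' : t ≤ if j = N then n + m else d₀ j := ht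
    split_ifs at ht' with hjN
    · subst hjN
      rcases Nat.lt_or_ge n s with hsn | hsn
      · exact hright s t hsn.le hst ht'
      rcases Nat.lt_or_ge n t with htn | htn
      · rw [hmid s t hsn htn.le ht', h₀.geo j hN s n hs hsn (by omega) (by omega)]
        omega
      · rw [hcl s hsn, hcl t htn]
        exact h₀.geo j hN s t hs hst (by omega) hmu
    · have := h₀.d_le (i := j) (by omega)
      rw [hcl s (by omega), hcl t (by omega)]
      exact h₀.geo j (by omega) s t hs hst ht' hmu
  · have := h₀.bridge_length j (by omega)
    show c₀ (j + 1) - (if j = N then n + m else d₀ j) ≤ ε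
    rwa [if_neg (by omega)]
  · intro j h1 h2
    show l ≤ (if j = N then n + m else d₀ j) - c₀ j
    rw [if_neg (by omega)]
    exact hp j h1 (by omega)
  · have := hD.le_d
    show t ≤ if i = N then n + m else d₀ i
    split_ifs with h1
    · subst h1; omega
    · exact this
  · have h1 := hD.ge_c
    have h2 := hD.le_d
    have h3 := h₀.d_le hD.le
    rw [hcl _ (by omega), hcl _ (by omega)]
    exact hD.left
  · have h2 := hD.le_d
    have h3 := h₀.d_le hD.le
    show catFun f n g (if i = N then n + m else d₀ i) ≠ b →
      l ≤ K.dist (catFun f n g (if i = N then n + m else d₀ i)) _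
    split_ifs with h1
    · exact fun h => absurd hlast h
    · intro _
      rw [hcl _ (by omega), hcl _ (by omega)]
      refine hD.right fun he => ?_
      rw [← h₀.last] at he
      have := hQ.inj (by omega) le_rfl he
      have := hlt i (by omega)
      omega

/-- A cylinder is the union of its two parts before and after a wide vertex. -/
theorem Wide.cylinder_eq (S : IsSetup K δ ε) {B : ℕ} (hB : 5 * baseAngle δ ≤ B)
    (hW : Wide K B a v b) :
    cylinder K δ ε l a b = cylinder K δ ε l a v ∪ cylinder K δ ε l v b := by
  have H := S.toIsHypGraph
  have hc := S.conn
  refine Set.Subset.antisymm (fun u hu => ?_) (Set.union_subset (hW.cylinder_left_subset S hB) ?_)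
  · obtain ⟨f, n, N, c, d, h, hp, i, t, hD, rfl⟩ := (mem_cylinder_iff hc).1 hu
    have hW' : Wide K B (f 0) v (f n) := by rw [h.first, h.last]; exact hW
    obtain ⟨τ, hτ, hv⟩ := hW'.exists_eq H h.edge (h.isQG H) (by omega)
    have htn := hD.le_d.trans (h.d_le hD.le)
    rcases le_total t τ with ht | ht
    · have := h.mem_cylinder_trunc S hp hD hτ ht
      rw [hv] at this
      exact Or.inl this
    · have := h.reverse.mem_cylinder_trunc S (h.piecesGE_reverse hp) (h.isDeep_reverse hD)
        (τ := n - τ) (by omega) (by omega)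
      rw [show n - (n - t) = t by omega, show n - (n - τ) = τ by omega, hv,
        cylinder_symm hc] at this
      exact Or.inr this
  · rw [cylinder_symm hc l v b, cylinder_symm hc l a b]
    exact hW.symm.cylinder_left_subset S hB

theorem Wide.adj_mem_left (S : IsSetup K δ ε) {B : ℕ} (hB : 5 * baseAngle δ ≤ B)
    (hW : Wide K B a v b) {u : V} (hu : u ∈ cylinder K δ ε l a v) (huv : u ≠ v)
    (hw : w ∈ cylinder K δ ε l a b) (huw : K.Adj u w) : w ∈ cylinder K δ ε l a v := by
  have H := S.toIsHypGraph
  rw [hW.cylinder_eq S hB] at hw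
  rcases hw with hw | hw
  · exact hw
  · have hb : K.dist u v + K.dist v w = K.dist u w :=
      hW.btw_of_onQG H hB (OnQG.of_mem_cylinder H hu) (OnQG.of_mem_cylinder H hw)
    have h1 := SimpleGraph.dist_eq_one_iff_adj.2 huw
    have h2 := S.conn.pos_dist_of_ne huv
    rw [← eq_of_dist_eq_zero S.conn (show K.dist v w = 0 by omega)]
    exact right_mem_cylinder H _ _

/-- Parabolic slices of a part of a cylinder are those of the whole cylinder. -/
theorem Wide.isParabolicSlice_left (S : IsSetup K δ ε) {B : ℕ} (hB : 5 * baseAngle δ ≤ B)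
    (hW : Wide K B a v b) {u : V} (hu : u ∈ cylinder K δ ε l a v)
    (huv : u ≠ v) : IsParabolicSlice K Θ (cylinder K δ ε l a b) u ↔
      IsParabolicSlice K Θ (cylinder K δ ε l a v) u := by
  constructor
  · rintro ⟨-, w, hw, w', hw', h1, h2, h3⟩
    exact ⟨hu, w, hW.adj_mem_left S hB hu huv hw h1, w', hW.adj_mem_left S hB hu huv hw' h2, h1,
      h2, h3⟩
  · rintro ⟨-, w, hw, w', hw', h1, h2, h3⟩
    exact ⟨hW.cylinder_left_subset S hB hu, w, hW.cylinder_left_subset S hB hw, w',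
      hW.cylinder_left_subset S hB hw', h1, h2, h3⟩

theorem IsParabolicSlice.ne (S : IsSetup K δ ε) (hΘ : 2 * baseAngle δ < Θ) {u : V}
    (h : IsParabolicSlice K Θ (cylinder K δ ε l a b) u) : u ≠ a ∧ u ≠ b := by
  have := h.wide S (B := 0) (by omega)
  exact ⟨this.1, this.2.1⟩

/-- The parabolic slices of a cylinder are those of its two parts at a parabolic slice `v`, and
`v`. -/
theorem IsParabolicSlice.split (S : IsSetup K δ ε) (hΘ : 7 * baseAngle δ < Θ)
    (hv : IsParabolicSlice K Θ (cylinder K δ ε l a b) v) {u : V} :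
    IsParabolicSlice K Θ (cylinder K δ ε l a b) u ↔
      IsParabolicSlice K Θ (cylinder K δ ε l a v) u ∨ u = v ∨
        IsParabolicSlice K Θ (cylinder K δ ε l v b) u := by
  have hB : 5 * baseAngle δ ≤ 5 * baseAngle δ := le_rfl
  have hW := hv.wide S (B := 5 * baseAngle δ) (by omega)
  have hW' := hW.symm
  have hsymm : ∀ s t : V, cylinder K δ ε l s t = cylinder K δ ε l t s := cylinder_symm S.conn l
  constructor
  · intro h
    have hu := h.1
    rcases eq_or_ne u v with rfl | huv
    · exact Or.inr (Or.inl rfl)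
    rw [hW.cylinder_eq S hB] at hu
    rcases hu with hu | hu
    · exact Or.inl ((hW.isParabolicSlice_left S hB hu huv).1 h)
    · rw [hsymm] at hu h
      rw [hsymm v b]
      exact Or.inr (Or.inr ((hW'.isParabolicSlice_left S hB hu huv).1 h))
  · rintro (h | rfl | h)
    · exact (hW.isParabolicSlice_left S hB h.1 (h.ne S (by omega)).2).2 h
    · exact hv
    · have hne := (h.ne S (by omega)).1
      rw [hsymm] at h ⊢
      exact (hW'.isParabolicSlice_left S hB h.1 hne).2 h

/-- A vertex where a side of a triangle makes a very large angle is parabolic for another side. -/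
theorem isParabolicSlice_or_of_lt_sliceAngle (S : IsSetup K δ ε) (hΘ : 2 * baseAngle δ < Θ)
    {x y z : V} (hvz : v ≠ z)
    (h : ¬ sliceAngle K (cylinder K δ ε l x y) v ≤ (3 * Θ + 100 * δ : ℕ)) :
    IsParabolicSlice K Θ (cylinder K δ ε l x z) v ∨
      IsParabolicSlice K Θ (cylinder K δ ε l y z) v := by
  have H := S.toIsHypGraph
  have hA := hundred_mul_le_baseAngle S.two_le
  unfold sliceAngle at h
  simp only [iSup_le_iff, not_forall, angle_le_iff] at h
  obtain ⟨w, hw, w', hw', hv, hv', hp⟩ := h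
  have hW : Wide K (2 * Θ + 100 * δ) x v y :=
    wide_of_mem_cylinder S hw hw' hv hv' fun h => hp (h.mono (by omega))
  obtain ⟨e, he⟩ := exists_FE S.conn hW.1
  obtain ⟨e', he'⟩ := exists_FE S.conn hW.2.1
  obtain ⟨e'', he''⟩ := exists_FE S.conn hvz
  by_cases h1 : PathIn K (· ≠ v) (Θ + 26 * δ) e e''
  · by_cases h2 : PathIn K (· ≠ v) (Θ + 26 * δ) e' e''
    · exact absurd ((h1.trans h2.symm).mono (by omega)) (hW.2.2 e e' he he')
    · exact Or.inr ((Wide.of_one H he' he'' h2).isParabolicSlice H (by omega) (by omega))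
  · exact Or.inl ((Wide.of_one H he he'' h1).isParabolicSlice H (by omega) (by omega))

end Cylinder

/-! ### Heights and regular slices -/

/-- The function on a cylinder issued from `a` of which `difference` is the coboundary. -/
noncomputable def height (K : SimpleGraph V) (δ : ℕ) (C : Set V) (a x : V) : ℤ :=
  (leftSet K δ C a x).ncard - (rightSet K δ C a x).ncard

section Height

variable {C C' : Set V} {a x y : V}

theorem finite_leftSet (hC : C.Finite) (a x : V) : (leftSet K δ C a x).Finite :=
  hC.subset fun _ h => h.1

theorem finite_rightSet (hC : C.Finite) (a x : V) : (rightSet K δ C a x).Finite :=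
  hC.subset fun _ h => h.1

theorem ncard_diff_sub_ncard_diff {A B : Set V} (hA : A.Finite) (hB : B.Finite) :
    ((A \ B).ncard : ℤ) - (B \ A).ncard = A.ncard - B.ncard := by
  have h1 := Set.ncard_inter_add_ncard_sdiff_eq_ncard A B hA
  have h2 := Set.ncard_inter_add_ncard_sdiff_eq_ncard B A hB
  rw [Set.inter_comm] at h2
  omega

theorem difference_eq_height_sub (hC : C.Finite) :
    difference K δ C a x y = height K δ C a x - height K δ C a y := by
  have h1 := ncard_diff_sub_ncard_diff (finite_leftSet (K := K) (δ := δ) hC a x)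
    (finite_leftSet (K := K) (δ := δ) hC a y)
  have h2 := ncard_diff_sub_ncard_diff (finite_rightSet (K := K) (δ := δ) hC a y)
    (finite_rightSet (K := K) (δ := δ) hC a x)
  unfold difference height
  omega

theorem difference_neg_of_lt (hc : K.Connected) (hC : C.Finite) (hx : x ∈ C)
    (h : K.dist a x + 100 * δ < K.dist a y) : difference K δ C a x y < 0 := by
  have e1 : leftSet K δ C a x \ leftSet K δ C a y = ∅ := by
    refine Set.eq_empty_of_forall_notMem fun v hv => hv.2 ⟨hv.1.1, by have := hv.1.2.1; omega, ?_⟩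
    have h1 := hv.1.2.1
    have t1 := hc.dist_triangle (u := a) (v := v) (w := y)
    have c1 := K.dist_comm (u := v) (v := y)
    omega
  have e2 : rightSet K δ C a y \ rightSet K δ C a x = ∅ := by
    refine Set.eq_empty_of_forall_notMem fun v hv => hv.2 ⟨hv.1.1, by have := hv.1.2.1; omega, ?_⟩
    have h1 := hv.1.2.1
    have t1 := hc.dist_triangle (u := a) (v := x) (w := v)
    omega
  have e3 : 0 < (leftSet K δ C a y \ leftSet K δ C a x).ncard := by
    rw [Set.ncard_pos ((finite_leftSet hC a y).sdiff)]
    refine ⟨x, ⟨hx, by omega, ?_⟩, fun h' => lt_irrefl _ h'.2.1⟩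
    have t1 := hc.dist_triangle (u := a) (v := x) (w := y)
    have c1 := K.dist_comm (u := x) (v := y)
    omega
  unfold difference
  rw [e1, e2]
  simp only [Set.ncard_empty]
  omega

theorem dist_le_of_difference_nonpos (hc : K.Connected) (hC : C.Finite) (hy : y ∈ C)
    (h : difference K δ C a x y ≤ 0) : K.dist a x ≤ K.dist a y + 100 * δ := by
  by_contra hlt
  have := difference_neg_of_lt (δ := δ) hc hC hy (x := y) (y := x) (a := a) (by omega)
  rw [difference_eq_height_sub hC] at this h
  omega

/-- The difference of two points depends only on the part of the cylinder that is not much further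
from its origin than they are. -/
theorem difference_congr (hc : K.Connected) {r : ℕ} (h : ∀ u, K.dist a u ≤ r → (u ∈ C ↔ u ∈ C'))
    (hx : K.dist a x + 100 * δ ≤ r) (hy : K.dist a y + 100 * δ ≤ r) :
    difference K δ C a x y = difference K δ C' a x y := by
  have hL : ∀ z, K.dist a z + 100 * δ ≤ r → leftSet K δ C a z = leftSet K δ C' a z := by
    intro z hz
    ext v
    constructor
    · rintro ⟨h1, h2, h3⟩
      exact ⟨(h v (by omega)).1 h1, h2, h3⟩
    · rintro ⟨h1, h2, h3⟩
      exact ⟨(h v (by omega)).2 h1, h2, h3⟩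
  have hR : ∀ (C C' : Set V), (∀ u, K.dist a u ≤ r → (u ∈ C ↔ u ∈ C')) →
      ∀ z w, K.dist a z + 100 * δ ≤ r → rightSet K δ C a w \ rightSet K δ C a z ⊆
        rightSet K δ C' a w \ rightSet K δ C' a z := by
    rintro C C' h z w hz v ⟨⟨h1, h2, h3⟩, h4⟩
    have hv : K.dist a v ≤ r := by
      by_contra hlt
      refine h4 ⟨h1, by omega, ?_⟩
      have t1 := hc.dist_triangle (u := a) (v := z) (w := v)
      omega
    exact ⟨⟨(h v hv).1 h1, h2, h3⟩, fun h' => h4 ⟨h1, h'.2⟩⟩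
  have hR' : ∀ z w, K.dist a z + 100 * δ ≤ r → rightSet K δ C a w \ rightSet K δ C a z =
        rightSet K δ C' a w \ rightSet K δ C' a z := fun z w hz =>
    Set.Subset.antisymm (hR C C' h z w hz) (hR C' C (fun u hu => (h u hu).symm) z w hz)
  unfold difference
  rw [hL x hx, hL y hy, hR' x y hx, hR' y x hy]

end Height

section Regular

variable {a b b' v : V} {l Θ : ℕ} {R R' : List (Set V)}

theorem IsRegularSliceList.subset (h : IsRegularSliceList K δ ε l Θ a b R) {S : Set V}
    (hS : S ∈ R) : S ⊆ cylinder K δ ε l a b \ {a, b} := by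
  obtain ⟨x, hx, rfl⟩ := (h.mem_iff S).1 hS
  exact fun y hy => hy.1

theorem IsRegularSliceList.nonempty (h : IsRegularSliceList K δ ε l Θ a b R) {S : Set V}
    (hS : S ∈ R) : S.Nonempty := by
  obtain ⟨x, hx, rfl⟩ := (h.mem_iff S).1 hS
  exact ⟨x, hx, by rw [difference_eq_height_sub h.finite]; omega⟩

theorem IsRegularSliceList.eq_class (h : IsRegularSliceList K δ ε l Θ a b R) {S : Set V}
    (hS : S ∈ R) {x : V} (hx : x ∈ S) : S = {y | y ∈ cylinder K δ ε l a b \ {a, b} ∧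
      difference K δ (cylinder K δ ε l a b) a x y = 0} := by
  obtain ⟨x', hx', rfl⟩ := (h.mem_iff S).1 hS
  have h1 := hx.2
  ext y
  simp only [difference_eq_height_sub h.finite, Set.mem_ofPred_eq] at h1 ⊢
  refine and_congr_right fun _ => ?_
  omega

theorem IsRegularSliceList.exists_mem (h : IsRegularSliceList K δ ε l Θ a b R) {x : V}
    (hx : x ∈ cylinder K δ ε l a b \ {a, b}) : ∃ S ∈ R, x ∈ S :=
  ⟨_, (h.mem_iff _).2 ⟨x, hx, rfl⟩, hx, by rw [difference_eq_height_sub h.finite]; omega⟩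

theorem IsRegularSliceList.pairwise_disjoint (h : IsRegularSliceList K δ ε l Θ a b R) :
    R.Pairwise Disjoint := by
  refine h.sorted.imp fun {S S'} hlt => Set.disjoint_left.2 fun x hx hx' => ?_
  have := hlt x hx x hx'
  rw [difference_eq_height_sub h.finite] at this
  omega

/-- The regular slices are the level sets of the height. -/
theorem exists_regularSliceList (hfin : (cylinder K δ ε l a b).Finite)
    (hno : ∀ v, ¬ IsParabolicSlice K Θ (cylinder K δ ε l a b) v) :
    ∃ R, IsRegularSliceList K δ ε l Θ a b R := by
  classical
  set C := cylinder K δ ε l a b with hC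
  have hfin' : (C \ {a, b}).Finite := hfin.sdiff
  set H : Finset ℤ := hfin'.toFinset.image (height K δ C a) with hH
  have hmem : ∀ t, t ∈ H ↔ ∃ x ∈ C \ {a, b}, height K δ C a x = t := by
    intro t
    simp only [hH, Finset.mem_image, Set.Finite.mem_toFinset]
  refine ⟨(H.sort (· ≤ ·)).map fun t => {y | y ∈ C \ {a, b} ∧ height K δ C a y = t}, hfin, hno,
    fun S => ?_, ?_⟩
  · simp only [List.mem_map, Finset.mem_sort, hmem, IsRegularSlice, ← hC]
    constructor
    · rintro ⟨t, ⟨x, hx, rfl⟩, rfl⟩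
      refine ⟨x, hx, ?_⟩
      ext y
      simp only [Set.mem_ofPred_eq, difference_eq_height_sub hfin]
      refine and_congr_right fun _ => ?_
      omega
    · rintro ⟨x, hx, rfl⟩
      refine ⟨_, ⟨x, hx, rfl⟩, ?_⟩
      ext y
      simp only [Set.mem_ofPred_eq, difference_eq_height_sub hfin]
      refine and_congr_right fun _ => ?_
      omega
  · rw [List.pairwise_map]
    refine (Finset.sortedLT_sort H).pairwise.imp fun {s t} hst x hx y hy => ?_
    rw [difference_eq_height_sub hfin, hx.2, hy.2]
    omega

/-- The left set seen from one end of a cylinder is the right set seen from the other. -/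
theorem leftSet_eq_rightSet (S : IsSetup K δ ε) (hl : mu δ ε ≤ l) {x : V}
    (hx : x ∈ cylinder K δ ε l a b) :
    leftSet K δ (cylinder K δ ε l a b) a x = rightSet K δ (cylinder K δ ε l a b) b x := by
  have hc := S.conn
  obtain ⟨g, h0, hm, hg⟩ := exists_geoFun hc a b
  obtain ⟨i, hi, hdi⟩ := cylinder_close S hl hx hg h0 hm
  have a1 := hg.dist_zero hi
  have b1 := hg.dist_last hi
  rw [h0] at a1
  rw [hm] at b1
  have key : ∀ v ∈ cylinder K δ ε l a b, 100 * δ < K.dist x v →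
      (K.dist a v < K.dist a x ↔ K.dist b x < K.dist b v) := by
    intro v hv hd
    obtain ⟨j, hj, hdj⟩ := cylinder_close S hl hv hg h0 hm
    have a2 := hg.dist_zero hj
    have b2 := hg.dist_last hj
    rw [h0] at a2
    rw [hm] at b2
    have hij : K.dist (g i) (g j) ≤ max (j - i) (i - j) := by
      rcases le_total i j with h | h
      · rw [hg i j h hj]; omega
      · rw [K.dist_comm, hg j i h hi]; omega
    have t1 := hc.dist_triangle (u := x) (v := g i) (w := v)
    have t2 := hc.dist_triangle (u := g i) (v := g j) (w := v)
    have c1 := K.dist_comm (u := g j) (v := v)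
    have c2 := K.dist_comm (u := g i) (v := x)
    have s1 := hc.dist_triangle (u := a) (v := x) (w := g i)
    have s2 := hc.dist_triangle (u := a) (v := g i) (w := x)
    have s3 := hc.dist_triangle (u := a) (v := v) (w := g j)
    have s4 := hc.dist_triangle (u := a) (v := g j) (w := v)
    have s5 := hc.dist_triangle (u := b) (v := x) (w := g i)
    have s6 := hc.dist_triangle (u := b) (v := g i) (w := x)
    have s7 := hc.dist_triangle (u := b) (v := v) (w := g j)
    have s8 := hc.dist_triangle (u := b) (v := g j) (w := v)
    have c3 := K.dist_comm (u := g i) (v := b)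
    have c4 := K.dist_comm (u := g j) (v := b)
    have := S.two_le
    constructor <;> intro h <;> omega
  ext v
  constructor
  · rintro ⟨h1, h2, h3⟩
    exact ⟨h1, (key v h1 h3).1 h2, h3⟩
  · rintro ⟨h1, h2, h3⟩
    exact ⟨h1, (key v h1 h3).2 h2, h3⟩

theorem difference_symm (S : IsSetup K δ ε) (hl : mu δ ε ≤ l)
    (hfin : (cylinder K δ ε l a b).Finite) {x y : V}
    (hx : x ∈ cylinder K δ ε l a b) (hy : y ∈ cylinder K δ ε l a b) :
    difference K δ (cylinder K δ ε l b a) b x y =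
      difference K δ (cylinder K δ ε l a b) a y x := by
  have hxy : ∀ z, z ∈ cylinder K δ ε l a b → height K δ (cylinder K δ ε l a b) b z =
      - height K δ (cylinder K δ ε l a b) a z := by
    intro z hz
    have h1 := leftSet_eq_rightSet S hl hz
    have hz' := hz
    rw [cylinder_symm S.conn] at hz'
    have h2 := leftSet_eq_rightSet S hl hz'
    rw [cylinder_symm S.conn l b a] at h2
    unfold height
    rw [h1, h2]
    omega
  rw [cylinder_symm S.conn l b a, difference_eq_height_sub hfin, difference_eq_height_sub hfin,
    hxy x hx, hxy y hy]
  omega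

/-- The height changes sign when the ends of a cylinder are exchanged. -/
theorem IsRegularSliceList.reverse (S : IsSetup K δ ε) (hl : mu δ ε ≤ l)
    (h : IsRegularSliceList K δ ε l Θ a b R) : IsRegularSliceList K δ ε l Θ b a R.reverse := by
  have e := cylinder_symm (ε := ε) (δ := δ) S.conn l b a
  refine ⟨by rw [e]; exact h.finite, by rw [e]; exact h.no_parabolic, fun T => ?_, ?_⟩
  · rw [List.mem_reverse, h.mem_iff]
    have key : ∀ x ∈ cylinder K δ ε l a b \ {a, b},
        {y | y ∈ cylinder K δ ε l a b \ {a, b} ∧ difference K δ (cylinder K δ ε l a b) a x y = 0} =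
        {y | y ∈ cylinder K δ ε l b a \ {b, a} ∧
          difference K δ (cylinder K δ ε l b a) b x y = 0} := by
      intro x hx
      ext y
      simp only [Set.mem_ofPred_eq]
      rw [Set.pair_comm b a]
      have : y ∈ cylinder K δ ε l b a \ {a, b} ↔ y ∈ cylinder K δ ε l a b \ {a, b} := by rw [e]
      rw [this]
      refine and_congr_right fun hy => ?_
      rw [difference_symm S hl h.finite hx.1 hy.1, difference_eq_height_sub h.finite,
        difference_eq_height_sub h.finite]
      omega
    constructor
    · rintro ⟨x, hx, rfl⟩
      exact ⟨x, by rw [e, Set.pair_comm]; exact hx, key x hx⟩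
    · rintro ⟨x, hx, rfl⟩
      rw [e, Set.pair_comm] at hx
      exact ⟨x, hx, (key x hx).symm⟩
  · rw [List.pairwise_reverse]
    refine h.sorted.imp_of_mem fun {T T'} hT hT' hlt x hx y hy => ?_
    rw [difference_symm S hl h.finite (h.subset hT' hx).1 (h.subset hT hy).1]
    exact hlt y hy x hx

/-- The longest common prefix of two lists among those all of whose elements satisfy `p`. -/
theorem exists_maximal_common_prefix {α : Type*} (p : α → Prop) : ∀ L L' : List α,
    ∃ P Q Q' : List α, L = P ++ Q ∧ L' = P ++ Q' ∧ (∀ x ∈ P, p x) ∧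
      ∀ x t t', Q = x :: t → Q' = x :: t' → ¬ p x := by
  intro L
  induction L with
  | nil => exact fun L' => ⟨[], [], L', rfl, rfl, by simp, by simp⟩
  | cons x L ih =>
    intro L'
    by_cases h : p x ∧ ∃ t, L' = x :: t
    · obtain ⟨hx, t, rfl⟩ := h
      obtain ⟨P, Q, Q', rfl, rfl, h1, h2⟩ := ih t
      refine ⟨x :: P, Q, Q', rfl, rfl, fun y hy => ?_, h2⟩
      rcases List.mem_cons.1 hy with rfl | hy
      · exact hx
      · exact h1 y hy
    · refine ⟨[], x :: L, L', rfl, rfl, by simp, ?_⟩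
      rintro y t t' h1 h2 hy
      obtain ⟨rfl, rfl⟩ := List.cons.inj h1
      exact h ⟨hy, t', h2⟩

/-- Cylinders which agree near their common origin have the same regular slices there. -/
theorem IsRegularSliceList.exists_common_prefix (hc : K.Connected)
    (h : IsRegularSliceList K δ ε l Θ a b R) (h' : IsRegularSliceList K δ ε l Θ a b' R') {r : ℕ}
    (hag : ∀ u, K.dist a u ≤ r → (u ∈ cylinder K δ ε l a b ↔ u ∈ cylinder K δ ε l a b'))
    (hb : r < K.dist a b) (hb' : r < K.dist a b') :
    ∃ P Q Q' : List (Set V), R = P ++ Q ∧ R' = P ++ Q' ∧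
      (∀ S ∈ P, ∀ u ∈ S, K.dist a u ≤ r) ∧
      (∀ S ∈ Q, ∀ u ∈ S, r < K.dist a u + 300 * δ) ∧
      (∀ S ∈ Q', ∀ u ∈ S, r < K.dist a u + 300 * δ) := by
  have hlocal : ∀ {b b' : V} {R R' : List (Set V)}, IsRegularSliceList K δ ε l Θ a b R →
      IsRegularSliceList K δ ε l Θ a b' R' →
      (∀ u, K.dist a u ≤ r → (u ∈ cylinder K δ ε l a b ↔ u ∈ cylinder K δ ε l a b')) →
      r < K.dist a b → r < K.dist a b' → ∀ S ∈ R, ∀ s ∈ S, K.dist a s + 200 * δ ≤ r →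
      S ∈ R' ∧ ∀ u ∈ S, K.dist a u ≤ r := by
    intro b b' R R' h h' hag hb hb' S hS s hs hsr
    have hin : ∀ u, K.dist a u ≤ r →
        (u ∈ cylinder K δ ε l a b \ {a, b} ↔ u ∈ cylinder K δ ε l a b' \ {a, b'}) := by
      intro u hu
      have h1 : u ≠ b := by rintro rfl; omega
      have h2 : u ≠ b' := by rintro rfl; omega
      simp only [Set.mem_sdiff, Set.mem_insert_iff, Set.mem_singleton_iff, h1, h2, or_false,
        hag u hu]
    have e := h.eq_class hS hs
    have hsC := h.subset hS hs
    have hsC' := (hin s (by omega)).1 hsC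
    have hle : ∀ u ∈ S, K.dist a u ≤ K.dist a s + 100 * δ := by
      intro u hu
      have hu' := hu
      rw [e] at hu'
      refine dist_le_of_difference_nonpos hc h.finite hsC.1 ?_
      have := hu'.2
      rw [difference_eq_height_sub h.finite] at this ⊢
      omega
    refine ⟨(h'.mem_iff S).2 ⟨s, hsC', ?_⟩, fun u hu => by have := hle u hu; omega⟩
    ext u
    constructor
    · intro hu
      have h1 := hle u hu
      rw [e] at hu
      refine ⟨(hin u (by omega)).1 hu.1, ?_⟩
      rw [← difference_congr hc hag (by omega) (by omega)]
      exact hu.2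
    · rintro ⟨h1, h2⟩
      have h3 : K.dist a u ≤ K.dist a s + 100 * δ := by
        refine dist_le_of_difference_nonpos hc h'.finite hsC'.1 ?_
        rw [difference_eq_height_sub h'.finite] at h2 ⊢
        omega
      rw [e]
      refine ⟨(hin u (by omega)).2 h1, ?_⟩
      rw [difference_congr hc hag (by omega) (by omega)]
      exact h2
  have hag' := fun u hu => (hag u hu).symm
  obtain ⟨P, Q, Q', rfl, rfl, hP, hmax⟩ :=
    exists_maximal_common_prefix (fun S : Set V => ∀ u ∈ S, K.dist a u ≤ r) R R'
  have hfar : ∀ {b b' : V} {Q Q' : List (Set V)}, IsRegularSliceList K δ ε l Θ a b (P ++ Q) →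
      IsRegularSliceList K δ ε l Θ a b' (P ++ Q') →
      (∀ u, K.dist a u ≤ r → (u ∈ cylinder K δ ε l a b ↔ u ∈ cylinder K δ ε l a b')) →
      r < K.dist a b → r < K.dist a b' →
      (∀ x t t', Q = x :: t → Q' = x :: t' → ¬ ∀ u ∈ x, K.dist a u ≤ r) →
      ∀ S ∈ Q, ∀ u ∈ S, r < K.dist a u + 300 * δ := by
    intro b b' Q Q' h h' hag hb hb' hmax S hS q hq
    by_contra hlt
    have hag' := fun u hu => (hag u hu).symm
    -- The slice `S` and the first slices of both remainders are near the origin, hence are slices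
    -- of both cylinders.
    have hhead : ∀ {b : V} {Q : List (Set V)}, IsRegularSliceList K δ ε l Θ a b (P ++ Q) →
        S ∈ Q → ∃ S₀ t, Q = S₀ :: t ∧ ∃ s ∈ S₀, K.dist a s + 200 * δ ≤ r := by
      intro b Q h hS
      cases Q with
      | nil => simp at hS
      | cons S₀ t =>
        refine ⟨S₀, t, rfl, ?_⟩
        rcases List.mem_cons.1 hS with rfl | hSt
        · exact ⟨q, hq, by omega⟩
        · obtain ⟨s, hs⟩ := h.nonempty (S := S₀) (by simp)
          have h1 := (List.pairwise_cons.1 (List.pairwise_append.1 h.sorted).2.1).1 S hSt s hs q hq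
          have h2 := dist_le_of_difference_nonpos hc h.finite
            (h.subset (List.mem_append_right _ hS) hq).1 h1.le
          exact ⟨s, hs, by omega⟩
    have hnotP : ∀ {b : V} {Q : List (Set V)}, IsRegularSliceList K δ ε l Θ a b (P ++ Q) →
        ∀ T ∈ Q, T ∉ P := by
      intro b Q h T hT hTP
      have h1 := (List.pairwise_append.1 h.pairwise_disjoint).2.2 T hTP T hT
      obtain ⟨t, ht⟩ := h.nonempty (List.mem_append_right _ hT)
      exact Set.disjoint_left.1 h1 ht ht
    obtain ⟨S₀, t, rfl, s, hs, hsr⟩ := hhead h hS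
    have hS' : S ∈ Q' := (List.mem_append.1 (hlocal h h' hag hb hb' S (List.mem_append_right _ hS)
      q hq (by omega)).1).resolve_left (hnotP h S hS)
    obtain ⟨S₀', t', rfl, s', hs', hsr'⟩ := hhead h' hS'
    have h1 := hlocal h h' hag hb hb' S₀ (by simp) s hs hsr
    have h2 := hlocal h' h hag' hb' hb S₀' (by simp) s' hs' hsr'
    by_cases heq : S₀ = S₀'
    · subst heq
      exact hmax _ _ _ rfl rfl h1.2
    · have m1 : S₀' ∈ t := by
        rcases List.mem_cons.1 ((List.mem_append.1 h2.1).resolve_left (hnotP h' S₀' (by simp)))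
          with e | e
        · exact absurd e.symm heq
        · exact e
      have m2 : S₀ ∈ t' := by
        rcases List.mem_cons.1 ((List.mem_append.1 h1.1).resolve_left (hnotP h S₀ (by simp)))
          with e | e
        · exact absurd e heq
        · exact e
      have n1 := (List.pairwise_cons.1 (List.pairwise_append.1 h.sorted).2.1).1 _ m1 s hs s' hs'
      have n2 := (List.pairwise_cons.1 (List.pairwise_append.1 h'.sorted).2.1).1 _ m2 s' hs' s hs
      rw [difference_congr hc hag (by omega) (by omega), difference_eq_height_sub h'.finite] at n1
      rw [difference_eq_height_sub h'.finite] at n2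
      omega
  exact ⟨P, Q, Q', rfl, rfl, hP, hfar h h' hag hb hb' hmax,
    hfar h' h hag' hb' hb fun x t t' e e' => hmax x t' t e' e⟩

end Regular

/-! ### Slice decompositions -/

section Decomposition

variable {a b b' v : V} {l Θ P : ℕ} {L L' L₁ L₂ : List (Set V)}

theorem IsSliceSequence.append : ∀ {a : V} {vs : List V} {L : List (Set V)},
    IsSliceSequence K δ ε l Θ v a vs L → ∀ {ws : List V} {L' : List (Set V)},
    IsSliceSequence K δ ε l Θ b v ws L' → IsSliceSequence K δ ε l Θ b a (vs ++ v :: ws) (L ++ L')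
  | _, [], _, ⟨R, hR, e⟩, _, L', h' => ⟨R, L', hR, h', by rw [e]; simp⟩
  | _, _ :: _, _, ⟨R, L₁, hR, h₁, e⟩, _, L', h' =>
    ⟨R, L₁ ++ L', hR, h₁.append h', by rw [e]; simp⟩

theorem IsSliceSequence.reverse (S : IsSetup K δ ε) (hl : mu δ ε ≤ l) :
    ∀ {a : V} {vs : List V} {L : List (Set V)}, IsSliceSequence K δ ε l Θ b a vs L →
      ∃ L', ({a} :: L).reverse = {b} :: L' ∧ IsSliceSequence K δ ε l Θ a b vs.reverse L'
  | a, [], L, ⟨R, hR, e⟩ =>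
    ⟨R.reverse ++ [{a}], by rw [e]; simp, R.reverse, hR.reverse S hl, rfl⟩
  | a, v :: vs, L, ⟨R, L₁, hR, h₁, e⟩ => by
    obtain ⟨L₂, e₂, h₂⟩ := h₁.reverse S hl
    have h₃ : IsSliceSequence K δ ε l Θ a v [] (R.reverse ++ [{a}]) :=
      ⟨R.reverse, hR.reverse S hl, rfl⟩
    refine ⟨L₂ ++ (R.reverse ++ [{a}]), ?_, by simpa using h₂.append h₃⟩
    have : ({a} :: L).reverse = ({v} :: L₁).reverse ++ (R.reverse ++ [{a}]) := by
      rw [e]; simp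
    rw [this, e₂]
    rfl

theorem IsGeodesic.reverse {g : K.Walk a b} (hg : IsGeodesic K g) : IsGeodesic K g.reverse := by
  unfold IsGeodesic at *
  rw [SimpleGraph.Walk.length_reverse, hg, K.dist_comm]

theorem IsSliceDecomposition.reverse (S : IsSetup K δ ε) (hl : mu δ ε ≤ l)
    (h : IsSliceDecomposition K δ ε l Θ a b L) :
    IsSliceDecomposition K δ ε l Θ b a L.reverse where
  sequence hne := by
    obtain ⟨vs, L', h1, h2, h3, rfl⟩ := h.sequence hne.symm
    obtain ⟨L'', e, h4⟩ := h3.reverse S hl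
    refine ⟨vs.reverse, L'', fun v => ?_, fun g hg => ?_, h4, e⟩
    · rw [List.mem_reverse, h1, cylinder_symm S.conn]
    · have := (h2 g.reverse hg.reverse).reverse
      rwa [SimpleGraph.Walk.support_reverse, List.reverse_reverse] at this
  degenerate e := by rw [h.degenerate e.symm, e]; rfl
  disjoint := by
    rw [List.pairwise_reverse]
    exact h.disjoint.imp fun h => h.symm
  cover := by
    rw [cylinder_symm S.conn, ← h.cover]
    simp

theorem isSliceDecomposition_self (H : IsHypGraph K δ) (a : V) :
    IsSliceDecomposition K δ ε l Θ a a [{a}] where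
  sequence h := absurd rfl h
  degenerate _ := rfl
  disjoint := List.pairwise_singleton _ _
  cover := by rw [cylinder_self H]; simp

theorem IsSliceDecomposition.eq_cons (h : IsSliceDecomposition K δ ε l Θ a b L) :
    ∃ L', L = {a} :: L' := by
  by_cases hab : a = b
  · exact ⟨[], h.degenerate hab⟩
  · obtain ⟨vs, L', -, -, -, e⟩ := h.sequence hab
    exact ⟨L', e⟩

theorem IsSliceDecomposition.eq_concat (S : IsSetup K δ ε) (hl : mu δ ε ≤ l)
    (h : IsSliceDecomposition K δ ε l Θ a b L) : ∃ L', L = L' ++ [{b}] := by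
  obtain ⟨L', e⟩ := (h.reverse S hl).eq_cons
  exact ⟨L'.reverse, by rw [← List.reverse_reverse L, e]; simp⟩

theorem IsSliceDecomposition.subset (h : IsSliceDecomposition K δ ε l Θ a b L) {T : Set V}
    (hT : T ∈ L) : T ⊆ cylinder K δ ε l a b := by
  rw [← h.cover]
  exact Set.subset_biUnion_of_mem (u := fun S => S) hT

theorem IsSliceSequence.nonempty : ∀ {a : V} {vs : List V} {L : List (Set V)},
    IsSliceSequence K δ ε l Θ b a vs L → ∀ T ∈ L, T.Nonempty
  | _, [], _, ⟨R, hR, e⟩, T, hT => by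
    rw [e] at hT
    rcases List.mem_append.1 hT with h | h
    · exact hR.nonempty h
    · rw [List.mem_singleton.1 h]; exact Set.singleton_nonempty _
  | _, _ :: _, _, ⟨R, L₁, hR, h₁, e⟩, T, hT => by
    rw [e] at hT
    rcases List.mem_append.1 hT with h | h
    · exact hR.nonempty h
    · rcases List.mem_cons.1 h with rfl | h
      · exact Set.singleton_nonempty _
      · exact h₁.nonempty T h

theorem IsSliceDecomposition.nonempty (h : IsSliceDecomposition K δ ε l Θ a b L) {T : Set V}
    (hT : T ∈ L) : T.Nonempty := by
  by_cases hab : a = b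
  · rw [h.degenerate hab] at hT
    rw [List.mem_singleton.1 hT]; exact Set.singleton_nonempty _
  · obtain ⟨vs, L', -, -, h3, rfl⟩ := h.sequence hab
    rcases List.mem_cons.1 hT with rfl | hT
    · exact Set.singleton_nonempty _
    · exact h3.nonempty T hT

/-- The decompositions of the two parts of a cylinder cut at a parabolic slice form a
decomposition of the cylinder. -/
theorem IsSliceDecomposition.append (S : IsSetup K δ ε) (hΘ : 7 * baseAngle δ < Θ)
    (h₁ : IsSliceDecomposition K δ ε l Θ a v L₁)
    (h₂ : IsSliceDecomposition K δ ε l Θ v b ({v} :: L₂))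
    (hv : IsParabolicSlice K Θ (cylinder K δ ε l a b) v) :
    IsSliceDecomposition K δ ε l Θ a b (L₁ ++ L₂) := by
  have H := S.toIsHypGraph
  have hc := S.conn
  have hA := hundred_mul_le_baseAngle S.two_le
  have hW := hv.wide S (B := 5 * baseAngle δ) (by omega)
  have hb : K.dist a v + K.dist v b = K.dist a b := hW.btw H (by omega)
  have hva := hW.1
  have hvb := hW.2.1
  have hcyl := hW.cylinder_eq (ε := ε) (l := l) S le_rfl
  have hab : a ≠ b := by
    rintro rfl
    rw [SimpleGraph.dist_self] at hb
    exact hva (eq_of_dist_eq_zero hc (by omega))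
  obtain ⟨vs₁, L₁', m₁, s₁, q₁, rfl⟩ := h₁.sequence hva.symm
  obtain ⟨vs₂, L₂', m₂, s₂, q₂, e₂⟩ := h₂.sequence hvb
  obtain ⟨-, rfl⟩ := List.cons.inj e₂
  have hne₁ : v ∉ vs₁ := fun h => (((m₁ v).1 h).ne S (by omega)).2 rfl
  have hne₂ : v ∉ vs₂ := fun h => (((m₂ v).1 h).ne S (by omega)).1 rfl
  refine ⟨fun _ => ⟨vs₁ ++ v :: vs₂, L₁' ++ L₂, fun u => ?_, fun g hg => ?_, q₁.append q₂, rfl⟩,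
    fun h => absurd h hab, ?_, ?_⟩
  · rw [List.mem_append, List.mem_cons, m₁, m₂, hv.split S hΘ]
  · classical
    have hgf := hg.isGeoFun hc
    have hW' : Wide K (5 * baseAngle δ) (g.getVert 0) v (g.getVert g.length) := by
      rw [g.getVert_zero, g.getVert_length]; exact hW
    obtain ⟨t, ht, hgt⟩ := hW'.exists_eq H hgf.edgePath (hgf.isQG (lam_pos H.two_le)) (by omega)
    have hmem : v ∈ g.support := by rw [← hgt]; exact g.getVert_mem_support t
    have hl := congrArg SimpleGraph.Walk.length (g.take_spec hmem)
    rw [SimpleGraph.Walk.length_append] at hl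
    have l1 := K.dist_le (g.takeUntil v hmem)
    have l2 := K.dist_le (g.dropUntil v hmem)
    unfold IsGeodesic at hg
    have g1 : IsGeodesic K (g.takeUntil v hmem) := by unfold IsGeodesic; omega
    have g2 : IsGeodesic K (g.dropUntil v hmem) := by unfold IsGeodesic; omega
    have t1 := s₁ _ g1
    have t2 := s₂ _ g2
    rw [← g.take_spec hmem, SimpleGraph.Walk.support_append_eq_support_dropLast_append]
    refine List.Sublist.append ?_ ?_
    · have e := List.dropLast_append_getLast (SimpleGraph.Walk.support_ne_nil (g.takeUntil v hmem))
      rw [SimpleGraph.Walk.getLast_support] at e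
      rw [← e] at t1
      obtain ⟨u1, u2, rfl, v1, v2⟩ := List.sublist_append_iff.1 t1
      rcases List.sublist_singleton.1 v2 with rfl | rfl
      · simpa using v1
      · simp at hne₁
    · rw [← SimpleGraph.Walk.cons_tail_support (g.dropUntil v hmem)] at t2 ⊢
      refine List.Sublist.cons_cons v ?_
      rcases List.sublist_cons_iff.1 t2 with h | ⟨r, rfl, h⟩
      · exact h
      · simp at hne₂
  · rw [List.pairwise_append]
    have d₂ := List.pairwise_cons.1 h₂.disjoint
    refine ⟨h₁.disjoint, d₂.2, fun T hT T' hT' => Set.disjoint_left.2 fun u hu hu' => ?_⟩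
    have hbt : K.dist u v + K.dist v u = K.dist u u := hW.btw_of_onQG H le_rfl
      (OnQG.of_mem_cylinder H (h₁.subset hT hu))
      (OnQG.of_mem_cylinder H (h₂.subset (List.mem_cons_of_mem _ hT') hu'))
    rw [SimpleGraph.dist_self] at hbt
    have huv : v = u := eq_of_dist_eq_zero hc (by omega)
    exact Set.disjoint_left.1 (d₂.1 T' hT') (show u ∈ ({v} : Set V) from huv.symm) hu'
  · have c₁ := h₁.cover
    have c₂ := h₂.cover
    have hv1 : v ∈ cylinder K δ ε l a v := right_mem_cylinder H a v
    rw [hcyl]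
    ext u
    rw [← c₁] at hv1
    rw [← c₁, ← c₂]
    simp only [List.mem_append, List.mem_cons, Set.mem_union, Set.mem_iUnion] at hv1 ⊢
    constructor
    · rintro ⟨T, hT | hT, hu⟩
      · exact Or.inl ⟨T, hT, hu⟩
      · exact Or.inr ⟨T, Or.inr hT, hu⟩
    · rintro (⟨T, hT, hu⟩ | ⟨T, rfl | hT, hu⟩)
      · exact ⟨T, Or.inl hT, hu⟩
      · obtain ⟨T', hT', hv'⟩ := hv1
        exact ⟨T', Or.inl hT', by rwa [show u = v from hu]⟩
      · exact ⟨T, Or.inr hT, hu⟩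

/-- By induction on the distance of the ends, cutting the cylinder at a parabolic slice. -/
theorem exists_isSliceDecomposition (S : IsSetup K δ ε) (hP : ConeBound K ε P) (hl : mu δ ε ≤ l)
    (hΘ : 7 * baseAngle δ < Θ) (a b : V) : ∃ L, IsSliceDecomposition K δ ε l Θ a b L := by
  have H := S.toIsHypGraph
  have hA := hundred_mul_le_baseAngle S.two_le
  induction hd : K.dist a b using Nat.strong_induction_on generalizing a b with
  | _ m ih =>
    subst hd
    rcases eq_or_ne a b with rfl | hab
    · exact ⟨_, isSliceDecomposition_self H a⟩
    by_cases hno : ∃ v, IsParabolicSlice K Θ (cylinder K δ ε l a b) v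
    · obtain ⟨v, hv⟩ := hno
      have hW := hv.wide S (B := 5 * baseAngle δ) (by omega)
      have hb : K.dist a v + K.dist v b = K.dist a b := hW.btw H (by omega)
      have p1 := S.conn.pos_dist_of_ne hW.1
      have p2 := S.conn.pos_dist_of_ne hW.2.1
      have c1 := K.dist_comm (u := a) (v := v)
      obtain ⟨L₁, h₁⟩ := ih _ (by omega) a v rfl
      obtain ⟨L₂, h₂⟩ := ih _ (by omega) v b rfl
      obtain ⟨L₂', rfl⟩ := h₂.eq_cons
      exact ⟨_, h₁.append S hΘ h₂ hv⟩
    · push Not at hno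
      have hfin := finite_cylinder S hP hl a b
      obtain ⟨R, hR⟩ := exists_regularSliceList hfin hno
      refine ⟨{a} :: (R ++ [{b}]), fun _ => ⟨[], _, fun v => ?_, fun g _ => List.nil_sublist _,
        ⟨R, hR, rfl⟩, rfl⟩, fun h => absurd h hab, ?_, ?_⟩
      · simp [hno v]
      · rw [List.pairwise_cons, List.pairwise_append]
        refine ⟨fun T hT => Set.disjoint_singleton_left.2 fun haT => ?_, hR.pairwise_disjoint,
          List.pairwise_singleton _ _, fun T hT T' hT' => ?_⟩
        · rcases List.mem_append.1 hT with hT | hT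
          · exact (hR.subset hT haT).2 (by simp)
          · rw [List.mem_singleton.1 hT] at haT
            exact hab haT
        · rw [List.mem_singleton.1 hT']
          exact Set.disjoint_singleton_right.2 fun hbT => (hR.subset hT hbT).2 (by simp)
      · ext u
        simp only [List.mem_append, List.mem_cons, Set.mem_iUnion]
        constructor
        · rintro ⟨T, rfl | hT | rfl | hT, hu⟩
          · rw [show u = a from hu]; exact left_mem_cylinder H a b
          · exact (hR.subset hT hu).1
          · rw [show u = b from hu]; exact right_mem_cylinder H a b
          · simp at hT
        · intro hu
          by_cases h1 : u = a
          · exact ⟨{a}, Or.inl rfl, h1⟩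
          by_cases h2 : u = b
          · exact ⟨{b}, Or.inr (Or.inr (Or.inl rfl)), h2⟩
          obtain ⟨T, hT, huT⟩ := hR.exists_mem (x := u) ⟨hu, by simp [h1, h2]⟩
          exact ⟨T, Or.inr (Or.inl hT), huT⟩

/-- The beginning of a slice decomposition, up to the first parabolic slice. -/
theorem IsSliceDecomposition.exists_first (S : IsSetup K δ ε) (hΘ : 7 * baseAngle δ < Θ)
    (h : IsSliceDecomposition K δ ε l Θ a b L) (hab : a ≠ b) :
    ∃ (R T : List (Set V)) (v : V), L = {a} :: (R ++ T) ∧ IsRegularSliceList K δ ε l Θ a v R ∧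
      (v = b ∨ IsParabolicSlice K Θ (cylinder K δ ε l a b) v) ∧
      cylinder K δ ε l a b = cylinder K δ ε l a v ∪ cylinder K δ ε l v b ∧
      (∀ u ∈ cylinder K δ ε l v b, K.dist a u = K.dist a v + K.dist v u) ∧
      ∀ W ∈ T, W ⊆ cylinder K δ ε l v b := by
  have H := S.toIsHypGraph
  obtain ⟨vs, L', h1, h2, h3, rfl⟩ := h.sequence hab
  rcases vs with _ | ⟨v, vs⟩
  · obtain ⟨R, hR, rfl⟩ := h3
    refine ⟨R, _, b, rfl, hR, Or.inl rfl, ?_, fun u hu => ?_, fun W hW => ?_⟩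
    · rw [cylinder_self H, Set.union_eq_self_of_subset_right]
      exact Set.singleton_subset_iff.2 (right_mem_cylinder H a b)
    · rw [cylinder_self H] at hu
      rw [show u = b from hu, SimpleGraph.dist_self, add_zero]
    · rw [List.mem_singleton.1 hW, cylinder_self H]
  · obtain ⟨R, L₁, hR, h4, rfl⟩ := h3
    have hv := (h1 v).1 (by simp)
    have hW := hv.wide S (B := 5 * baseAngle δ) (by omega)
    have hcyl := hW.cylinder_eq (ε := ε) (l := l) S le_rfl
    refine ⟨R, _, v, rfl, hR, Or.inr hv, hcyl, fun u hu => ?_, fun W hT u hu => ?_⟩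
    · exact (show K.dist a v + K.dist v u = K.dist a u from hW.btw_of_onQG H le_rfl
        (OnQG.of_mem_cylinder H (left_mem_cylinder (ε := ε) (l := l) H a v))
        (OnQG.of_mem_cylinder H hu)).symm
    · have huC := h.subset (T := W) (by simp [List.mem_cons.1 hT]) hu
      rw [hcyl] at huC
      rcases huC with hu1 | hu1
      · have hd := h.disjoint
        rw [List.pairwise_cons, List.pairwise_append] at hd
        have hua : u ≠ a := fun e => Set.disjoint_left.1 (hd.1 W (List.mem_append_right _ hT))
          (show u ∈ ({a} : Set V) from e) hu
        by_cases huv : u = v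
        · rw [huv]; exact left_mem_cylinder H v b
        · obtain ⟨T', hT', hu'⟩ := hR.exists_mem (x := u) ⟨hu1, by simp [hua, huv]⟩
          exact absurd hu (Set.disjoint_left.1 (hd.2.2.2 T' hT' W hT) hu')
      · exact hu1

/-- Two cylinders which agree near their common origin, and have no common parabolic slice, have
the same slices there. -/
theorem IsSliceDecomposition.exists_common_prefix (S : IsSetup K δ ε)
    (hΘ : 7 * baseAngle δ < Θ) (h : IsSliceDecomposition K δ ε l Θ a b L)
    (h' : IsSliceDecomposition K δ ε l Θ a b' L') {r : ℕ}
    (hag : ∀ u, K.dist a u ≤ r + 1 → (u ∈ cylinder K δ ε l a b ↔ u ∈ cylinder K δ ε l a b'))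
    (hb : r < K.dist a b) (hb' : r < K.dist a b')
    (hno : ∀ v, IsParabolicSlice K Θ (cylinder K δ ε l a b) v →
      ¬ IsParabolicSlice K Θ (cylinder K δ ε l a b') v) :
    ∃ P Q Q' : List (Set V), L = P ++ Q ∧ L' = P ++ Q' ∧
      (∀ S ∈ P, ∀ u ∈ S, K.dist a u ≤ r) ∧
      (∀ S ∈ Q, ∀ u ∈ S, r < K.dist a u + 300 * δ) ∧
      (∀ S ∈ Q', ∀ u ∈ S, r < K.dist a u + 300 * δ) := by
  have hc := S.conn
  have hne : ∀ {c : V}, r < K.dist a c → a ≠ c := by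
    rintro c hlt rfl
    simp at hlt
  have hfar : ∀ {b b' v : V},
      (∀ u, K.dist a u ≤ r + 1 → (u ∈ cylinder K δ ε l a b ↔ u ∈ cylinder K δ ε l a b')) →
      r < K.dist a b → (∀ v, IsParabolicSlice K Θ (cylinder K δ ε l a b) v →
        ¬ IsParabolicSlice K Θ (cylinder K δ ε l a b') v) →
      (v = b ∨ IsParabolicSlice K Θ (cylinder K δ ε l a b) v) → r < K.dist a v := by
    rintro b b' v hag hb hno (rfl | hv)
    · exact hb
    · by_contra hlt
      refine hno v hv ?_
      obtain ⟨hvC, w, hw, w', hw', hvw, hvw', hang⟩ := hv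
      have d1 := SimpleGraph.dist_eq_one_iff_adj.2 hvw
      have d2 := SimpleGraph.dist_eq_one_iff_adj.2 hvw'
      have t1 := hc.dist_triangle (u := a) (v := v) (w := w)
      have t2 := hc.dist_triangle (u := a) (v := v) (w := w')
      exact ⟨(hag v (by omega)).1 hvC, w, (hag w (by omega)).1 hw, w', (hag w' (by omega)).1 hw',
        hvw, hvw', hang⟩
  obtain ⟨R, T, v, rfl, hR, hv, hC, hadd, hT⟩ := h.exists_first S hΘ (hne hb)
  obtain ⟨R', T', v', rfl, hR', hv', hC', hadd', hT'⟩ := h'.exists_first S hΘ (hne hb')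
  have hvr := hfar hag hb hno hv
  have hvr' := hfar (fun u hu => (hag u hu).symm) hb' (fun v h1 h2 => hno v h2 h1) hv'
  have hin : ∀ {b v : V}, cylinder K δ ε l a b = cylinder K δ ε l a v ∪ cylinder K δ ε l v b →
      (∀ u ∈ cylinder K δ ε l v b, K.dist a u = K.dist a v + K.dist v u) → r < K.dist a v →
      ∀ u, K.dist a u ≤ r → (u ∈ cylinder K δ ε l a v ↔ u ∈ cylinder K δ ε l a b) := by
    intro b v hC hadd hvr u hu
    rw [hC]
    refine ⟨Or.inl, fun h => h.resolve_right fun h => ?_⟩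
    have := hadd u h
    omega
  obtain ⟨P, Q, Q', rfl, rfl, hP, hQ, hQ'⟩ := hR.exists_common_prefix hc hR' (r := r)
    (fun u hu => by rw [hin hC hadd hvr u hu, hag u (by omega), hin hC' hadd' hvr' u hu]) hvr hvr'
  refine ⟨{a} :: P, Q ++ T, Q' ++ T', by simp, by simp, ?_, ?_, ?_⟩
  · intro W hW u hu
    rcases List.mem_cons.1 hW with rfl | hW
    · rw [show u = a from hu]; simp
    · exact hP W hW u hu
  · intro W hW u hu
    rcases List.mem_append.1 hW with hW | hW
    · exact hQ W hW u hu
    · have := hadd u (hT W hW hu); omega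
  · intro W hW u hu
    rcases List.mem_append.1 hW with hW | hW
    · exact hQ' W hW u hu
    · have := hadd' u (hT' W hW hu); omega

end Decomposition

/-! ### Switching to another side of a triangle -/

section Switch

variable {x y z : V} {f : ℕ → V} {n N l : ℕ} {c d : ℕ → ℕ}

/-- Along a quasi-geodesic, the distance to the origin is nearly monotone. -/
theorem IsSetup.dist_le_of_le (S : IsSetup K δ ε) (hf : IsEdgePath K f n)
    (hQ : IsQG K (lam δ) f n) {s t : ℕ} (hst : s ≤ t) (ht : t ≤ n) :
    K.dist (f 0) (f s) ≤ K.dist (f 0) (f t) + morseConst δ := by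
  obtain ⟨g, g0, gm, hg⟩ := exists_geoFun S.conn (f 0) (f t)
  obtain ⟨i, hi, hd⟩ := S.near (hf.mono ht) (hQ.mono ht) hg g0 gm hst
  have e := hg.dist_zero hi
  rw [g0] at e
  have t1 := S.conn.dist_triangle (u := f 0) (v := g i) (w := f s)
  have c1 := K.dist_comm (u := f s) (v := g i)
  omega

/-- Along a geodesic stretch of a quasi-geodesic, the distance to the origin grows. -/
theorem IsSetup.progress (S : IsSetup K δ ε) (hf : IsEdgePath K f n)
    (hQ : IsQG K (lam δ) f n) {lo a t : ℕ} (hlo : lo + marg δ ≤ a) (hat : a ≤ t) (ht : t ≤ n)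
    (hgeo : K.dist (f lo) (f t) = t - lo) :
    K.dist (f 0) (f a) + (t - a) ≤ K.dist (f 0) (f t) + 4 * δ := by
  have hc := S.conn
  obtain ⟨g, g0, gm, hg⟩ := exists_geoFun hc (f 0) (f t)
  obtain ⟨j, hj, hd⟩ := S.close_of_stretch (hf.mono ht) (hQ.mono ht) hg g0 gm (lo := lo) (t := a)
    (hi := t) (by omega) hat le_rfl hgeo (Or.inr (by omega)) (Or.inl rfl)
  have e := hg.dist_zero hj
  have e' := hg.dist_last hj
  rw [g0] at e
  rw [gm] at e'
  have t1 := hc.dist_triangle (u := f 0) (v := g j) (w := f a)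
  have t2 := hc.dist_triangle (u := f a) (v := g j) (w := f t)
  have t3 := hc.dist_triangle (u := f lo) (v := f a) (w := f t)
  have t4 := hf.dist_le (i := lo) (j := a) (by omega) (by omega)
  have c1 := K.dist_comm (u := f a) (v := g j)
  omega

/-- A vertex well inside a piece, and before the centre of the triangle, is close to another
side of the triangle. -/
theorem IsPre.exists_close_side (S : IsSetup K δ ε) (h : IsPre K δ ε x y f n N c d) {k t₀ : ℕ}
    (hk : k ≤ N) (h1 : c k + marg δ ≤ t₀) (h2 : t₀ + marg δ ≤ d k)
    (hG : 2 * K.dist x (f t₀) + 6 * δ + K.dist y z < K.dist x y + K.dist x z)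
    {g : ℕ → V} {m : ℕ} (hg : IsGeoFun K g m) (g0 : g 0 = x) (gm : g m = z) :
    ∃ s ≤ m, K.dist (f t₀) (g s) ≤ 3 * δ := by
  have hc := S.conn
  have hdn := h.d_le hk
  have k1 := S.marg_le
  have k2 := eighty_thousand_mul_le_locScale (ε := ε) S.two_le
  have k3 := ten_mul_locScale_le_mu (δ := δ) (ε := ε)
  obtain ⟨g', g0', gm', hg'⟩ := exists_geoFun hc x y
  obtain ⟨j, hj, hd⟩ := S.close_of_stretch h.edge (h.isQG S.toIsHypGraph) hg'
    (g0'.trans h.first.symm) (gm'.trans h.last.symm) (lo := t₀ - marg δ) (t := t₀)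
    (hi := t₀ + marg δ) (by omega) (by omega) (by omega)
    (h.geo k hk _ _ (by omega) (by omega) (by omega) (by omega)) (Or.inr (by omega))
    (Or.inr (by omega))
  have hb := hg'.btw hj
  rw [g0', gm'] at hb
  have t1 := hc.dist_triangle (u := x) (v := f t₀) (w := g' j)
  obtain ⟨s, hs, hds⟩ := close_of_lt_gromov hc S.hyp hb hg g0 gm (by omega)
  have t2 := hc.dist_triangle (u := f t₀) (v := g' j) (w := g s)
  exact ⟨s, hs, by omega⟩

/-- The shortest connection, in a suitable sense, between a piece and another side: the quantity
minimized is twice the length of the connection minus the position of its end. This choice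
prevents the two paths from meeting each other or the connection elsewhere. -/
theorem IsPre.exists_connection (S : IsSetup K δ ε) (h : IsPre K δ ε x y f n N c d) {k t₀ : ℕ}
    (hk : k ≤ N) (h1 : c k + 2 * locScale δ ε ≤ t₀) (h2 : t₀ + marg δ ≤ d k)
    (hG : 2 * K.dist x (f t₀) + 6 * δ + K.dist y z < K.dist x y + K.dist x z)
    {g : ℕ → V} {m : ℕ} (hg : IsGeoFun K g m) (g0 : g 0 = x) (gm : g m = z) :
    ∃ t s, t ≤ t₀ ∧ t₀ ≤ t + 13 * δ ∧ s ≤ m ∧ K.dist (f t) (g s) ≤ 13 * δ ∧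
      ∀ t' s', t' ≤ t₀ → t₀ ≤ t' + 100 * δ → s' ≤ m →
        2 * K.dist (f t) (g s) + s' ≤ 2 * K.dist (f t') (g s') + s := by
  have hc := S.conn
  have hdn := h.d_le hk
  have k1 := S.marg_le
  have k2 := eighty_thousand_mul_le_locScale (ε := ε) S.two_le
  have k3 := ten_mul_locScale_le_mu (δ := δ) (ε := ε)
  have k4 := S.morse_le
  obtain ⟨s₁, hs₁, hd₁⟩ := h.exists_close_side S hk (by omega) h2 hG hg g0 gm
  have hex : ((Finset.Icc (t₀ - 100 * δ) t₀) ×ˢ Finset.range (m + 1)).Nonempty :=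
    ⟨(t₀, s₁), by simp; omega⟩
  obtain ⟨⟨t, s⟩, hmem, hmin⟩ := Finset.exists_min_image _
    (fun p : ℕ × ℕ => 2 * (K.dist (f p.1) (g p.2) : ℤ) - p.2) hex
  have hmem' : (t₀ - 100 * δ ≤ t ∧ t ≤ t₀) ∧ s < m + 1 := by simpa using hmem
  have hmin' : ∀ t' s', t' ≤ t₀ → t₀ ≤ t' + 100 * δ → s' ≤ m →
        2 * K.dist (f t) (g s) + s' ≤ 2 * K.dist (f t') (g s') + s := by
    intro t' s' a1 a2 a3
    have := hmin (t', s') (by simp; omega)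
    simp only at this
    omega
  have hpr := S.progress h.edge (h.isQG S.toIsHypGraph) (lo := t - marg δ) (a := t) (t := t₀)
    (by omega) hmem'.1.2 (by omega)
    (h.geo k hk _ _ (by omega) (by omega) (by omega) (by omega))
  rw [h.first] at hpr
  have m1 := hmin' t₀ s₁ le_rfl (by omega) hs₁
  have e1 := hg.dist_zero hs₁
  have e2 := hg.dist_zero (k := s) (by omega)
  rw [g0] at e1 e2
  have t1 := hc.dist_triangle (u := x) (v := f t) (w := g s)
  have t2 := hc.dist_triangle (u := x) (v := g s₁) (w := f t₀)
  have c1 := K.dist_comm (u := f t₀) (v := g s₁)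
  exact ⟨t, s, hmem'.1.2, by omega, by omega, by omega, hmin'⟩

/-- An additive bound is a multiplicative one, as different vertices have distance at least `1`. -/
theorem le_mul_of_le_of_pos {δ T D B : ℕ} (hT : T ≤ D + B) (hD : 1 ≤ D) (hB : B + 1 ≤ 500 * δ) :
    T ≤ 500 * δ * D := by
  have h1 : (B + 1) * D ≤ 500 * δ * D := Nat.mul_le_mul_right D hB
  have h2 : B ≤ B * D := Nat.le_mul_of_pos_right _ hD
  have h3 : (B + 1) * D = B * D + D := by ring
  omega

/-- One can leave a piecewise geodesic from `x` to `y` inside a piece, before the centre of the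
triangle `(x, y, z)`, and continue along a geodesic from `x` to `z`. -/
theorem IsPre.switch (S : IsSetup K δ ε) (h : IsPre K δ ε x y f n N c d) {k t₀ : ℕ}
    (hk : k ≤ N) (h1 : c k + 2 * locScale δ ε ≤ t₀) (h2 : t₀ + marg δ ≤ d k)
    (hG : 2 * K.dist x (f t₀) + 6 * δ + K.dist y z < K.dist x y + K.dist x z) :
    ∃ (f' : ℕ → V) (n' t : ℕ) (c' d' : ℕ → ℕ), t ≤ t₀ ∧ t₀ ≤ t + 13 * δ ∧
      IsPre K δ ε x z f' n' (k + 1) c' d' ∧ (∀ s ≤ t, f' s = f s) ∧ (∀ j ≤ k, c' j = c j) ∧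
      (∀ j < k, d' j = d j) ∧ d' k = t := by
  have hc := S.conn
  have H := S.toIsHypGraph
  have hdn := h.d_le hk
  have k1 := S.marg_le
  have k2 := eighty_thousand_mul_le_locScale (ε := ε) S.two_le
  have k3 := ten_mul_locScale_le_mu (δ := δ) (ε := ε)
  have k4 := S.morse_le
  have k5 := S.two_le
  have hQ := h.isQG H
  obtain ⟨g, g0, gm, hg⟩ := exists_geoFun hc x z
  set m := K.dist x z with hm
  obtain ⟨t, s, ht, ht', hs, hβ, hmin⟩ := h.exists_connection S hk h1 h2 hG hg g0 gm
  obtain ⟨β, β0, βb, hβg⟩ := exists_geoFun hc (f t) (g s)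
  set b := K.dist (f t) (g s) with hb
  set p := catFun f t β with hp
  set q := catFun p (t + b) (fun k => g (s + k)) with hq
  have hfβ : f t = β 0 := β0.symm
  have hpb : p (t + b) = (fun k => g (s + k)) 0 := by
    rw [hp, catFun_of_ge hfβ (by omega)]
    show β (t + b - t) = g (s + 0)
    rw [show t + b - t = b by omega, βb, add_zero]
  have qf : ∀ a ≤ t, q a = f a := fun a ha => by
    rw [hq, catFun_of_le (by omega), hp, catFun_of_le ha]
  have qβ : ∀ j ≤ b, q (t + j) = β j := fun j hj => by
    rw [hq, catFun_of_le (by omega), hp, catFun_of_ge hfβ (by omega)]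
    congr 1; omega
  have qg : ∀ j, q (t + b + j) = g (s + j) := fun j => by
    rw [hq, catFun_of_ge hpb (by omega)]
    show g (s + (t + b + j - (t + b))) = _
    congr 1; omega
  have hedge : IsEdgePath K q (t + b + (m - s)) :=
    ((h.edge.mono (by omega)).cat hβg.edgePath hfβ).cat (hg.edgePath.shift (by omega)) hpb
  have hlast : q (t + b + (m - s)) = z := by
    rw [qg, ← gm]; congr 1; omega
  have hstretch : ∀ a, a ≤ t → t - a ≤ locScale δ ε → K.dist (f a) (f t) = t - a :=
    fun a ha hL => h.geo k hk a t (by omega) ha (by omega) (by omega)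
  have esub : ∀ j, s + j ≤ m → K.dist (g s) (g (s + j)) = j := fun j hj => by
    rw [hg s (s + j) (by omega) hj]; omega
  have ebz : ∀ j ≤ b, K.dist (f t) (β j) = j := fun j hj => by
    have := hβg.dist_zero hj
    rwa [β0] at this
  have ebl : ∀ j ≤ b, K.dist (β j) (g s) = b - j := fun j hj => by
    have := hβg.dist_last hj
    rwa [βb] at this
  -- The three kinds of subpaths meeting the connection. In each case the minimality of the
  -- connection excludes that the two ends coincide.
  have hfb : ∀ a j, a ≤ t → t - a ≤ locScale δ ε → j ≤ b →
      t + j - a ≤ 500 * δ * K.dist (f a) (β j) := by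
    intro a j ha hL hj
    rcases Nat.eq_zero_or_pos (t + j - a) with h0 | hpos
    · omega
    have e1 := hstretch a ha hL
    have e2 := ebz j hj
    have t1 := hc.dist_triangle (u := f a) (v := β j) (w := f t)
    have c1 := K.dist_comm (u := f t) (v := β j)
    refine le_mul_of_le_of_pos (B := 26 * δ) (by omega) ?_ (by omega)
    by_contra hlt
    have heq := eq_of_dist_eq_zero hc (show K.dist (f a) (β j) = 0 by omega)
    have m1 := hmin a s (by omega) (by omega) hs
    have e3 := ebl j hj
    rw [heq] at m1
    omega
  have hbg : ∀ j i, j ≤ b → s + i ≤ m →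
      b - j + i ≤ 500 * δ * K.dist (β j) (g (s + i)) := by
    intro j i hj hi
    rcases Nat.eq_zero_or_pos (b - j + i) with h0 | hpos
    · omega
    have e1 := esub i hi
    have e2 := ebl j hj
    have t1 := hc.dist_triangle (u := g s) (v := β j) (w := g (s + i))
    have c1 := K.dist_comm (u := g s) (v := β j)
    refine le_mul_of_le_of_pos (B := 26 * δ) (by omega) ?_ (by omega)
    by_contra hlt
    have heq := eq_of_dist_eq_zero hc (show K.dist (β j) (g (s + i)) = 0 by omega)
    have m1 := hmin t (s + i) ht (by omega) hi
    have e3 := ebz j hj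
    rw [← heq] at m1
    omega
  have hfg : ∀ a i, a ≤ t → t - a ≤ locScale δ ε → s + i ≤ m →
      t - a + b + i ≤ 500 * δ * K.dist (f a) (g (s + i)) := by
    intro a i ha hL hi
    rcases Nat.eq_zero_or_pos (t - a + b + i) with h0 | hpos
    · omega
    have e1 := hstretch a ha hL
    have hpr := S.progress h.edge hQ (lo := a - marg δ) (a := a) (t := t)
      (by omega) ha (by omega)
      (h.geo k hk _ _ (by omega) (by omega) (by omega) (by omega))
    rw [h.first] at hpr
    have e2 := hg.dist_zero hi
    have e3 := hg.dist_zero hs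
    rw [g0] at e2 e3
    have t1 := hc.dist_triangle (u := x) (v := g s) (w := f t)
    have t2 := hc.dist_triangle (u := x) (v := f a) (w := g (s + i))
    have c1 := K.dist_comm (u := g s) (v := f t)
    refine le_mul_of_le_of_pos (B := 30 * δ) (by omega) ?_ (by omega)
    by_contra hlt
    have heq := eq_of_dist_eq_zero hc (show K.dist (f a) (g (s + i)) = 0 by omega)
    have m1 := hmin a (s + i) (by omega) (by omega) hi
    rw [heq, SimpleGraph.dist_self] at m1
    have hi0 : i = 0 := by omega
    have hb0 : b = 0 := by omega
    have : f a = f t := by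
      rw [heq, hi0, add_zero]
      exact (eq_of_dist_eq_zero hc (hb.symm.trans hb0)).symm
    rw [this, SimpleGraph.dist_self] at e1
    omega
  have hloc : ∀ i j, i ≤ j → j ≤ t + b + (m - s) → j - i ≤ locScale δ ε →
      j - i ≤ 500 * δ * K.dist (q i) (q j) := by
    intro i j hij hj hL
    rcases Nat.lt_or_ge t i with hi | hi
    · rcases Nat.lt_or_ge (t + b) i with hi' | hi'
      · obtain ⟨i', rfl⟩ : ∃ i', i = t + b + i' := ⟨i - (t + b), by omega⟩
        obtain ⟨j', rfl⟩ : ∃ j', j = t + b + j' := ⟨j - (t + b), by omega⟩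
        rw [qg, qg, hg _ _ (by omega) (by omega)]
        have := Nat.le_mul_of_pos_left (s + j' - (s + i')) (show 0 < 500 * δ by omega)
        omega
      obtain ⟨i', rfl⟩ : ∃ i', i = t + i' := ⟨i - t, by omega⟩
      rcases Nat.lt_or_ge (t + b) j with hj' | hj'
      · obtain ⟨j', rfl⟩ : ∃ j', j = t + b + j' := ⟨j - (t + b), by omega⟩
        rw [qβ i' (by omega), qg]
        have := hbg i' j' (by omega) (by omega)
        omega
      · obtain ⟨j', rfl⟩ : ∃ j', j = t + j' := ⟨j - t, by omega⟩
        rw [qβ i' (by omega), qβ j' (by omega), hβg _ _ (by omega) (by omega)]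
        have := Nat.le_mul_of_pos_left (j' - i') (show 0 < 500 * δ by omega)
        omega
    rw [qf i hi]
    rcases Nat.lt_or_ge t j with hj1 | hj1
    · rcases Nat.lt_or_ge (t + b) j with hj' | hj'
      · obtain ⟨j', rfl⟩ : ∃ j', j = t + b + j' := ⟨j - (t + b), by omega⟩
        rw [qg]
        have := hfg i j' hi (by omega) (by omega)
        omega
      · obtain ⟨j', rfl⟩ : ∃ j', j = t + j' := ⟨j - t, by omega⟩
        rw [qβ j' (by omega)]
        exact hfb i j' hi (by omega) (by omega)
    · rw [qf j hj1]
      exact h.loc i j hij (by omega) hL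
  -- Before the connection, the path is close to a geodesic from `x` to `f t`, a side of the
  -- triangle whose third vertex is `g s`.
  have hclose : ∀ a ≤ t + b + (m - s), ∃ j ≤ m, K.dist (q a) (g j) ≤ 2 * ε := by
    intro a ha
    rcases Nat.lt_or_ge (t + b) a with ha1 | ha1
    · obtain ⟨i, rfl⟩ : ∃ i, a = t + b + i := ⟨a - (t + b), by omega⟩
      exact ⟨s + i, by omega, by rw [qg]; simp⟩
    rcases Nat.lt_or_ge t a with ha2 | ha2
    · obtain ⟨j, rfl⟩ : ∃ j, a = t + j := ⟨a - t, by omega⟩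
      exact ⟨s, hs, by rw [qβ j (by omega), ebl j (by omega)]; omega⟩
    rw [qf a ha2]
    obtain ⟨g', g0', gm', hg'⟩ := exists_geoFun hc x (f t)
    obtain ⟨i, hi, hdi⟩ := S.near (h.edge.mono (show t ≤ n by omega)) (hQ.mono (by omega)) hg'
      (g0'.trans h.first.symm) gm' ha2
    have hbt := (hg'.btw hi).symm
    rw [g0', gm'] at hbt
    rcases slim_fun_left hc S.hyp hbt (hg.mono hs) g0 rfl with ⟨j, hj, hdj⟩ | ⟨w, hw, hdw⟩
    · refine ⟨j, by omega, ?_⟩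
      have t1 := hc.dist_triangle (u := f a) (v := g' i) (w := g j)
      omega
    · refine ⟨s, hs, ?_⟩
      have hw' : K.dist (f t) w + K.dist w (g s) = K.dist (f t) (g s) := hw
      have t1 := hc.dist_triangle (u := f a) (v := g' i) (w := g s)
      have t2 := hc.dist_triangle (u := g' i) (v := w) (w := g s)
      omega
  refine ⟨q, t + b + (m - s), t, fun j => if j ≤ k then c j else t + b,
    fun j => if j < k then d j else if j = k then t else t + b + (m - s), ht, ht', ?_, qf,
    fun j hj => if_pos hj, fun j hj => if_pos hj, by simp⟩
  refine ⟨hedge, (qf 0 (Nat.zero_le _)).trans h.first, hlast, hloc, by simp [h.start], by simp,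
    fun j hj => ?_, fun j hj => ?_, fun j hj u v hu huv hv hmu => ?_, fun j hj => ?_,
    ⟨g, m, hg, g0, gm, hclose⟩⟩
  · show (if j ≤ k then c j else t + b) ≤
      if j < k then d j else if j = k then t else t + b + (m - s)
    split_ifs with a1 a2 a3
    · exact h.piece_le j (by omega)
    · subst a3; omega
    · omega
    · omega
    · omega
    · omega
  · show (if j < k then d j else if j = k then t else t + b + (m - s)) ≤
      if j + 1 ≤ k then c (j + 1) else t + b
    rcases Nat.lt_or_ge j k with hjk | hjk
    · rw [if_pos hjk, if_pos (by omega)]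
      exact h.bridge_le j (by omega)
    · rw [if_neg (by omega), if_pos (by omega), if_neg (by omega)]
      omega
  · have hu' : (if j ≤ k then c j else t + b) ≤ u := hu
    have hv' : v ≤ if j < k then d j else if j = k then t else t + b + (m - s) := hv
    rcases Nat.lt_or_ge k j with hjk | hjk
    · rw [if_neg (by omega)] at hu'
      rw [if_neg (by omega), if_neg (by omega)] at hv'
      obtain ⟨u', rfl⟩ : ∃ i, u = t + b + i := ⟨u - (t + b), by omega⟩
      obtain ⟨v', rfl⟩ : ∃ i, v = t + b + i := ⟨v - (t + b), by omega⟩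
      rw [qg, qg, hg _ _ (by omega) (by omega)]
      omega
    · rw [if_pos hjk] at hu'
      have hvt : v ≤ t ∧ v ≤ d j := by
        rcases Nat.lt_or_ge j k with hjk' | hjk'
        · rw [if_pos hjk'] at hv'
          have := h.d_le_c hjk' hk
          omega
        · obtain rfl : j = k := by omega
          rw [if_neg (by omega), if_pos rfl] at hv'
          omega
      rw [qf u (by omega), qf v hvt.1]
      exact h.geo j (by omega) u v hu' huv hvt.2 hmu
  · show (if j + 1 ≤ k then c (j + 1) else t + b) -
      (if j < k then d j else if j = k then t else t + b + (m - s)) ≤ ε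
    rcases Nat.lt_or_ge j k with hjk | hjk
    · rw [if_pos hjk, if_pos (by omega)]
      exact h.bridge_length j (by omega)
    · rw [if_neg (show ¬ j < k by omega), if_pos (show j = k by omega),
        if_neg (show ¬ j + 1 ≤ k by omega)]
      omega

/-- After a switch, a deep vertex of a piecewise geodesic from `x` to `y` is a deep vertex of a
piecewise geodesic from `x` to `z`. -/
theorem IsPre.mem_cylinder_of_switch (S : IsSetup K δ ε) (h : IsPre K δ ε x y f n N c d)
    {k t₀ : ℕ} (hk : k ≤ N) (h1 : c k + 2 * locScale δ ε ≤ t₀) (h2 : t₀ + marg δ ≤ d k)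
    (hG : 2 * K.dist x (f t₀) + 6 * δ + K.dist y z < K.dist x y + K.dist x z)
    (hp : ∀ j, 0 < j → j < k → l ≤ d j - c j) (hkl : 0 < k → c k + l + 13 * δ ≤ t₀) {p t : ℕ}
    (hD : IsDeep K l x y f N c d p t)
    (hpt : p < k ∨ p = k ∧ ∀ t', t' ≤ t₀ → t₀ ≤ t' + 13 * δ → t ≤ t' ∧ l ≤ K.dist (f t') (f t)) :
    f t ∈ cylinder K δ ε l x z := by
  have hQ := h.isQG S.toIsHypGraph
  have hdn := h.d_le hk
  have k2 := eighty_thousand_mul_le_locScale (ε := ε) S.two_le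
  have k4 := S.morse_le
  obtain ⟨f', n', t', c', d', ht', ht'', h', hf', hc', hd', hdk⟩ := h.switch S hk h1 h2 hG
  have g1 := hD.ge_c
  have g2 := hD.le_d
  have htt : t ≤ t' := by
    rcases hpt with hpk | ⟨-, hh⟩
    · have := h.d_le_c hpk hk
      omega
    · exact (hh t' ht' ht'').1
  have hpk : p ≤ k := by omega
  refine (mem_cylinder_iff S.conn).2 ⟨f', n', k + 1, c', d', h', fun j j1 j2 => ?_, p, t,
    ⟨by omega, by rw [hc' p hpk]; exact g1, ?_, ?_, ?_⟩, hf' t htt⟩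
  · rcases Nat.lt_or_ge j k with hj | hj
    · rw [hc' j hj.le, hd' j hj]
      exact hp j j1 hj
    · obtain rfl : j = k := by omega
      rw [hc' j le_rfl, hdk]
      have := hkl j1
      omega
  · rcases hpt with hpk | ⟨rfl, hh⟩
    · rw [hd' p hpk]; exact g2
    · rw [hdk]; exact htt
  · rw [hc' p hpk, hf' _ (by omega), hf' t htt]
    exact hD.left
  · rcases hpt with hpk | ⟨rfl, hh⟩
    · intro _
      have := h.d_le_c hpk hk
      rw [hd' p hpk, hf' _ (by omega), hf' t htt]
      refine hD.right fun he => ?_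
      rw [← h.last] at he
      have := hQ.inj (by omega) le_rfl he
      omega
    · intro _
      rw [hdk, hf' _ le_rfl, hf' t htt]
      exact (hh t' ht' ht'').2

end Switch

/-! ### Splicing piecewise geodesics -/

section Splice

variable {x y z : V} {f f' : ℕ → V} {n n' N N' l l' P₀ : ℕ} {c d c' d' : ℕ → ℕ}

/-- Two piecewise geodesics having a segment of length `μ` in common, inside a piece of each of
them, can be spliced along it: one follows the first one up to the end of the segment and then
the second one. -/
theorem IsPre.splice (S : IsSetup K δ ε) (h : IsPre K δ ε x y f n N c d)
    (h' : IsPre K δ ε x y f' n' N' c' d') {k k' s s' : ℕ} (hk : k ≤ N) (hk' : k' ≤ N')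
    (hs : c k ≤ s) (hsd : s + mu δ ε ≤ d k) (hs' : c' k' ≤ s') (hsd' : s' + mu δ ε ≤ d' k')
    (heq : ∀ j ≤ mu δ ε, f (s + j) = f' (s' + j)) :
    ∃ (q : ℕ → V) (nq : ℕ) (cq dq : ℕ → ℕ), IsPre K δ ε x y q nq (k + (N' - k')) cq dq ∧
      (∀ j ≤ s + mu δ ε, q j = f j) ∧ (∀ j, q (s + j) = f' (s' + j)) ∧
      (∀ j ≤ k, cq j = c j) ∧ (∀ j < k, dq j = d j) ∧ (dq k + s' = d' k' + s) ∧
      ∀ j, 0 < j → j ≤ N' - k' → cq (k + j) + s' = c' (k' + j) + s ∧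
        dq (k + j) + s' = d' (k' + j) + s := by
  have hdn := h.d_le hk
  have hdn' := h'.d_le hk'
  have k3 := ten_mul_locScale_le_mu (δ := δ) (ε := ε)
  set M := mu δ ε with hM
  set q := catFun f (s + M) (fun j => f' (s' + M + j)) with hq
  have hj : f (s + M) = (fun j => f' (s' + M + j)) 0 := heq M le_rfl
  have q1 : ∀ j ≤ s + M, q j = f j := fun j hj => catFun_of_le hj
  have q2 : ∀ j, q (s + j) = f' (s' + j) := by
    intro j
    rcases Nat.lt_or_ge j M with hjM | hjM
    · rw [q1 _ (by omega)]
      exact heq j hjM.le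
    · rw [hq, catFun_of_ge hj (by omega)]
      show f' (s' + M + (s + j - (s + M))) = _
      congr 1; omega
  set nq := s + M + (n' - (s' + M)) with hnq
  have hedge : IsEdgePath K q nq :=
    (h.edge.mono (by omega)).cat (h'.edge.shift (i := s' + M) (by omega)) hj
  have hlast : q nq = y := by
    rw [show nq = s + (n' - s') by omega, q2, ← h'.last]
    congr 1; omega
  have hd'mono : ∀ j, 0 < j → j ≤ N' - k' → d' k' ≤ c' (k' + j) := fun j h1 h2 =>
    h'.d_le_c (by omega) (by omega)
  have hpc : ∀ j, j ≤ N' - k' → c' (k' + j) ≤ d' (k' + j) := fun j h1 => h'.piece_le _ (by omega)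
  refine ⟨q, nq, fun j => if j ≤ k then c j else c' (k' + (j - k)) + s - s',
    fun j => if j < k then d j else d' (k' + (j - k)) + s - s', ?_, q1, q2,
    fun j hj => if_pos hj, fun j hj => if_pos hj, ?_, ?_⟩
  · refine ⟨hedge, (q1 0 (Nat.zero_le _)).trans h.first, hlast, fun i j hij hj hL => ?_, ?_, ?_,
      fun j hj => ?_, fun j hj => ?_, fun j hj u v hu huv hv hmu => ?_, fun j hj => ?_, ?_⟩
    · rcases Nat.lt_or_ge i s with hi | hi
      · rw [q1 i (by omega), q1 j (by omega)]
        exact h.loc i j hij (by omega) hL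
      · obtain ⟨i', rfl⟩ : ∃ i', i = s + i' := ⟨i - s, by omega⟩
        obtain ⟨j', rfl⟩ : ∃ j', j = s + j' := ⟨j - s, by omega⟩
        rw [q2, q2]
        have := h'.loc (s' + i') (s' + j') (by omega) (by omega) (by omega)
        omega
    · simp [h.start]
    · show (if k + (N' - k') < k then d (k + (N' - k')) else
        d' (k' + (k + (N' - k') - k)) + s - s') = nq
      rw [if_neg (by omega), show k' + (k + (N' - k') - k) = N' by omega, h'.finish]
      omega
    · show (if j ≤ k then c j else c' (k' + (j - k)) + s - s') ≤
        if j < k then d j else d' (k' + (j - k)) + s - s'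
      rcases lt_trichotomy j k with hjk | hjk | hjk
      · rw [if_pos hjk.le, if_pos hjk]
        exact h.piece_le j (by omega)
      · subst hjk
        rw [if_pos le_rfl, if_neg (by omega), Nat.sub_self, add_zero]
        omega
      · rw [if_neg (by omega), if_neg (by omega)]
        have := hpc (j - k) (by omega)
        omega
    · show (if j < k then d j else d' (k' + (j - k)) + s - s') ≤
        if j + 1 ≤ k then c (j + 1) else c' (k' + (j + 1 - k)) + s - s'
      rcases Nat.lt_or_ge j k with hjk | hjk
      · rw [if_pos hjk, if_pos (by omega)]
        exact h.bridge_le j (by omega)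
      · rw [if_neg (by omega), if_neg (by omega)]
        have := h'.bridge_le (k' + (j - k)) (by omega)
        rw [show k' + (j - k) + 1 = k' + (j + 1 - k) by omega] at this
        omega
    · have hu' : (if j ≤ k then c j else c' (k' + (j - k)) + s - s') ≤ u := hu
      have hv' : v ≤ if j < k then d j else d' (k' + (j - k)) + s - s' := hv
      rcases Nat.lt_or_ge j k with hjk | hjk
      · rw [if_pos hjk.le] at hu'
        rw [if_pos hjk] at hv'
        have := h.d_le_c hjk hk
        rw [q1 u (by omega), q1 v (by omega)]
        exact h.geo j (by omega) u v hu' huv hv' hmu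
      rw [if_neg (by omega)] at hv'
      have key : ∀ i i', c' (k' + (j - k)) ≤ s' + i → i ≤ i' → s' + i' ≤ d' (k' + (j - k)) →
          i' - i ≤ M → K.dist (q (s + i)) (q (s + i')) = i' - i := by
        intro i i' h1 h2 h3 h4
        rw [q2, q2, h'.geo (k' + (j - k)) (by omega) (s' + i) (s' + i') h1 (by omega) h3 (by omega)]
        omega
      rcases Nat.lt_or_ge k j with hjk' | hjk'
      · rw [if_neg (by omega)] at hu'
        have := hd'mono (j - k) (by omega) (by omega)
        have := hpc (j - k) (by omega)
        have := key (u - s) (v - s) (by omega) (by omega) (by omega) (by omega)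
        rw [show s + (u - s) = u by omega, show s + (v - s) = v by omega] at this
        omega
      · obtain rfl : j = k := by omega
        rw [if_pos le_rfl] at hu'
        rw [Nat.sub_self, add_zero] at hv' key
        rcases Nat.lt_or_ge u s with hus | hus
        · rw [q1 u (by omega), q1 v (by omega)]
          exact h.geo j hk u v hu' huv (by omega) hmu
        · have := key (u - s) (v - s) (by omega) (by omega) (by omega) (by omega)
          rw [show s + (u - s) = u by omega, show s + (v - s) = v by omega] at this
          omega
    · show (if j + 1 ≤ k then c (j + 1) else c' (k' + (j + 1 - k)) + s - s') -
        (if j < k then d j else d' (k' + (j - k)) + s - s') ≤ ε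
      rcases Nat.lt_or_ge j k with hjk | hjk
      · rw [if_pos hjk, if_pos (by omega)]
        exact h.bridge_length j (by omega)
      · rw [if_neg (show ¬ j < k by omega), if_neg (show ¬ j + 1 ≤ k by omega)]
        have := h'.bridge_length (k' + (j - k)) (by omega)
        rw [show k' + (j - k) + 1 = k' + (j + 1 - k) by omega] at this
        omega
    · obtain ⟨g, g0, gm, hg⟩ := exists_geoFun S.conn x y
      have km := S.morse_le
      refine ⟨g, _, hg, g0, gm, fun j hj => ?_⟩
      rcases Nat.lt_or_ge j s with hjs | hjs
      · obtain ⟨i, hi, hd⟩ := h.near S hg g0 gm (t := j) (by omega)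
        exact ⟨i, hi, by rw [q1 j (by omega)]; omega⟩
      · obtain ⟨i, hi, hd⟩ := h'.near S hg g0 gm (t := s' + (j - s)) (by omega)
        refine ⟨i, hi, ?_⟩
        rw [show j = s + (j - s) by omega, q2]
        omega
  · show (if k < k then d k else d' (k' + (k - k)) + s - s') + s' = _
    rw [if_neg (by omega), Nat.sub_self, add_zero]
    omega
  · intro j h1 h2
    show (if k + j ≤ k then c (k + j) else c' (k' + (k + j - k)) + s - s') + s' = _ ∧
      (if k + j < k then d (k + j) else d' (k' + (k + j - k)) + s - s') + s' = _
    rw [if_neg (by omega), if_neg (by omega), show k + j - k = j by omega]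
    have := hd'mono j h1 h2
    have := hpc j h2
    omega

/-- If a piece following that of a deep vertex is longer than required, the vertex lies in the
cylinder of another side of the triangle. -/
theorem IsPre.mem_cylinder_of_long_piece (S : IsSetup K δ ε) (h : IsPre K δ ε x y f n N c d)
    (hl : mu δ ε ≤ l) {p k t : ℕ} (hpk : p < k) (hk : k ≤ N) (hlen : c k + l + ε ≤ d k)
    (hp : ∀ j, 0 < j → j < k → l ≤ d j - c j) (hD : IsDeep K l x y f N c d p t)
    (hG : 2 * K.dist x (f (c k)) + 2 * l + ε + K.dist y z < K.dist x y + K.dist x z) :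
    f t ∈ cylinder K δ ε l x z := by
  have k1 := S.marg_le
  have k2 := eighty_thousand_mul_le_locScale (ε := ε) S.two_le
  have k3 := ten_mul_locScale_le_mu (δ := δ) (ε := ε)
  have k4 := S.morse_le
  have hdn := h.d_le hk
  have e1 := h.edge.dist_le (i := c k) (j := c k + l + 13 * δ) (by omega) (by omega)
  have t1 := S.conn.dist_triangle (u := x) (v := f (c k)) (w := f (c k + l + 13 * δ))
  exact h.mem_cylinder_of_switch S hk (t₀ := c k + l + 13 * δ) (by omega) (by omega) (by omega)
    hp (fun _ => le_rfl) hD (Or.inl hpk)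

/-- If the piece of a deep vertex goes on far enough towards the centre of the triangle, the
vertex lies in the cylinder of another side. -/
theorem IsPre.mem_cylinder_of_same_piece (S : IsSetup K δ ε) (h : IsPre K δ ε x y f n N c d)
    {k s t : ℕ} (hp : PiecesGE l N c d) (hs : c k ≤ s)
    (hsd : s + mu δ ε ≤ d k) (hD : IsDeep K l x y f N c d k t)
    (hfar : K.dist x (f t) + l + mu δ ε ≤ K.dist x (f s)) (hts : t ≤ s)
    (hG : 2 * K.dist x (f s) + 2 * mu δ ε + 6 * δ + K.dist y z < K.dist x y + K.dist x z) :
    f t ∈ cylinder K δ ε l x z := by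
  have k1 := S.marg_le
  have k2 := eighty_thousand_mul_le_locScale (ε := ε) S.two_le
  have k3 := ten_mul_locScale_le_mu (δ := δ) (ε := ε)
  have k4 := S.morse_le
  have hk := hD.le
  have hdn := h.d_le hk
  have hD1 := hD.ge_c
  have hQ := h.isQG S.toIsHypGraph
  have hdist : ∀ t', t' ≤ n → s ≤ t' → l + 100 * δ ≤ K.dist (f t') (f t) := by
    intro t' h1 h2
    have m1 := S.dist_le_of_le h.edge hQ h2 h1
    rw [h.first] at m1
    have t1 := S.conn.dist_triangle (u := x) (v := f t) (w := f t')
    have c1 := K.dist_comm (u := f t) (v := f t')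
    omega
  set t₀ := s + mu δ ε - marg δ with ht₀
  have e1 := h.edge.dist_le (i := s) (j := t₀) (by omega) (by omega)
  have t1 := S.conn.dist_triangle (u := x) (v := f s) (w := f t₀)
  refine h.mem_cylinder_of_switch S hk (t₀ := t₀) (by omega) (by omega) (by omega)
    (fun j h1 h2 => hp j h1 (by omega)) (fun _ => ?_) hD (Or.inr ⟨rfl, fun t' h1 h2 => ⟨?_, ?_⟩⟩)
  · have h3 := hdist t₀ (by omega) (by omega)
    have h4 := h.edge.dist_le (i := t) (j := t₀) (by omega) (by omega)
    have c1 := K.dist_comm (u := f t) (v := f t₀)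
    omega
  · omega
  · have := hdist t' (by omega) (by omega)
    omega

/-- A piecewise geodesic contains a segment of length `μ` of one of its pieces at any given
position which is not too close to its end. -/
theorem IsPre.exists_segment (S : IsSetup K δ ε) (h : IsPre K δ ε x y f n N c d)
    (hl : 10 * mu δ ε ≤ l) (hp : PiecesGE l N c d) (hy : P₀ + 4 * mu δ ε ≤ K.dist x y) :
    ∃ k s, k ≤ N ∧ c k ≤ s ∧ s + mu δ ε ≤ d k ∧ K.dist x (f s) ≤ P₀ + 2 * mu δ ε ∧
      (∀ t, t ≤ n → s ≤ t → P₀ ≤ K.dist x (f t) + morseConst δ) ∧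
      ∀ t ≤ n, K.dist x (f t) + morseConst δ < P₀ → t < s := by
  classical
  have k2 := eighty_thousand_mul_le_locScale (ε := ε) S.two_le
  have k3 := ten_mul_locScale_le_mu (δ := δ) (ε := ε)
  have hQ := h.isQG S.toIsHypGraph
  have hex : ∃ t, t ≤ n ∧ P₀ ≤ K.dist x (f t) := ⟨n, le_rfl, by rw [h.last]; omega⟩
  obtain ⟨h1, h2⟩ := Nat.find_spec hex
  have hmin : ∀ t < Nat.find hex, t ≤ n → K.dist x (f t) < P₀ := by
    intro t ht htn
    by_contra hlt
    exact Nat.find_min hex ht ⟨htn, by omega⟩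
  set τ := Nat.find hex with hτ
  have h3 : K.dist x (f τ) ≤ P₀ := by
    rcases Nat.eq_zero_or_pos τ with h0 | hpos
    · rw [h0, h.first, SimpleGraph.dist_self]; omega
    · have := hmin (τ - 1) (by omega) (by omega)
      have e1 := h.edge.dist_le (i := τ - 1) (j := τ) (by omega) h1
      have t1 := S.conn.dist_triangle (u := x) (v := f (τ - 1)) (w := f τ)
      omega
  have hlong : ∀ t, τ ≤ t → t ≤ n → P₀ ≤ K.dist x (f t) + morseConst δ := by
    intro t ht htn
    have m1 := S.dist_le_of_le h.edge hQ ht htn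
    rw [h.first] at m1
    omega
  -- The first piece that goes at least `μ` beyond the time `τ`.
  have hn : τ + 4 * mu δ ε ≤ n := by
    have e1 := h.edge.dist_le (i := τ) (j := n) h1 le_rfl
    have t1 := S.conn.dist_triangle (u := x) (v := f τ) (w := f n)
    rw [h.last] at t1 e1
    omega
  have hex' : ∃ k, τ + mu δ ε ≤ d k := ⟨N, by rw [h.finish]; omega⟩
  have g1 := Nat.find_spec hex'
  have g2 : ∀ j < Nat.find hex', d j < τ + mu δ ε := fun j hj =>
    Nat.lt_of_not_le (Nat.find_min hex' hj)
  have g3 : Nat.find hex' ≤ N := Nat.find_min' hex' (by rw [h.finish]; omega)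
  set k := Nat.find hex' with hk
  have hck : c k ≤ τ + mu δ ε + ε := by
    rcases Nat.eq_zero_or_pos k with h0 | hpos
    · rw [h0, h.start]; omega
    · have b1 := h.bridge_length (k - 1) (by omega)
      have b2 := g2 (k - 1) (by omega)
      rw [show k - 1 + 1 = k by omega] at b1
      omega
  have hdk : max τ (c k) + mu δ ε ≤ d k := by
    rcases Nat.lt_or_ge τ (c k) with hlt | hge
    · rw [max_eq_right hlt.le]
      rcases Nat.lt_or_ge k N with hkN | hkN
      · have hk0 : 0 < k := by
          rcases Nat.eq_zero_or_pos k with h0 | hpos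
          · rw [h0, h.start] at hlt; omega
          · exact hpos
        have := hp k hk0 hkN
        have := h.piece_le k g3
        omega
      · rw [show k = N by omega, h.finish]
        rw [show k = N by omega] at hck
        omega
    · rw [max_eq_left hge]; exact g1
  have hdn := h.d_le g3
  have e1 := h.edge.dist_le (i := τ) (j := max τ (c k)) (by omega) (by omega)
  have t1 := S.conn.dist_triangle (u := x) (v := f τ) (w := f (max τ (c k)))
  refine ⟨k, max τ (c k), g3, le_max_right _ _, hdk, by omega,
    fun t ht hst => hlong t (by omega) ht, fun t ht htP => ?_⟩
  by_contra hlt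
  have := hlong t (by omega) ht
  omega

end Splice

/-! ### Agreement of cylinders -/

section Agreement

variable {x y z : V} {f f' : ℕ → V} {n n' N N' l l' P₀ p k t s p' k' t' s' : ℕ}
  {c d c' d' : ℕ → ℕ}

/-- A piecewise geodesic from `x` to `y` witnessing that a vertex of the cylinder of `x` and `y`,
close to `x`, is not obviously in the cylinder of `x` and `z`: the piece meeting the position `P₀`
is not that of the vertex, and it is not longer than required. The segment of length `μ` starting
at the time `s` lies in this piece. -/
structure IsObstruction (K : SimpleGraph V) (δ ε : ℕ) (x y z : V) (P₀ l : ℕ) (f : ℕ → V)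
    (n N : ℕ) (c d : ℕ → ℕ) (p t k s : ℕ) : Prop where
  pre : IsPre K δ ε x y f n N c d
  pieces : PiecesGE l N c d
  deep : IsDeep K l x y f N c d p t
  notMem : f t ∉ cylinder K δ ε l x z
  lt_piece : p < k
  lt_last : k < N
  ge_c : c k ≤ s
  le_d : s + mu δ ε ≤ d k
  short : d k < c k + l + ε
  le_pos : K.dist x (f s) ≤ P₀ + 2 * mu δ ε
  pos_le : ∀ j ≤ n, s ≤ j → P₀ ≤ K.dist x (f j) + morseConst δ

/-- The exclusion of the two cases in which a switch to the other side is possible. -/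
theorem exists_isObstruction (S : IsSetup K δ ε) (hl : 10 * mu δ ε ≤ l)
    (hG : 2 * P₀ + 4 * l + 20 * mu δ ε + K.dist y z ≤ K.dist x y + K.dist x z) {v : V}
    (hv : v ∈ cylinder K δ ε l x y) (hv' : v ∉ cylinder K δ ε l x z)
    (hP : K.dist x v + l + 4 * mu δ ε ≤ P₀) :
    ∃ (f : ℕ → V) (n N : ℕ) (c d : ℕ → ℕ) (p t k s : ℕ),
      IsObstruction K δ ε x y z P₀ l f n N c d p t k s := by
  have k2 := eighty_thousand_mul_le_locScale (ε := ε) S.two_le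
  have k3 := ten_mul_locScale_le_mu (δ := δ) (ε := ε)
  have k4 := S.morse_le
  have hc := S.conn
  have t1 := hc.dist_triangle (u := x) (v := y) (w := z)
  obtain ⟨f, n, N, c, d, h, hp, p, t, hD, rfl⟩ := (mem_cylinder_iff hc).1 hv
  obtain ⟨k, s, hk, hs, hsd, hpos, hge, hlt⟩ := h.exists_segment S hl hp (P₀ := P₀) (by omega)
  have hdp := h.d_le hD.le
  have hdk := h.d_le hk
  have hD1 := hD.ge_c
  have hD2 := hD.le_d
  have hts := hlt t (by omega) (by omega)
  have hpk : p < k := by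
    rcases lt_trichotomy p k with h1 | rfl | h1
    · exact h1
    · have := hge s (by omega) le_rfl
      exact absurd (h.mem_cylinder_of_same_piece S hp hs hsd hD (by omega) hts.le (by omega)) hv'
    · have := h.d_le_c h1 hD.le
      omega
  have hshort : d k < c k + l + ε := by
    by_contra hle
    have m1 := S.dist_le_of_le h.edge (h.isQG S.toIsHypGraph) hs (by omega)
    rw [h.first] at m1
    exact hv' (h.mem_cylinder_of_long_piece S (by omega) hpk hk (by omega)
      (fun j j1 j2 => hp j j1 (by omega)) hD (by omega))
  refine ⟨f, n, N, c, d, p, t, k, s, h, hp, hD, hv', hpk, ?_, hs, hsd, hshort, hpos, hge⟩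
  refine lt_of_le_of_ne hk fun hkN => ?_
  have e1 := h.edge.dist_le (i := s) (j := n) (by omega) le_rfl
  have t2 := hc.dist_triangle (u := x) (v := f s) (w := f n)
  rw [h.last] at e1 t2
  rw [hkN, h.finish] at hshort
  rw [hkN] at hs
  omega

/-- The contradiction behind the agreement of cylinders: obstructions for two different lengths
cannot have the same segment and ends of pieces at the same distance, up to a multiple of
`2 ε + 1`, from this segment. Otherwise splicing the two paths produces a long piece. -/
theorem IsObstruction.false_of_eq (S : IsSetup K δ ε) (hl : 10 * mu δ ε ≤ l)
    (h : IsObstruction K δ ε x y z P₀ l f n N c d p t k s)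
    (h' : IsObstruction K δ ε x y z P₀ l' f' n' N' c' d' p' t' k' s') (hll : l + 2 * ε ≤ l')
    (hG : 2 * P₀ + 4 * l' + 20 * mu δ ε + K.dist y z ≤ K.dist x y + K.dist x z)
    (heq : ∀ j ≤ mu δ ε, f (s + j) = f' (s' + j))
    (hmod : (d k - (s + mu δ ε)) % (2 * ε + 1) = (d' k' - (s' + mu δ ε)) % (2 * ε + 1)) :
    False := by
  have k2 := eighty_thousand_mul_le_locScale (ε := ε) S.two_le
  have k3 := ten_mul_locScale_le_mu (δ := δ) (ε := ε)
  have k4 := S.morse_le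
  have hc := S.conn
  have tri := hc.dist_triangle (u := x) (v := y) (w := z)
  -- Splicing the path of one obstruction with that of another one having a longer end of piece.
  have long : ∀ {l l' : ℕ} {f f' : ℕ → V} {n n' N N' : ℕ} {c d c' d' : ℕ → ℕ}
      {p t k s p' t' k' s' : ℕ}, 10 * mu δ ε ≤ l →
      IsObstruction K δ ε x y z P₀ l f n N c d p t k s →
      IsObstruction K δ ε x y z P₀ l' f' n' N' c' d' p' t' k' s' →
      2 * P₀ + 4 * l + 20 * mu δ ε + K.dist y z ≤ K.dist x y + K.dist x z →
      (∀ j ≤ mu δ ε, f (s + j) = f' (s' + j)) →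
      d k + s' + ε < d' k' + s → False := by
    intro l l' f f' n n' N N' c d c' d' p t k s p' t' k' s' hl h h' hG heq hlt
    obtain ⟨q, nq, cq, dq, hq, q1, q2, c1, d1, d2, -⟩ := h.pre.splice S h'.pre h.lt_last.le
      h'.lt_last.le h.ge_c h.le_d h'.ge_c h'.le_d heq
    have g0 := h.le_d
    have g1 := h.ge_c
    have g2 := h.lt_piece
    have g3 := h.deep.ge_c
    have g4 := h.deep.le_d
    have g5 := h.pre.d_le_c g2 h.lt_last.le
    have g6 := h.pieces k (by omega) h.lt_last
    have g7 := h.pre.d_le h.lt_last.le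
    have hDq : IsDeep K l x y q (k + (N' - k')) cq dq p t := by
      refine ⟨by omega, by rw [c1 p g2.le]; exact g3, by rw [d1 p g2]; exact g4, ?_, ?_⟩
      · rw [c1 p g2.le, q1 _ (by omega), q1 _ (by omega)]
        exact h.deep.left
      · rw [d1 p g2, q1 _ (by omega), q1 _ (by omega)]
        exact h.deep.right
    have m1 := S.dist_le_of_le h.pre.edge (h.pre.isQG S.toIsHypGraph) g1 (by omega)
    rw [h.pre.first] at m1
    have g8 := h.le_pos
    refine h.notMem ?_
    rw [← q1 t (by omega)]
    refine hq.mem_cylinder_of_long_piece S (by omega) g2 (by omega)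
      (by rw [c1 k le_rfl]; omega) (fun j j1 j2 => ?_) hDq
      (by rw [c1 k le_rfl, q1 _ (by omega)]; omega)
    rw [c1 j j2.le, d1 j j2]
    exact h.pieces j j1 (by have := h.lt_last; omega)
  have g0 := h.le_d
  have g0' := h'.le_d
  -- If the ends of pieces are at different distances from the segment, these differ by at least
  -- `2 ε + 1`; if they are at the same one, the next piece of the spliced path, which comes from
  -- the second path, is too long since `l'` exceeds `l`.
  rcases lt_trichotomy (d k + s') (d' k' + s) with hlt | he | hlt
  · refine long hl h h' (by omega) heq ?_
    by_contra hle
    rw [← Nat.ModEq, Nat.modEq_iff_dvd'] at hmod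
    · have := Nat.le_of_dvd (by omega) hmod
      omega
    · omega
  · obtain ⟨q, nq, cq, dq, hq, q1, q2, c1, d1, d2, e1⟩ := h.pre.splice S h'.pre h.lt_last.le
      h'.lt_last.le h.ge_c h.le_d h'.ge_c h'.le_d heq
    have g1 := h.ge_c
    have g1' := h'.ge_c
    have g2 := h.lt_piece
    have g3 := h.deep.ge_c
    have g4 := h.deep.le_d
    have g5 := h.pre.d_le_c g2 h.lt_last.le
    have g6 := h.pieces k (by omega) h.lt_last
    have g7 := h.pre.d_le h.lt_last.le
    have g8 := h.le_pos
    have g9 := h.short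
    have lt' := h'.lt_last
    have hDq : IsDeep K l x y q (k + (N' - k')) cq dq p t := by
      refine ⟨by omega, by rw [c1 p g2.le]; exact g3, by rw [d1 p g2]; exact g4, ?_, ?_⟩
      · rw [c1 p g2.le, q1 _ (by omega), q1 _ (by omega)]
        exact h.deep.left
      · rw [d1 p g2, q1 _ (by omega), q1 _ (by omega)]
        exact h.deep.right
    obtain ⟨e2, e3⟩ := e1 1 (by omega) (by omega)
    have b1 := hq.bridge_length k (by omega)
    have b2 := hq.bridge_le k (by omega)
    have b3 := hq.d_le (i := k + 1) (by omega)
    have b4 := hq.piece_le (k + 1) (by omega)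
    have m1 := hq.edge.dist_le (i := s) (j := cq (k + 1)) (by omega) (by omega)
    have t1 := hc.dist_triangle (u := x) (v := q s) (w := q (cq (k + 1)))
    rw [q1 s (by omega)] at m1 t1
    have hlen : cq (k + 1) + l + ε ≤ dq (k + 1) := by
      rcases Nat.lt_or_ge (k' + 1) N' with hkN | hkN
      · have := h'.pieces (k' + 1) (by omega) hkN
        have := h'.pre.piece_le (k' + 1) lt'
        omega
      · have hlast : dq (k + 1) = nq := by
          rw [← hq.finish]; congr 1; omega
        have m2 := hq.edge.dist_le (i := cq (k + 1)) (j := nq) (by omega) le_rfl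
        have t2 := hc.dist_triangle (u := x) (v := q (cq (k + 1))) (w := q nq)
        rw [hq.last] at m2 t2
        omega
    refine h.notMem ?_
    rw [← q1 t (by omega)]
    refine hq.mem_cylinder_of_long_piece S (by omega) (k := k + 1) (by omega) (by omega) hlen
      (fun j j1 j2 => ?_) hDq (by omega)
    rcases Nat.lt_or_ge j k with hj | hj
    · rw [c1 j hj.le, d1 j hj]
      exact h.pieces j j1 (by have := h.lt_last; omega)
    · obtain rfl : j = k := by omega
      rw [c1 j le_rfl]
      omega
  · refine long (by omega) h' h hG (fun j hj => (heq j hj).symm) ?_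
    by_contra hle
    have hmod' := hmod.symm
    rw [← Nat.ModEq, Nat.modEq_iff_dvd'] at hmod'
    · have := Nat.le_of_dvd (by omega) hmod'
      omega
    · omega

/-- The cylinders of `x` and `y` of lengths `l i` are contained, near `x`, in those of `x` and `z`
for all but a bounded number of values of `i`. -/
theorem ncard_not_subset_le (S : IsSetup K δ ε) {P : ℕ} (hP : ConeBound K ε P) {len : ℕ → ℕ}
    {I : Finset ℕ} {lmax : ℕ}
    (h10 : ∀ i ∈ I, 10 * mu δ ε ≤ len i) (hmax : ∀ i ∈ I, len i ≤ lmax)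
    (hstep : ∀ i ∈ I, ∀ j ∈ I, i < j → len i + 2 * ε ≤ len j)
    (hbad : ∀ i ∈ I, ∃ v, v ∈ cylinder K δ ε (len i) x y ∧ v ∉ cylinder K δ ε (len i) x z ∧
      2 * K.dist x v + 6 * lmax + 40 * mu δ ε + K.dist y z ≤ K.dist x y + K.dist x z) :
    I.card ≤ ((4 * mu δ ε + 2 * ε + 2) * (2 * P) + 1) ^ (mu δ ε + 1) * (2 * ε + 1) := by
  classical
  have k2 := eighty_thousand_mul_le_locScale (ε := ε) S.two_le
  have k3 := ten_mul_locScale_le_mu (δ := δ) (ε := ε)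
  have k4 := S.morse_le
  have hc := S.conn
  rcases I.eq_empty_or_nonempty with rfl | ⟨i₀, hi₀⟩
  · simp
  -- A position between the bad vertices and the centre of the triangle, the same for all `i`.
  set P₀ := (K.dist x y + K.dist x z - K.dist y z) / 2 - (2 * lmax + 12 * mu δ ε) with hP₀
  have hG : 2 * P₀ + 4 * lmax + 20 * mu δ ε + K.dist y z ≤ K.dist x y + K.dist x z := by
    obtain ⟨v, -, -, hv⟩ := hbad i₀ hi₀
    omega
  have hobs : ∀ i : I, ∃ (f : ℕ → V) (n N : ℕ) (c d : ℕ → ℕ) (p t k s : ℕ),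
      IsObstruction K δ ε x y z P₀ (len i) f n N c d p t k s := by
    rintro ⟨i, hi⟩
    obtain ⟨v, hv, hv', hd⟩ := hbad i hi
    have := hmax i hi
    have := h10 i hi
    exact exists_isObstruction (l := len i) S (h10 i hi) (by omega) hv hv' (by omega)
  choose f n N c d p t k s h using hobs
  have hxy : x ≠ y := by
    rintro rfl
    have := K.dist_comm (u := x) (v := z)
    rw [SimpleGraph.dist_self] at hG
    have := h10 i₀ hi₀
    omega
  obtain ⟨g, hg⟩ := exists_geodesic hc x y
  obtain ⟨w1, w2⟩ := hP.window hc hg (P₀ - morseConst δ) (4 * mu δ ε)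
  set W := {w | w ∈ conicalNeighbourhood K ε g ∧ P₀ - morseConst δ ≤ K.dist x w ∧
    K.dist x w ≤ P₀ - morseConst δ + 4 * mu δ ε} with hW
  set A := {L : List V | L.length ≤ mu δ ε + 1 ∧ ∀ w ∈ L, w ∈ W} with hA
  have hAcard := encard_lists_le W w1 (mu δ ε + 1)
  have hAfin : A.Finite := Set.finite_of_encard_le_coe hAcard
  have hAn : A.ncard ≤ ((4 * mu δ ε + 2 * ε + 2) * (2 * P) + 1) ^ (mu δ ε + 1) := by
    have h1 : A.ncard ≤ (W.ncard + 1) ^ (mu δ ε + 1) := by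
      rw [← hAfin.cast_ncard_eq] at hAcard
      exact_mod_cast hAcard
    exact h1.trans (Nat.pow_le_pow_left (by omega) _)
  -- An obstruction is determined by its segment, for which there are finitely many
  -- possibilities, and by a residue.
  set key : I → List V × ℕ := fun i => ((List.range (mu δ ε + 1)).map fun j => f i (s i + j),
    (d i (k i) - (s i + mu δ ε)) % (2 * ε + 1)) with hkey
  have hmem : ∀ i : I, key i ∈ hAfin.toFinset ×ˢ Finset.range (2 * ε + 1) := by
    intro i
    have hi := h i
    have hdn := hi.pre.d_le hi.lt_last.le
    have hld := hi.le_d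
    rw [Finset.mem_product, Set.Finite.mem_toFinset, Finset.mem_range]
    refine ⟨⟨by simp [hkey], fun w hw => ?_⟩, Nat.mod_lt _ (by omega)⟩
    obtain ⟨j, hj, rfl⟩ := List.mem_map.1 hw
    rw [List.mem_range] at hj
    obtain ⟨q, hq, hqs⟩ := hi.pre.edge.exists_quasiGeodesic_walk S.toIsHypGraph
      (hi.pre.isQG S.toIsHypGraph) hi.pre.first hi.pre.last
    have a1 := hi.pos_le (s i + j) (by omega) (by omega)
    have a2 := hi.pre.edge.dist_le (i := s i) (j := s i + j) (by omega) (by omega)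
    have a3 := hc.dist_triangle (u := x) (v := f i (s i)) (w := f i (s i + j))
    have a4 := hi.le_pos
    refine ⟨S.isConicalConstant x y hxy q g hq hg _ (hqs _ (by omega)), ?_, ?_⟩
    · omega
    · omega
  have hinj : Function.Injective key := by
    intro i j hij
    have h1 := congrArg Prod.fst hij
    have h2 : (d i (k i) - (s i + mu δ ε)) % (2 * ε + 1) =
      (d j (k j) - (s j + mu δ ε)) % (2 * ε + 1) := congrArg Prod.snd hij
    have h3 : ∀ m ≤ mu δ ε, f i (s i + m) = f j (s j + m) := fun m hm =>
      List.map_inj_left.1 h1 m (List.mem_range.2 (by omega))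
    have hmi := hmax i i.2
    have hmj := hmax j j.2
    rcases lt_trichotomy (i : ℕ) j with hlt | he | hlt
    · exact ((h i).false_of_eq S (h10 i i.2) (h j) (hstep i i.2 j j.2 hlt) (by omega) h3 h2).elim
    · exact Subtype.ext he
    · exact ((h j).false_of_eq S (h10 j j.2) (h i) (hstep j j.2 i i.2 hlt) (by omega)
        (fun m hm => (h3 m hm).symm) h2.symm).elim
  have hcard := Finset.card_le_card_of_injOn (s := I.attach) key (fun i _ => hmem i)
    (fun i _ j _ e => hinj e)
  rw [Finset.card_attach, Finset.card_product, Finset.card_range,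
    ← Set.ncard_eq_toFinset_card _ hAfin] at hcard
  exact hcard.trans (Nat.mul_le_mul_right _ hAn)

end Agreement

/-! ### Slice decompositions of the sides of a triangle -/

section Triangle

variable {x y z u v : V} {l Θ r M P : ℕ}

/-- The cylinders of `x`, `y` and of `x`, `z` have the same trace on the ball of centre `x` and
radius `(y · z)_x - r`. -/
def NearAgree (K : SimpleGraph V) (δ ε l r : ℕ) (x y z : V) : Prop :=
  ∀ u, 2 * K.dist x u + 2 * r + K.dist y z ≤ K.dist x y + K.dist x z →
    (u ∈ cylinder K δ ε l x y ↔ u ∈ cylinder K δ ε l x z)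

theorem NearAgree.swap (h : NearAgree K δ ε l r x y z) : NearAgree K δ ε l r x z y := by
  intro u hu
  have c := K.dist_comm (u := y) (v := z)
  exact (h u (by omega)).symm

/-- The vertex `v` is a parabolic slice of the cylinder of `a` and `b`. -/
abbrev IsPar (K : SimpleGraph V) (δ ε l Θ : ℕ) (a b v : V) : Prop :=
  IsParabolicSlice K Θ (cylinder K δ ε l a b) v

theorem IsPar.symm (hc : K.Connected) {a b : V} (h : IsPar K δ ε l Θ a b v) :
    IsPar K δ ε l Θ b a v := by
  unfold IsPar at *
  rwa [cylinder_symm hc]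

/-- A triangle whose cylinders agree near its vertices, without parabolic slice common to its
three cylinders, and none of whose vertices is a parabolic slice of the opposite side. -/
structure IsTameTriangle (K : SimpleGraph V) (δ ε l Θ r : ℕ) (x y z : V) : Prop where
  ne_xy : x ≠ y
  ne_xz : x ≠ z
  ne_yz : y ≠ z
  agree_x : NearAgree K δ ε l r x y z
  agree_y : NearAgree K δ ε l r y x z
  agree_z : NearAgree K δ ε l r z x y
  no_central : ∀ v, IsPar K δ ε l Θ x y v → IsPar K δ ε l Θ x z v → ¬ IsPar K δ ε l Θ y z v
  opp_x : ¬ IsPar K δ ε l Θ y z x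
  opp_y : ¬ IsPar K δ ε l Θ x z y
  opp_z : ¬ IsPar K δ ε l Θ x y z

theorem IsTameTriangle.swap_left (hc : K.Connected) (h : IsTameTriangle K δ ε l Θ r x y z) :
    IsTameTriangle K δ ε l Θ r y x z where
  ne_xy := h.ne_xy.symm
  ne_xz := h.ne_yz
  ne_yz := h.ne_xz
  agree_x := h.agree_y
  agree_y := h.agree_x
  agree_z := h.agree_z.swap
  no_central v h1 h2 h3 := h.no_central v (h1.symm hc) h3 h2
  opp_x := h.opp_y
  opp_y := h.opp_x
  opp_z h' := h.opp_z (h'.symm hc)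

theorem IsTameTriangle.swap_right (hc : K.Connected) (h : IsTameTriangle K δ ε l Θ r x y z) :
    IsTameTriangle K δ ε l Θ r x z y where
  ne_xy := h.ne_xz
  ne_xz := h.ne_xy
  ne_yz := h.ne_yz.symm
  agree_x := h.agree_x.swap
  agree_y := h.agree_z
  agree_z := h.agree_y
  no_central v h1 h2 h3 := h.no_central v h2 h1 (h3.symm hc)
  opp_x h' := h.opp_x (h'.symm hc)
  opp_y := h.opp_z
  opp_z := h.opp_y

/-- The list `H` is a hole of the side `x`, `y` of a triangle: it has at most `M` elements, and no
parabolic slice of this side in it is a parabolic slice of another side. -/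
def IsCommonFree (K : SimpleGraph V) (δ ε l Θ M : ℕ) (x y z : V) (H : List (Set V)) : Prop :=
  H.length ≤ M ∧ ∀ v, {v} ∈ H → IsPar K δ ε l Θ x y v →
    ¬ IsPar K δ ε l Θ x z v ∧ ¬ IsPar K δ ε l Θ y z v

theorem IsCommonFree.reverse (hc : K.Connected) {H : List (Set V)}
    (h : IsCommonFree K δ ε l Θ M x y z H) : IsCommonFree K δ ε l Θ M y x z H.reverse :=
  ⟨by rw [List.length_reverse]; exact h.1, fun v hv hp =>
    (h.2 v (List.mem_reverse.1 hv) (hp.symm hc)).symm⟩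

/-- The decompositions of the sides of a triangle form a tripod with holes which contain no
common parabolic slices. -/
def HasTripod (K : SimpleGraph V) (δ ε l Θ M : ℕ) (x y z : V) : Prop :=
  ∃ S T W Hx Hy Hz : List (Set V),
    IsSliceDecomposition K δ ε l Θ x y ({x} :: S ++ Hz ++ ({y} :: T).reverse) ∧
    IsSliceDecomposition K δ ε l Θ x z ({x} :: S ++ Hy ++ ({z} :: W).reverse) ∧
    IsSliceDecomposition K δ ε l Θ y z ({y} :: T ++ Hx ++ ({z} :: W).reverse) ∧
    IsCommonFree K δ ε l Θ M x y z Hz ∧ IsCommonFree K δ ε l Θ M x z y Hy ∧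
    IsCommonFree K δ ε l Θ M y z x Hx

theorem IsSliceDecomposition.reverse_tripod (S : IsSetup K δ ε) (hl : mu δ ε ≤ l)
    {A B C : List (Set V)} (h : IsSliceDecomposition K δ ε l Θ x y (A ++ B ++ C.reverse)) :
    IsSliceDecomposition K δ ε l Θ y x (C ++ B.reverse ++ A.reverse) := by
  simpa using h.reverse S hl

theorem HasTripod.swap_left (S : IsSetup K δ ε) (hl : mu δ ε ≤ l)
    (h : HasTripod K δ ε l Θ M x y z) : HasTripod K δ ε l Θ M y x z := by
  obtain ⟨A, T, W, Hx, Hy, Hz, h1, h2, h3, h4, h5, h6⟩ := h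
  exact ⟨T, A, W, Hy, Hx, Hz.reverse, h1.reverse_tripod S hl, h3, h2, h4.reverse S.conn, h6, h5⟩

theorem HasTripod.swap_right (S : IsSetup K δ ε) (hl : mu δ ε ≤ l)
    (h : HasTripod K δ ε l Θ M x y z) : HasTripod K δ ε l Θ M x z y := by
  obtain ⟨A, T, W, Hx, Hy, Hz, h1, h2, h3, h4, h5, h6⟩ := h
  exact ⟨A, W, T, Hx.reverse, Hz, Hy, h2, h1, h3.reverse_tripod S hl, h5, h4, h6.reverse S.conn⟩

theorem length_le_ncard_of_pairwise_disjoint : ∀ {H : List (Set V)} {W : Set V}, W.Finite →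
    H.Pairwise Disjoint → (∀ S ∈ H, S.Nonempty) → (∀ S ∈ H, S ⊆ W) → H.length ≤ W.ncard
  | [], _, _, _, _, _ => Nat.zero_le _
  | S :: H, W, hW, hd, hne, hsub => by
    obtain ⟨s, hs⟩ := hne S (by simp)
    have hd' := List.pairwise_cons.1 hd
    have ih := length_le_ncard_of_pairwise_disjoint (H := H) (W := W \ {s}) (hW.sdiff) hd'.2
      (fun T hT => hne T (List.mem_cons_of_mem _ hT)) fun T hT t ht =>
        ⟨hsub T (List.mem_cons_of_mem _ hT) ht, fun hts => Set.disjoint_left.1 (hd'.1 T hT) hs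
          ((show t = s from hts) ▸ ht)⟩
    have := Set.ncard_sdiff_singleton_add_one (hsub S (by simp) hs) hW
    simp only [List.length_cons]
    omega

/-- Near a corner of the triangle, the decompositions of the two sides coincide. -/
theorem NearAgree.exists_common_prefix (S : IsSetup K δ ε) (hΘ : 7 * baseAngle δ < Θ)
    (hag : NearAgree K δ ε l r x y z)
    (hno : ∀ v, IsPar K δ ε l Θ x y v → ¬ IsPar K δ ε l Θ x z v) {L L' : List (Set V)}
    (h : IsSliceDecomposition K δ ε l Θ x y L) (h' : IsSliceDecomposition K δ ε l Θ x z L') :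
    ∃ A Q Q' : List (Set V), L = {x} :: A ++ Q ∧ L' = {x} :: A ++ Q' ∧
      (∀ W ∈ ({x} :: A : List (Set V)), ∀ u ∈ W,
        u = x ∨ 2 * K.dist x u + 2 * r + K.dist y z ≤ K.dist x y + K.dist x z) ∧
      (∀ W ∈ Q, ∀ u ∈ W, K.dist x y + K.dist x z <
        2 * K.dist x u + 2 * r + 600 * δ + 4 + K.dist y z) ∧
      (∀ W ∈ Q', ∀ u ∈ W, K.dist x y + K.dist x z <
        2 * K.dist x u + 2 * r + 600 * δ + 4 + K.dist y z) := by
  have hc := S.conn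
  obtain ⟨B, rfl⟩ := h.eq_cons
  obtain ⟨B', rfl⟩ := h'.eq_cons
  rcases Nat.lt_or_ge (K.dist x y + K.dist x z) (2 * r + 2 + K.dist y z) with hlt | hge
  · refine ⟨[], B, B', rfl, rfl, fun W hW u hu => ?_, fun W _ u _ => by omega,
      fun W _ u _ => by omega⟩
    rw [List.mem_singleton.1 hW] at hu
    exact Or.inl hu
  · have t1 := hc.dist_triangle (u := x) (v := y) (w := z)
    have t2 := hc.dist_triangle (u := x) (v := z) (w := y)
    have c1 := K.dist_comm (u := y) (v := z)
    obtain ⟨A, Q, Q', e, e', h1, h2, h3⟩ := h.exists_common_prefix S hΘ h'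
      (r := (K.dist x y + K.dist x z - K.dist y z - 2 * r - 2) / 2)
      (fun u hu => hag u (by omega)) (by omega) (by omega) hno
    rcases A with _ | ⟨W₀, A⟩
    · -- The first slice `{x}` is always common.
      refine ⟨[], B, B', rfl, rfl, fun W hW u hu => ?_, fun W hW u hu => ?_, fun W hW u hu => ?_⟩
      · rw [List.mem_singleton.1 hW] at hu
        exact Or.inl hu
      · have := h2 W (by rw [List.nil_append] at e; rw [← e]; exact List.mem_cons_of_mem _ hW) u hu
        omega
      · have := h3 W (by
          rw [List.nil_append] at e'; rw [← e']; exact List.mem_cons_of_mem _ hW) u hu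
        omega
    · obtain ⟨rfl, rfl⟩ := List.cons.inj e
      obtain ⟨-, rfl⟩ := List.cons.inj e'
      refine ⟨A, Q, Q', rfl, rfl, fun W hW u hu => Or.inr ?_, fun W hW u hu => ?_,
        fun W hW u hu => ?_⟩
      · have := h1 W hW u hu
        omega
      · have := h2 W hW u hu
        omega
      · have := h3 W hW u hu
        omega

/-- A decomposition is made of its parts near the two corners and of a small hole. -/
theorem IsSliceDecomposition.exists_hole (S : IsSetup K δ ε) (hP : ConeBound K ε P)
    (hl : mu δ ε ≤ l) (hr : 1 ≤ r) (hxy : x ≠ y) {A B Q Q' : List (Set V)}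
    (h : IsSliceDecomposition K δ ε l Θ x y (A ++ Q)) (he : A ++ Q = (B ++ Q').reverse)
    (hA : ∀ W ∈ A, ∀ u ∈ W, u = x ∨
      2 * K.dist x u + 2 * r + K.dist y z ≤ K.dist x y + K.dist x z)
    (hB : ∀ W ∈ B, ∀ u ∈ W, u = y ∨
      2 * K.dist y u + 2 * r + K.dist x z ≤ K.dist y x + K.dist y z)
    (hQ : ∀ W ∈ Q, ∀ u ∈ W, K.dist x y + K.dist x z <
        2 * K.dist x u + 2 * r + 600 * δ + 4 + K.dist y z)
    (hQ' : ∀ W ∈ Q', ∀ u ∈ W, K.dist y x + K.dist y z <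
        2 * K.dist y u + 2 * r + 600 * δ + 4 + K.dist x z) :
    ∃ H : List (Set V), A ++ Q = A ++ H ++ B.reverse ∧
      H.length ≤ (2 * r + 700 * δ + 2 * ε + 2) * (2 * P) := by
  have hc := S.conn
  have c1 := K.dist_comm (u := x) (v := y)
  have c2 := K.dist_comm (u := z) (v := y)
  have t1 := hc.dist_triangle (u := x) (v := y) (w := z)
  have t2 := hc.dist_triangle (u := y) (v := x) (w := z)
  -- The parts near the two corners do not overlap.
  have hdisj : ∀ W ∈ A, W ∉ B := by
    intro W hWA hWB
    obtain ⟨u, hu⟩ := h.nonempty (T := W) (by simp [hWA])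
    have t3 := hc.dist_triangle (u := x) (v := u) (w := y)
    have c3 := K.dist_comm (u := u) (v := y)
    rcases hA W hWA u hu with rfl | h1 <;> rcases hB W hWB u hu with h2 | h2
    · exact hxy h2
    · omega
    · subst h2
      omega
    · omega
  rw [List.reverse_append] at he
  have hH : ∃ H, Q'.reverse = A ++ H ∧ Q = H ++ B.reverse := by
    rcases List.append_eq_append_iff.1 he with ⟨H, h1, h2⟩ | ⟨H, h1, h2⟩
    · exact ⟨H, h1, h2⟩
    · rcases H with _ | ⟨W, H⟩
      · exact ⟨[], by rw [h1]; simp, by simpa using h2.symm⟩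
      · exact absurd (List.mem_reverse.1 (by rw [h2]; simp : W ∈ B.reverse))
          (hdisj W (by rw [h1]; simp))
  obtain ⟨H, h1, rfl⟩ := hH
  refine ⟨H, by simp, ?_⟩
  obtain ⟨w1, w2⟩ := cylinder_window S hP hxy (l := l)
    ((K.dist x y + K.dist x z - K.dist y z - 2 * r - 600 * δ - 4) / 2) (2 * r + 700 * δ)
  have hd := h.disjoint
  refine (length_le_ncard_of_pairwise_disjoint w1 ?_ (fun W hW => h.nonempty (by simp [hW]))
    fun W hW u hu => ?_).trans w2
  · exact (List.pairwise_append.1 (List.pairwise_append.1 hd).2.1).1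
  · have huC := h.subset (T := W) (by simp [hW]) hu
    have q1 := hQ W (by simp [hW]) u hu
    have q2 := hQ' W (List.mem_reverse.1 (by rw [h1]; simp [hW])) u hu
    have q3 := dist_le_of_mem_cylinder S hl huC
    have c3 := K.dist_comm (u := u) (v := y)
    have := S.two_le
    exact ⟨huC, by omega, by omega⟩

/-- Triangles without parabolic slice common to two sides. -/
theorem IsTameTriangle.hasTripod_of_forall_not (S : IsSetup K δ ε) (hP : ConeBound K ε P)
    (hl : mu δ ε ≤ l) (hΘ : 7 * baseAngle δ < Θ) (hr : 1 ≤ r)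
    (hM : (2 * r + 700 * δ + 2 * ε + 2) * (2 * P) ≤ M)
    (h : IsTameTriangle K δ ε l Θ r x y z)
    (hx : ∀ v, IsPar K δ ε l Θ x y v → ¬ IsPar K δ ε l Θ x z v)
    (hy : ∀ v, IsPar K δ ε l Θ x y v → ¬ IsPar K δ ε l Θ y z v)
    (hz : ∀ v, IsPar K δ ε l Θ x z v → ¬ IsPar K δ ε l Θ y z v) :
    HasTripod K δ ε l Θ M x y z := by
  have hc := S.conn
  obtain ⟨L₁, h₁⟩ := exists_isSliceDecomposition S hP hl hΘ x y
  obtain ⟨L₂, h₂⟩ := exists_isSliceDecomposition S hP hl hΘ x z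
  obtain ⟨L₃, h₃⟩ := exists_isSliceDecomposition S hP hl hΘ y z
  have r₁ := h₁.reverse S hl
  have r₂ := h₂.reverse S hl
  have r₃ := h₃.reverse S hl
  obtain ⟨A, Q₁, Q₂, rfl, rfl, a1, a2, a3⟩ := h.agree_x.exists_common_prefix S hΘ hx h₁ h₂
  obtain ⟨B, R₁, Q₃, e1, rfl, b1, b2, b3⟩ := h.agree_y.exists_common_prefix S hΘ
    (fun v h1 h2 => hy v (h1.symm hc) h2) r₁ h₃
  obtain ⟨C, R₂, R₃, e2, e3, c1, c2, c3⟩ := h.agree_z.exists_common_prefix S hΘ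
    (fun v h1 h2 => hz v (h1.symm hc) (h2.symm hc)) r₂ r₃
  have d1 := K.dist_comm (u := x) (v := y)
  have d2 := K.dist_comm (u := x) (v := z)
  have d3 := K.dist_comm (u := y) (v := z)
  obtain ⟨Hz, f1, g1⟩ := h₁.exists_hole S hP hl hr h.ne_xy (z := z)
    (by rw [← e1, List.reverse_reverse]) a1 b1 a2 b2
  obtain ⟨Hy, f2, g2⟩ := h₂.exists_hole S hP hl hr h.ne_xz (z := y)
    (by rw [← e2, List.reverse_reverse])
    (fun W hW u hu => (a1 W hW u hu).imp_right fun h => by omega) c1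
    (fun W hW u hu => by have := a3 W hW u hu; omega) c2
  obtain ⟨Hx, f3, g3⟩ := h₃.exists_hole S hP hl hr h.ne_yz (z := x)
    (by rw [← e3, List.reverse_reverse])
    (fun W hW u hu => (b1 W hW u hu).imp_right fun h => by omega)
    (fun W hW u hu => (c1 W hW u hu).imp_right fun h => by omega)
    (fun W hW u hu => by have := b3 W hW u hu; omega)
    (fun W hW u hu => by have := c3 W hW u hu; omega)
  refine ⟨A, B, C, Hx, Hy, Hz, f1 ▸ h₁, f2 ▸ h₂, f3 ▸ h₃, ⟨g1.trans hM, fun v _ hp => ⟨hx v hp,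
    hy v hp⟩⟩, ⟨g2.trans hM, fun v _ hp => ⟨fun h' => hx v h' hp,
    fun h' => hz v hp (h'.symm hc)⟩⟩, ⟨g3.trans hM, fun v _ hp => ⟨fun h' => hy v (h'.symm hc) hp,
    fun h' => hz v (h'.symm hc) hp⟩⟩⟩

end Triangle

/-! ### Cutting triangles at common parabolic slices -/

section Cut

variable {x y z u v : V} {l Θ r M P : ℕ}

/-- A parabolic slice separates the two parts of its cylinder in the metric sense too. -/
theorem IsPar.isGate (S : IsSetup K δ ε) (hΘ : 7 * baseAngle δ < Θ) (h : IsPar K δ ε l Θ x y u) :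
    u ≠ x ∧ u ≠ y ∧ cylinder K δ ε l x y = cylinder K δ ε l x u ∪ cylinder K δ ε l u y ∧
      ∀ w ∈ cylinder K δ ε l x u, ∀ w' ∈ cylinder K δ ε l u y,
        K.dist w w' = K.dist w u + K.dist u w' := by
  have H := S.toIsHypGraph
  have hW := h.wide S (B := 5 * baseAngle δ) (by omega)
  exact ⟨hW.1, hW.2.1, hW.cylinder_eq S le_rfl, fun w hw w' hw' =>
    (show K.dist w u + K.dist u w' = K.dist w w' from hW.btw_of_onQG H le_rfl
      (OnQG.of_mem_cylinder H hw) (OnQG.of_mem_cylinder H hw')).symm⟩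

/-- A tame triangle can be cut at a parabolic slice common to two sides. -/
theorem IsTameTriangle.cut (S : IsSetup K δ ε) (hΘ : 7 * baseAngle δ < Θ) (hr : 1 ≤ r)
    (h : IsTameTriangle K δ ε l Θ r x y z) (hu : IsPar K δ ε l Θ x y u)
    (hu' : IsPar K δ ε l Θ x z u) : IsTameTriangle K δ ε l Θ r u y z := by
  have H := S.toIsHypGraph
  have hc := S.conn
  obtain ⟨n1, n2, C1, B1⟩ := hu.isGate S hΘ
  obtain ⟨n3, n4, C2, B2⟩ := hu'.isGate S hΘ
  have xm : ∀ w, x ∈ cylinder K δ ε l x w := left_mem_cylinder H x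
  have wm : ∀ w w', w ∈ cylinder K δ ε l w' w := fun w w' => right_mem_cylinder H w' w
  have um : ∀ w, u ∈ cylinder K δ ε l u w := left_mem_cylinder H u
  have e1 := B1 x (xm u) y (wm y u)
  have e2 := B2 x (xm u) z (wm z u)
  have hsub : ∀ {w : V}, IsPar K δ ε l Θ u y w → IsPar K δ ε l Θ x y w := fun hw =>
    (hu.split S hΘ).2 (Or.inr (Or.inr hw))
  have hsub' : ∀ {w : V}, IsPar K δ ε l Θ u z w → IsPar K δ ε l Θ x z w := fun hw =>
    (hu'.split S hΘ).2 (Or.inr (Or.inr hw))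
  have key : ∀ {y z : V}, cylinder K δ ε l x y = cylinder K δ ε l x u ∪ cylinder K δ ε l u y →
      (∀ w ∈ cylinder K δ ε l x u, ∀ w' ∈ cylinder K δ ε l u y,
        K.dist w w' = K.dist w u + K.dist u w') → NearAgree K δ ε l r y x z →
      K.dist x z = K.dist x u + K.dist u z → NearAgree K δ ε l r y u z := by
    intro y z C1 B1 hag e2 w hw
    have e1 := B1 x (xm u) y (wm y u)
    have c1 := K.dist_comm (u := x) (v := y)
    have c2 := K.dist_comm (u := u) (v := y)
    have c3 := K.dist_comm (u := w) (v := y)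
    have t1 := hc.dist_triangle (u := y) (v := u) (w := z)
    rw [← hag w (by omega), cylinder_symm hc l y x, cylinder_symm hc l y u, C1]
    refine ⟨Or.inr, fun hw' => hw'.resolve_left fun hw' => ?_⟩
    have := B1 w hw' y (wm y u)
    omega
  refine ⟨n2, n4, h.ne_yz, fun w hw => ?_, key C1 B1 h.agree_y e2, key C2 B2 h.agree_z e1,
    fun v h1 h2 h3 => h.no_central v (hsub h1) (hsub' h2) h3, fun h' => h.no_central u hu hu' h',
    fun h' => h.opp_y (hsub' h'), fun h' => h.opp_z (hsub h')⟩
  have side : ∀ {y z : V}, cylinder K δ ε l x y = cylinder K δ ε l x u ∪ cylinder K δ ε l u y →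
      (∀ w ∈ cylinder K δ ε l x u, ∀ w' ∈ cylinder K δ ε l u y,
        K.dist w w' = K.dist w u + K.dist u w') →
      cylinder K δ ε l x z = cylinder K δ ε l x u ∪ cylinder K δ ε l u z →
      (K.dist x w = K.dist x u + K.dist u w →
        (w ∈ cylinder K δ ε l x y ↔ w ∈ cylinder K δ ε l x z)) →
      w ∈ cylinder K δ ε l u y → w ∈ cylinder K δ ε l u z := by
    intro y z C1 B1 C2 hag hw
    have hwx := (hag (B1 x (xm u) w hw)).1 (by rw [C1]; exact Or.inr hw)
    rw [C2] at hwx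
    refine hwx.elim (fun hw' => ?_) id
    have e := B1 w hw' w hw
    rw [SimpleGraph.dist_self] at e
    rw [eq_of_dist_eq_zero hc (show K.dist w u = 0 by omega)]
    exact um z
  exact ⟨side C1 B1 C2 fun e => h.agree_x w (by omega),
    side C2 B2 C1 fun e => (h.agree_x w (by omega)).symm⟩

/-- The slices of the cylinder from `x` to the common parabolic slice `u` are added to the branch of
the tripod issued from `u`. -/
theorem HasTripod.of_cut (S : IsSetup K δ ε) (hΘ : 7 * baseAngle δ < Θ) (hP : ConeBound K ε P)
    (hl : mu δ ε ≤ l) (h : IsTameTriangle K δ ε l Θ r x y z) (hu : IsPar K δ ε l Θ x y u)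
    (hu' : IsPar K δ ε l Θ x z u) (hT : HasTripod K δ ε l Θ M u y z) :
    HasTripod K δ ε l Θ M x y z := by
  have H := S.toIsHypGraph
  have hc := S.conn
  obtain ⟨A, B, C, Hx, Hy, Hz, h1, h2, h3, h4, h5, h6⟩ := hT
  obtain ⟨L, hL⟩ := exists_isSliceDecomposition S hP hl hΘ x u
  obtain ⟨L', rfl⟩ := hL.eq_cons
  have j1 := hL.append S hΘ (L₂ := A ++ Hz ++ ({y} :: B).reverse) (by simpa using h1) hu
  have j2 := hL.append S hΘ (L₂ := A ++ Hy ++ ({z} :: C).reverse) (by simpa using h2) hu'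
  obtain ⟨n1, n2, C1, B1⟩ := hu.isGate S hΘ
  obtain ⟨n3, n4, C2, B2⟩ := hu'.isGate S hΘ
  -- A parabolic slice in a hole lies beyond `u`.
  have key : ∀ {y : V} {Hz T : List (Set V)}, IsPar K δ ε l Θ x y u →
      (∀ w ∈ cylinder K δ ε l x u, ∀ w' ∈ cylinder K δ ε l u y,
        K.dist w w' = K.dist w u + K.dist u w') →
      IsSliceDecomposition K δ ε l Θ u y ({u} :: A ++ Hz ++ T) → ∀ v, {v} ∈ Hz →
      v ≠ u ∧ v ∉ cylinder K δ ε l x u := by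
    intro y Hz T hu B1 h1 v hv
    have hvu : v ≠ u := by
      rintro rfl
      have hd := h1.disjoint
      rw [List.cons_append, List.cons_append, List.pairwise_cons] at hd
      exact Set.disjoint_left.1 (hd.1 {v} (by simp [hv])) rfl rfl
    refine ⟨hvu, fun hv' => hvu ?_⟩
    have e := B1 v hv' v (h1.subset (T := {v}) (by simp [hv]) rfl)
    rw [SimpleGraph.dist_self] at e
    exact eq_of_dist_eq_zero hc (by omega)
  have far : ∀ {y v : V}, IsPar K δ ε l Θ x y u → v ≠ u ∧ v ∉ cylinder K δ ε l x u →
      IsPar K δ ε l Θ x y v → IsPar K δ ε l Θ u y v := by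
    rintro y v hu ⟨hv1, hv2⟩ hv
    rcases (hu.split S hΘ).1 hv with h | h | h
    · exact absurd h.1 hv2
    · exact absurd h hv1
    · exact h
  refine ⟨L' ++ A, B, C, Hx, Hy, Hz, by simpa using j1, by simpa using j2, h3,
    ⟨h4.1, fun v hv hp => ?_⟩, ⟨h5.1, fun v hv hp => ?_⟩, ⟨h6.1, fun v hv hp => ?_⟩⟩
  · have hv' := key hu B1 h1 v hv
    have := h4.2 v hv (far hu hv' hp)
    exact ⟨fun h' => this.1 (far hu' hv' h'), this.2⟩
  · have hv' := key hu' B2 h2 v hv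
    have := h5.2 v hv (far hu' hv' hp)
    exact ⟨fun h' => this.1 (far hu hv' h'), this.2⟩
  · have := h6.2 v hv hp
    have aux : ∀ {y z : V}, IsPar K δ ε l Θ x y u → IsPar K δ ε l Θ x z u →
        (IsPar K δ ε l Θ x y v → ¬ IsPar K δ ε l Θ x z v) → ¬ IsPar K δ ε l Θ u y v → v ≠ u →
        ¬ IsPar K δ ε l Θ x y v := by
      intro y z hu hu' hno hv hvu h'
      rcases (hu.split S hΘ).1 h' with h | h | h
      · exact hno h' ((hu'.split S hΘ).2 (Or.inl h))
      · exact hvu h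
      · exact hv h
    have hvu : v ≠ u := by
      rintro rfl
      exact h.no_central v hu hu' hp
    exact ⟨fun h' => aux hu hu' (fun a b => h.no_central v a b hp)
        (fun h'' => this.1 (h''.symm hc)) hvu (h'.symm hc),
      fun h' => aux hu' hu (fun a b => h.no_central v b a hp)
        (fun h'' => this.2 (h''.symm hc)) hvu (h'.symm hc)⟩

/-- By induction on the perimeter, cutting the triangle at common parabolic slices. -/
theorem IsTameTriangle.hasTripod (S : IsSetup K δ ε) (hP : ConeBound K ε P)
    (hl : mu δ ε ≤ l) (hΘ : 7 * baseAngle δ < Θ) (hr : 1 ≤ r)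
    (hM : (2 * r + 700 * δ + 2 * ε + 2) * (2 * P) ≤ M)
    (h : IsTameTriangle K δ ε l Θ r x y z) : HasTripod K δ ε l Θ M x y z := by
  have H := S.toIsHypGraph
  have hc := S.conn
  induction hd : K.dist x y + K.dist x z + K.dist y z using Nat.strong_induction_on
    generalizing x y z with
  | _ m ih =>
    subst hd
    have step : ∀ {x y z u : V}, IsTameTriangle K δ ε l Θ r x y z → IsPar K δ ε l Θ x y u →
        IsPar K δ ε l Θ x z u → (∀ {x' y' z' : V}, IsTameTriangle K δ ε l Θ r x' y' z' →
          K.dist x' y' + K.dist x' z' + K.dist y' z' < K.dist x y + K.dist x z + K.dist y z →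
          HasTripod K δ ε l Θ M x' y' z') → HasTripod K δ ε l Θ M x y z := by
      intro x y z u h hu hu' ih
      obtain ⟨n1, n2, -, B1⟩ := hu.isGate S hΘ
      obtain ⟨n3, n4, -, B2⟩ := hu'.isGate S hΘ
      have e1 := B1 x (left_mem_cylinder H x u) y (right_mem_cylinder H u y)
      have e2 := B2 x (left_mem_cylinder H x u) z (right_mem_cylinder H u z)
      have p1 := hc.pos_dist_of_ne n1.symm
      exact HasTripod.of_cut S hΘ hP hl h hu hu' (ih (h.cut S hΘ hr hu hu') (by omega))
    have c1 := K.dist_comm (u := x) (v := y)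
    have c2 := K.dist_comm (u := x) (v := z)
    have c3 := K.dist_comm (u := y) (v := z)
    by_cases hx : ∃ v, IsPar K δ ε l Θ x y v ∧ IsPar K δ ε l Θ x z v
    · obtain ⟨v, hv, hv'⟩ := hx
      exact step h hv hv' fun h' hlt => ih _ hlt h' rfl
    by_cases hy : ∃ v, IsPar K δ ε l Θ x y v ∧ IsPar K δ ε l Θ y z v
    · obtain ⟨v, hv, hv'⟩ := hy
      exact (step (h.swap_left hc) (hv.symm hc) hv' fun h' hlt =>
        ih _ (by omega) h' rfl).swap_left S hl
    by_cases hz : ∃ v, IsPar K δ ε l Θ x z v ∧ IsPar K δ ε l Θ y z v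
    · obtain ⟨v, hv, hv'⟩ := hz
      exact ((step ((h.swap_right hc).swap_left hc) (hv.symm hc) (hv'.symm hc) fun h' hlt =>
        ih _ (by omega) h' rfl).swap_left S hl).swap_right S hl
    push Not at hx hy hz
    exact h.hasTripod_of_forall_not S hP hl hΘ hr hM hx hy hz

/-! ### Tripods of slices -/

theorem IsHole.congr {C C' : Set V} {N A : ℕ} {L L' : List (Set V)} (h : IsHole K Θ N A C L)
    (hC : C = C') (hL : ∀ S, S ∈ L' ↔ S ∈ L) (hlen : L'.length = L.length) :
    IsHole K Θ N A C' L' := by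
  subst hC
  exact ⟨hlen ▸ h.1, fun v hv => h.2 v ((hL _).1 hv)⟩

theorem SlicesFormTripod.swap_left (S : IsSetup K δ ε) (hl : mu δ ε ≤ l) {A : ℕ}
    (h : SlicesFormTripod K δ ε l Θ M A x y z) : SlicesFormTripod K δ ε l Θ M A y x z := by
  have e := cylinder_symm (δ := δ) (ε := ε) S.conn l x y
  obtain ⟨L, T, W, ⟨Hx, Hy, Hz, h1, h2, h3, h4, h5, h6⟩ | ⟨v, h1, h2, h3, h4, h5, h6⟩⟩ := h
  · exact ⟨T, L, W, Or.inl ⟨Hy, Hx, Hz.reverse, h1.reverse_tripod S hl, h3, h2,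
      h4.congr e (fun _ => List.mem_reverse) List.length_reverse, h6, h5⟩⟩
  · exact ⟨T, L, W, Or.inr ⟨v, e ▸ h1, h3, h2, by simpa using h4.reverse_tripod S hl, h6, h5⟩⟩

theorem SlicesFormTripod.swap_right (S : IsSetup K δ ε) (hl : mu δ ε ≤ l) {A : ℕ}
    (h : SlicesFormTripod K δ ε l Θ M A x y z) : SlicesFormTripod K δ ε l Θ M A x z y := by
  have e := cylinder_symm (δ := δ) (ε := ε) S.conn l y z
  obtain ⟨L, T, W, ⟨Hx, Hy, Hz, h1, h2, h3, h4, h5, h6⟩ | ⟨v, h1, h2, h3, h4, h5, h6⟩⟩ := h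
  · exact ⟨L, W, T, Or.inl ⟨Hx.reverse, Hz, Hy, h2, h1, h3.reverse_tripod S hl, h5, h4,
      h6.congr e (fun _ => List.mem_reverse) List.length_reverse⟩⟩
  · exact ⟨L, W, T, Or.inr ⟨v, h2, h1, e ▸ h3, h5, h4, by simpa using h6.reverse_tripod S hl⟩⟩

theorem isHole_nil (C : Set V) (N A : ℕ) : IsHole K Θ N A C [] :=
  ⟨Nat.zero_le _, fun _ h => by simp at h⟩

/-- Degenerate triangles. -/
theorem slicesFormTripod_of_eq (S : IsSetup K δ ε) (hP : ConeBound K ε P) (hl : mu δ ε ≤ l)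
    (hΘ : 7 * baseAngle δ < Θ) (hM : 1 ≤ M) (A : ℕ) (x z : V) :
    SlicesFormTripod K δ ε l Θ M A x x z := by
  obtain ⟨L, h⟩ := exists_isSliceDecomposition S hP hl hΘ x z
  obtain ⟨L', rfl⟩ := h.eq_cons
  refine ⟨[{x}], [], L'.reverse, Or.inl ⟨[{x}], [], [],
    by simpa using isSliceDecomposition_self S.toIsHypGraph x, by simpa using h,
    by simpa using h, isHole_nil _ _ _, isHole_nil _ _ _, hM, fun v hv hp => ?_⟩⟩
  have : v = x := by simpa using hv
  exact absurd this (hp.ne S (by omega)).1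

/-- Triangles one vertex of which is a parabolic slice of the opposite side. -/
theorem slicesFormTripod_of_isPar (S : IsSetup K δ ε) (hP : ConeBound K ε P) (hl : mu δ ε ≤ l)
    (hΘ : 7 * baseAngle δ < Θ) (hM : 1 ≤ M) (A : ℕ) (h : IsPar K δ ε l Θ x y z) :
    SlicesFormTripod K δ ε l Θ M A x y z := by
  obtain ⟨L, h₁⟩ := exists_isSliceDecomposition S hP hl hΘ x z
  obtain ⟨T, h₂⟩ := exists_isSliceDecomposition S hP hl hΘ z y
  obtain ⟨T, rfl⟩ := h₂.eq_cons
  have h₃ := h₂.reverse S hl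
  refine ⟨L, T.reverse, [], Or.inl ⟨[{z}], [], [], by simpa using h₁.append S hΘ h₂ h,
    by simpa using h₁, by simpa using h₃, isHole_nil _ _ _, isHole_nil _ _ _, hM,
    fun v hv hp => ?_⟩⟩
  have : v = z := by simpa using hv
  exact absurd this (hp.ne S (by omega)).2

/-- Triangles with a central parabolic slice. -/
theorem slicesFormTripod_of_central (S : IsSetup K δ ε) (hP : ConeBound K ε P) (hl : mu δ ε ≤ l)
    (hΘ : 7 * baseAngle δ < Θ) (A : ℕ) (h₁ : IsPar K δ ε l Θ x y v) (h₂ : IsPar K δ ε l Θ x z v)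
    (h₃ : IsPar K δ ε l Θ y z v) : SlicesFormTripod K δ ε l Θ M A x y z := by
  obtain ⟨L, l₁⟩ := exists_isSliceDecomposition S hP hl hΘ x v
  obtain ⟨T, l₂⟩ := exists_isSliceDecomposition S hP hl hΘ y v
  obtain ⟨W, l₃⟩ := exists_isSliceDecomposition S hP hl hΘ z v
  obtain ⟨L, rfl⟩ := l₁.eq_concat S hl
  obtain ⟨T, rfl⟩ := l₂.eq_concat S hl
  obtain ⟨W, rfl⟩ := l₃.eq_concat S hl
  have r₂ := l₂.reverse S hl
  have r₃ := l₃.reverse S hl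
  rw [List.reverse_append] at r₂ r₃
  exact ⟨L, T, W, Or.inr ⟨v, h₁, h₂, h₃, l₁.append S hΘ r₂ h₁, l₁.append S hΘ r₃ h₂,
    l₂.append S hΘ r₃ h₃⟩⟩

/-- A parabolic slice of large angle of one side is a parabolic slice of another one, which is
excluded in a hole. -/
theorem IsCommonFree.isHole (S : IsSetup K δ ε) (hΘ : 7 * baseAngle δ < Θ) {H : List (Set V)}
    (h : IsCommonFree K δ ε l Θ M x y z H) (hz : ¬ IsPar K δ ε l Θ x y z) :
    IsHole K Θ M (3 * Θ + 100 * δ) (cylinder K δ ε l x y) H := by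
  refine ⟨h.1, fun v hv hp => ?_⟩
  by_contra hlt
  have := h.2 v hv hp
  rcases isParabolicSlice_or_of_lt_sliceAngle S (Θ := Θ) (by omega) (z := z)
    (fun e => hz (e ▸ hp)) hlt with h' | h'
  · exact this.1 h'
  · exact this.2 h'

/-- Slice decompositions of the sides of a triangle whose cylinders agree near its vertices. -/
theorem slicesFormTripod_of_nearAgree (S : IsSetup K δ ε) (hP : ConeBound K ε P) (hl : mu δ ε ≤ l)
    (hΘ : 7 * baseAngle δ < Θ) (hr : 1 ≤ r) (hM1 : 1 ≤ M)
    (hM : (2 * r + 700 * δ + 2 * ε + 2) * (2 * P) ≤ M) (hx : NearAgree K δ ε l r x y z)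
    (hy : NearAgree K δ ε l r y x z) (hz : NearAgree K δ ε l r z x y) :
    SlicesFormTripod K δ ε l Θ M (3 * Θ + 100 * δ) x y z := by
  have hc := S.conn
  rcases eq_or_ne x y with rfl | hxy
  · exact slicesFormTripod_of_eq S hP hl hΘ hM1 _ x z
  rcases eq_or_ne x z with rfl | hxz
  · exact (slicesFormTripod_of_eq S hP hl hΘ hM1 _ x y).swap_right S hl
  rcases eq_or_ne y z with rfl | hyz
  · exact ((slicesFormTripod_of_eq S hP hl hΘ hM1 _ y x).swap_right S hl).swap_left S hl
  by_cases oz : IsPar K δ ε l Θ x y z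
  · exact slicesFormTripod_of_isPar S hP hl hΘ hM1 _ oz
  by_cases oy : IsPar K δ ε l Θ x z y
  · exact (slicesFormTripod_of_isPar S hP hl hΘ hM1 _ oy).swap_right S hl
  by_cases ox : IsPar K δ ε l Θ y z x
  · exact ((slicesFormTripod_of_isPar S hP hl hΘ hM1 _ ox).swap_right S hl).swap_left S hl
  by_cases hcen : ∃ v, IsPar K δ ε l Θ x y v ∧ IsPar K δ ε l Θ x z v ∧ IsPar K δ ε l Θ y z v
  · obtain ⟨v, h1, h2, h3⟩ := hcen
    exact slicesFormTripod_of_central S hP hl hΘ _ h1 h2 h3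
  push Not at hcen
  obtain ⟨A, B, C, Hx, Hy, Hz, h1, h2, h3, h4, h5, h6⟩ := IsTameTriangle.hasTripod S hP hl hΘ hr hM
    ⟨hxy, hxz, hyz, hx, hy, hz, hcen, ox, oy, oz⟩
  exact ⟨_, _, _, Or.inl ⟨Hx, Hy, Hz, h1, h2, h3, h4.isHole S hΘ oz, h5.isHole S hΘ oy,
    h6.isHole S hΘ ox⟩⟩

end Cut

/-! ### The choice of the length of the pieces -/

/-- The pigeonhole principle choosing the length of the pieces. -/
theorem exists_forall_not_of_card_le {ι : Type*} (A : Finset ι) (bad : ι → ℕ → Prop) {C I : ℕ}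
    (h : ∀ a ∈ A, ∀ J ⊆ Finset.Icc 1 I, (∀ i ∈ J, bad a i) → J.card ≤ C) (hI : A.card * C < I) :
    ∃ i ∈ Finset.Icc 1 I, ∀ a ∈ A, ¬ bad a i := by
  classical
  by_contra hne
  push Not at hne
  have hsub : Finset.Icc 1 I ⊆ A.biUnion fun a => (Finset.Icc 1 I).filter (bad a) := by
    intro i hi
    obtain ⟨a, ha, hb⟩ := hne i hi
    exact Finset.mem_biUnion.2 ⟨a, ha, Finset.mem_filter.2 ⟨hi, hb⟩⟩
  have h1 := Finset.card_le_card hsub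
  have h2 := Finset.card_biUnion_le_card_mul A (fun a => (Finset.Icc 1 I).filter (bad a)) C
    fun a ha => h a ha _ (Finset.filter_subset _ _) fun i hi => (Finset.mem_filter.1 hi).2
  rw [Nat.card_Icc] at h1
  omega

/-- The trace of the cylinder of `x`, `y` on the ball of centre `x` and radius `(y · z)_x - r` is
contained in the cylinder of `x`, `z`. -/
def NearSubset (K : SimpleGraph V) (δ ε l r : ℕ) (x y z : V) : Prop :=
  ∀ u, 2 * K.dist x u + 2 * r + K.dist y z ≤ K.dist x y + K.dist x z →
    u ∈ cylinder K δ ε l x y → u ∈ cylinder K δ ε l x z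

theorem NearSubset.nearAgree {l r : ℕ} {x y z : V} (h : NearSubset K δ ε l r x y z)
    (h' : NearSubset K δ ε l r x z y) : NearAgree K δ ε l r x y z := by
  intro u hu
  have c := K.dist_comm (u := y) (v := z)
  exact ⟨h u hu, h' u (by omega)⟩

theorem NearAgree.cylindersAgree {l r r' : ℕ} {x y z : V} (h : NearAgree K δ ε l r x y z)
    (hr : r ≤ r') : CylindersAgree K δ ε l r' x y z := by
  ext u
  simp only [Set.mem_inter_iff, Set.mem_ofPred_eq, gromovProduct]
  refine and_congr_left fun hu => h u ?_
  have hr' : (r : ℝ) ≤ r' := by exact_mod_cast hr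
  have : (2 * K.dist x u + 2 * r + K.dist y z : ℝ) ≤ K.dist x y + K.dist x z := by linarith
  exact_mod_cast this

/-- For a given number of triangles, among the lengths `10 μ + 2 i ε` with `i` in a sufficiently
large interval there is one for which the cylinders of all these triangles agree near the
vertices. -/
theorem exists_nearSubset (S : IsSetup K δ ε) {P : ℕ} (hP : ConeBound K ε P)
    (A : Finset (V × V × V)) {I : ℕ}
    (hI : A.card * (((4 * mu δ ε + 2 * ε + 2) * (2 * P) + 1) ^ (mu δ ε + 1) * (2 * ε + 1)) < I) :
    ∃ i ∈ Finset.Icc 1 I, ∀ a ∈ A, NearSubset K δ ε (10 * mu δ ε + 2 * i * ε)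
      (3 * (10 * mu δ ε + 2 * I * ε) + 20 * mu δ ε) a.1 a.2.1 a.2.2 := by
  have key : ∀ a ∈ A, ∀ J ⊆ Finset.Icc 1 I, (∀ i ∈ J, ¬ NearSubset K δ ε
      (10 * mu δ ε + 2 * i * ε) (3 * (10 * mu δ ε + 2 * I * ε) + 20 * mu δ ε) a.1 a.2.1 a.2.2) →
      J.card ≤ ((4 * mu δ ε + 2 * ε + 2) * (2 * P) + 1) ^ (mu δ ε + 1) * (2 * ε + 1) := by
    intro a _ J hJ hbad
    refine ncard_not_subset_le S hP (x := a.1) (y := a.2.1) (z := a.2.2)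
      (len := fun i => 10 * mu δ ε + 2 * i * ε) (lmax := 10 * mu δ ε + 2 * I * ε)
      (fun i _ => Nat.le_add_right _ _) (fun i hi => ?_) (fun i _ j _ hij => ?_) fun i hi => ?_
    · have h1 := (Finset.mem_Icc.1 (hJ hi)).2
      have : 2 * i * ε ≤ 2 * I * ε := Nat.mul_le_mul_right _ (by omega)
      show 10 * mu δ ε + 2 * i * ε ≤ _
      omega
    · have h1 : (2 * i + 2) * ε ≤ 2 * j * ε := Nat.mul_le_mul_right _ (by omega)
      have h2 : (2 * i + 2) * ε = 2 * i * ε + 2 * ε := by ring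
      show 10 * mu δ ε + 2 * i * ε + 2 * ε ≤ 10 * mu δ ε + 2 * j * ε
      omega
    · have := hbad i hi
      simp only [NearSubset, not_forall] at this
      obtain ⟨u, h1, h2, h3⟩ := this
      exact ⟨u, h2, h3, by omega⟩
  obtain ⟨i, hi, h⟩ := exists_forall_not_of_card_le A _ key hI
  exact ⟨i, hi, fun a ha => not_not.1 (h a ha)⟩

end CanonicalSlices

theorem mainTheorem3 (δ : ℕ) (hδ : 2 ≤ δ) :
    ∃ D₀ ε₀ : ℕ, ∀ ε : ℕ, ε₀ ≤ ε →
      ∀ (V : Type*) (Γ : Type*) [Group Γ] [MulAction Γ V] (𝒢 : Set (Subgroup Γ))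
        (K : SimpleGraph V), IsAssociatedGraph Γ 𝒢 K δ →
      (∀ D : ℕ, D₀ ≤ D → IsStabilityConstant K (lam δ) D) ∧
      IsConicalConstant K (lam δ) ε ∧
      ∃ Cap₀ : ℕ, ∀ Cap : ℕ, Cap₀ ≤ Cap →
        IsChannelBound K ε (mu δ ε) Cap ∧
        ∀ (p : V) (F : Finset Γ) (n : ℕ), n = (2 * F.card) ^ 3 →
          ∃ i l : ℕ, 1 ≤ i ∧ 2 * i * ε ≤ phi ε Cap n ∧ l = 10 * mu δ ε + 2 * i * ε ∧
            ∀ α β γ : Γ, (α ∈ F ∨ α⁻¹ ∈ F) → (β ∈ F ∨ β⁻¹ ∈ F) → (γ ∈ F ∨ γ⁻¹ ∈ F) →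
              α * β * γ = 1 →
              ∀ x y z : V, x = p → y = α • p → z = γ⁻¹ • p →
                (CylindersAgree K δ ε l (4 * (11 * mu δ ε + phi ε Cap n)) x y z ∧
                  CylindersAgree K δ ε l (4 * (11 * mu δ ε + phi ε Cap n)) y z x ∧
                  CylindersAgree K δ ε l (4 * (11 * mu δ ε + phi ε Cap n)) z x y) ∧
                ∀ D ρ Θ : ℕ, D₀ ≤ D → Θ = max (10000 * (D + ε + δ)) ρ →
                  SlicesFormTripod K δ ε l Θ (10 * phi ε Cap n) (3 * Θ + 100 * δ) x y z := by
  refine ⟨morseConst δ, 1000 * (baseAngle δ + δ + 1), fun ε hε V Γ _ _ 𝒢 K hK => ?_⟩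
  have S : IsSetup K δ ε := ⟨⟨hK.connected, hK.hyperbolic, hδ⟩, hε⟩
  obtain ⟨P, hP⟩ : ∃ P, ConeBound K ε P := exists_cone_bound hK ε
  refine ⟨fun D hD => isStabilityConstant_of_morseConst_le hK.connected (by omega) hK.hyperbolic hD,
    S.isConicalConstant, ?_⟩
  set μ := mu δ ε with hμ
  set C := ((4 * μ + 2 * ε + 2) * (2 * P) + 1) ^ (μ + 1) * (2 * ε + 1) with hC
  set C₁ := ((μ + ε + 2 * ε + 2) * (2 * P) + 1) ^ (2 * (μ + 1 + ε) + 1) with hC₁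
  -- A bound for the size of the holes, divided by `n + 1`.
  set Y := (100 * μ + 14 * ε + 72 * C * ε + 700 * δ + 2) * (2 * P) with hY
  refine ⟨C + C₁ + μ + Y + 1, fun Cap hCap => ⟨hP.isChannelBound hK.connected
    ((show C₁ ≤ Cap by omega)), fun p F n hn => ?_⟩⟩
  classical
  set E := F ∪ F.image (·⁻¹) with hE
  have hEmem : ∀ γ : Γ, (γ ∈ F ∨ γ⁻¹ ∈ F) → γ ∈ E := by
    rintro γ (h | h)
    · exact Finset.mem_union_left _ h
    · exact Finset.mem_union_right _ (Finset.mem_image.2 ⟨γ⁻¹, h, inv_inv γ⟩)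
  have hEcard : E.card ≤ 2 * F.card := by
    have h1 : E.card ≤ F.card + (F.image (·⁻¹)).card := Finset.card_union_le _ _
    have h2 := Finset.card_image_le (s := F) (f := (·⁻¹))
    omega
  -- The triangles under consideration, with their vertices in all possible orders.
  set A : Finset (V × V × V) := (E ×ˢ E ×ˢ E).biUnion fun τ =>
    {(p, τ.1 • p, τ.2.2⁻¹ • p), (p, τ.2.2⁻¹ • p, τ.1 • p), (τ.1 • p, p, τ.2.2⁻¹ • p),
      (τ.1 • p, τ.2.2⁻¹ • p, p), (τ.2.2⁻¹ • p, p, τ.1 • p), (τ.2.2⁻¹ • p, τ.1 • p, p)} with hA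
  have hAcard : A.card ≤ n * 6 := by
    refine (Finset.card_biUnion_le_card_mul _ _ 6 fun τ _ => Finset.card_le_six).trans ?_
    refine Nat.mul_le_mul_right 6 ?_
    rw [Finset.card_product, Finset.card_product, hn, pow_three]
    exact Nat.mul_le_mul hEcard (Nat.mul_le_mul hEcard hEcard)
  have hI : A.card * C < 6 * n * C + 1 := by
    have := Nat.mul_le_mul_right C hAcard
    rw [show 6 * n * C = n * 6 * C by ring]
    omega
  obtain ⟨i, hi, hgood⟩ := exists_nearSubset S hP A hI
  set I := 6 * n * C + 1 with hI'
  have hi' := Finset.mem_Icc.1 hi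
  set φ := phi ε Cap n with hφ
  have hε1 : 1 ≤ ε := by omega
  have hφ1 : 24 * ((n + 1) * Cap) * ε ≤ φ := by
    have : φ = 24 * ((n + 1) * Cap) * ε * (2 * ε + 1) := by rw [hφ, phi]; ring
    rw [this]
    exact Nat.le_mul_of_pos_right _ (by omega)
  have hφ2 : 24 * ((n + 1) * Cap) ≤ φ := (Nat.le_mul_of_pos_right _ hε1).trans hφ1
  have hCapn : Cap ≤ (n + 1) * Cap := Nat.le_mul_of_pos_left _ (by omega)
  have hIφ : 2 * I * ε ≤ φ := by
    refine le_trans (Nat.mul_le_mul_right ε ?_) hφ1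
    have h1 : (n + 1) * (C + 1) ≤ (n + 1) * Cap := Nat.mul_le_mul_left _ (by omega)
    have h2 : (n + 1) * (C + 1) = n * C + C + n + 1 := by ring
    have h3 : 6 * n * C = 6 * (n * C) := by ring
    omega
  set r := 3 * (10 * μ + 2 * I * ε) + 20 * μ with hr
  set l := 10 * μ + 2 * i * ε with hl
  have hM : (2 * r + 700 * δ + 2 * ε + 2) * (2 * P) ≤ 10 * φ := by
    have h1 : 2 * r + 700 * δ + 2 * ε + 2 ≤
        (n + 1) * (100 * μ + 14 * ε + 72 * C * ε + 700 * δ + 2) := by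
      have e1 : 2 * r = 100 * μ + 72 * (n * C * ε) + 12 * ε := by rw [hr, hI']; ring
      have e2 : (n + 1) * (100 * μ + 14 * ε + 72 * C * ε + 700 * δ + 2) =
          n * (100 * μ + 14 * ε + 700 * δ + 2) + 72 * (n * C * ε) +
            (100 * μ + 14 * ε + 72 * C * ε + 700 * δ + 2) := by ring
      omega
    have h2 := Nat.mul_le_mul_right (2 * P) h1
    rw [mul_assoc, ← hY] at h2
    have h3 : (n + 1) * Y ≤ (n + 1) * Cap := Nat.mul_le_mul_left _ (by omega)
    omega
  have hrφ : r ≤ 4 * (11 * μ + φ) := by omega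
  have hμε : ε ≤ μ := by
    have h1 := eighty_thousand_mul_le_locScale (ε := ε) hδ
    have h2 := ten_mul_locScale_le_mu (δ := δ) (ε := ε)
    omega
  refine ⟨i, l, hi'.1, le_trans (Nat.mul_le_mul_right ε (by omega)) hIφ, rfl, ?_⟩
  rintro α β γ hα hβ hγ - x y z rfl rfl rfl
  have hmem : ∀ a ∈ ({(x, α • x, γ⁻¹ • x), (x, γ⁻¹ • x, α • x), (α • x, x, γ⁻¹ • x),
      (α • x, γ⁻¹ • x, x), (γ⁻¹ • x, x, α • x), (γ⁻¹ • x, α • x, x)} : Finset (V × V × V)),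
      NearSubset K δ ε l r a.1 a.2.1 a.2.2 := fun a ha =>
    hgood a (Finset.mem_biUnion.2 ⟨(α, β, γ), Finset.mem_product.2 ⟨hEmem α hα,
      Finset.mem_product.2 ⟨hEmem β hβ, hEmem γ hγ⟩⟩, ha⟩)
  have ax := (hmem (x, α • x, γ⁻¹ • x) (by simp)).nearAgree (hmem (x, γ⁻¹ • x, α • x) (by simp))
  have ay := (hmem (α • x, x, γ⁻¹ • x) (by simp)).nearAgree (hmem (α • x, γ⁻¹ • x, x) (by simp))
  have az := (hmem (γ⁻¹ • x, x, α • x) (by simp)).nearAgree (hmem (γ⁻¹ • x, α • x, x) (by simp))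
  refine ⟨⟨ax.cylindersAgree hrφ, ay.swap.cylindersAgree hrφ, az.cylindersAgree hrφ⟩, ?_⟩
  intro D ρ Θ _ hΘ
  refine slicesFormTripod_of_nearAgree S hP (by omega) ?_ (by omega) (by omega) hM ax ay az
  have : 10000 * (D + ε + δ) ≤ Θ := hΘ ▸ le_max_left _ _
  omega
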